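/- **Setting.** Let $X\subseteq\mathbb R^d$ be closed and convex, let $\xi$ and $\zeta$ be random variables with values in $\Xi$ and $Z$, and consider $$\min_{x\in X} f(x):=\mathbb E[\tilde f(x,\xi)]\quad\text{subject to}\quad c_i(x):=\mathbb E[\tilde c_i(x,\zeta)]=0,\ i=1,\dots,m,$$ with $f,c_i$ differentiable at the points of $X$; write $c=(c_1,\dots,c_m)$ and $\nabla c(x)^\top\lambda=\sum_i\lambda_i\nabla c_i(x)$. There are oracles $\tilde\nabla f,\tilde\nabla c_i$ with $\mathbb E\tilde\nabla f(x,\xi)=\nabla f(x)$ and $\mathbb E\tilde\nabla c_i(x,\zeta)=\nabla c_i(x)$ for $x\in X$. $P_X$ is the Euclidean projection onto $X$, $N_X(x)=\{v:\langle v,y-x\rangle\le 0\ \forall y\in X\}$ is the normal cone, $\mathsf d$ is the Euclidean distance to a set, and $Q_r(x)=f(x)+\frac r2\sum_i c_i(x)^2$. **Assumptions.** For all $x,y\in X$, all $i$, all values of $\zeta$ and all $r>0$: (A2) $\mathbb E\|\tilde\nabla f(x,\xi)-\tilde\nabla f(y,\xi)\|^2\le\tilde L_{\nabla f}^2\|x-y\|^2$,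 $\ \mathbb E\|\tilde\nabla c_i(x,\zeta)-\tilde\nabla c_i(y,\zeta)\|^2\le\tilde L_{\nabla c}^2\|x-y\|^2$, $\ \mathbb E|\tilde c_i(x,\zeta)-\tilde c_i(y,\zeta)|^2\le\tilde L_c^2\|x-y\|^2$; (A3) $\mathbb E\|\tilde\nabla f(x,\xi)-\nabla f(x)\|^2\le\sigma_f^2$, $\ \mathbb E\|\tilde\nabla c_i(x,\zeta)-\nabla c_i(x)\|^2\le\sigma_{\nabla c}^2$, $\ \mathbb E|\tilde c_i(x,\zeta)-c_i(x)|^2\le\sigma_c^2$; (A4) $\|\nabla c_i(x)\|\le C_{\nabla c}$, $|c_i(x)|\le C_c$, $\|\tilde\nabla c_i(x,\zeta)\|\le\tilde C_{\nabla c}$, $|\tilde c_i(x,\zeta)|\le\tilde C_c$, $\|\nabla f(x)\|\le C_{\nabla f}$, $Q_r(x)\ge\underline Q>-\infty$, and $|f(x_k)|\le B_f$ almost surely for the iterates $x_k$, $k\ge1$, of the algorithm below; (A5) for some $\delta>0$, the iterates satisfy $\mathsf d(\nabla c(x_k)^\top c(x_k),-N_X(x_k))\ge\delta\|c(x_k)\|$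 almost surely for all $k\ge1$. **Algorithm (stochastic linearized ALM).** Let $B_k=(\xi^0_k,\zeta^1_k,\zeta^2_k)$, $k\ge1$, be independent over $k$, where $\xi_k^0$ is distributed as $\xi$ and $\zeta^1_k,\zeta^2_k$ are independent and distributed as $\zeta$. For $B=(\xi^0,\zeta^1,\zeta^2)$ put $$\tilde\nabla Q_r(x,\lambda,B)=\tilde\nabla f(x,\xi^0)+\sum_{i=1}^m\lambda_i\tilde\nabla c_i(x,\zeta^1)+r\sum_{i=1}^m\tilde\nabla c_i(x,\zeta^1)\,\tilde c_i(x,\zeta^2).$$ Given $x_1\in X$ and $\lambda_1\in\mathbb R^m$, let $g_1=\tilde\nabla Q_{\rho_1}(x_1,\lambda_1,B_1)$, and for $k\ge1$ $$x_{k+1}=P_X(x_k-\eta_kg_k),\qquad \lambda_{k+1,i}=\lambda_{k,i}+\gamma_{k,i}\,\tilde c_i(x_k,\zeta_k^2)\quad(1\le i\le m),$$ $$g_{k+1}=\tilde\nabla Q_{\rho_{k+1}}(x_{k+1},\lambda_{k+1},B_{k+1})+(1-\alpha_{k+1})\big(g_k-\tilde\nabla Q_{\rho_k}(x_k,\lambda_k,B_{k+1})\big),$$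 with constants $\rho>1$, $\gamma>0$ and $$\eta_k=\frac1{9\tilde L\rho(k+1)^{3/5}},\quad \rho_k=\rho k^{1/5},\quad \alpha_{k+1}=\frac{72}{81(k+1)^{4/5}},\quad \gamma_{k,i}=\frac{\gamma}{k(\log(k+1))^2\,|\tilde c_i(x_k,\zeta^2_k)|}$$ (the dual increment being $0$ when $\tilde c_i(x_k,\zeta_k^2)=0$), where $\tilde L>0$ and $$\tilde L^2=\tfrac34\tilde L_{\nabla f}^2+\tfrac34m^2(\|\lambda_1\|+4)^2\tilde L_{\nabla c}^2+\tfrac32m^2\big(\tilde C_c^2\tilde L_{\nabla c}^2+\tilde C_{\nabla c}^2\tilde L_c^2\big).$$ **Theorem.** Assume (A2)–(A5). Then the method reaches an $\varepsilon$-stationary point in expectation within $\widetilde O(\varepsilon^{-5})$ iterations. Precisely, there are a universal $e\in\mathbb N$ and a $C>0$ depending only on $m$, $\rho$, $\gamma$, $\lambda_1$ and the constants in (A2)–(A5), such that for every $\varepsilon\in(0,1]$ and every integer $K\ge C\varepsilon^{-5}(1+\log(1/\varepsilon))^e$, if $\hat k$ is uniformly distributed on $\{1,\dots,K\}$ and independent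 of the samples, there is a random vector $\lambda\in\mathbb R^m$ with $$\mathbb E\,\mathsf d\big(\nabla f(x_{\hat k+1})+\nabla c(x_{\hat k+1})^\top\lambda,\,-N_X(x_{\hat k+1})\big)\le\varepsilon\qquad\text{and}\qquad\mathbb E\|c(x_{\hat k+1})\|\le\varepsilon.$$ -/

import Mathlib

open MeasureTheory ProbabilityTheory

noncomputable section

namespace StochALM

/-- The decision space `ℝ^d` with its Euclidean structure. -/
abbrev Vec (d : ℕ) := EuclideanSpace ℝ (Fin d)

/-- `h` has a finite expectation, and it is at most `b`. -/
def ExpLE {α : Type*} [MeasurableSpace α] (μ : Measure α) (h : α → ℝ) (b : ℝ) : Prop :=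
  Integrable h μ ∧ ∫ a, h a ∂μ ≤ b

/-- The normal cone of convex analysis to `X` at a point `x ∈ X`. -/
def normalCone {d : ℕ} (X : Set (Vec d)) (x : Vec d) : Set (Vec d) :=
  {v | ∀ y ∈ X, inner ℝ v (y - x) ≤ 0}

/-- The distance from `v` to `-N_X(x)`. -/
def distNegNormal {d : ℕ} (X : Set (Vec d)) (x v : Vec d) : ℝ :=
  Metric.infDist v {w | -w ∈ normalCone X x}

/-- The metric projection onto `X`: the point of `X` nearest to `v`, which exists and is unique
when `X` is nonempty, closed and convex. -/
def proj {d : ℕ} (X : Set (Vec d)) (v : Vec d) : Vec d :=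
  Classical.epsilon fun y => y ∈ X ∧ dist v y = Metric.infDist v X

/-- The data of the problem `min_{x ∈ X} E f̃(x, ξ)` subject to `E c̃_i(x, ζ) = 0`, `i < m`,
together with the stochastic gradient oracles `gradF = ∇̃f` and `gradC i = ∇̃c_i`;
`lawXi` and `lawZeta` are the distributions of `ξ` and `ζ`. -/
structure Problem (d m : ℕ) (Ξ Z : Type*) [MeasurableSpace Ξ] [MeasurableSpace Z] where
  X : Set (Vec d)
  lawXi : Measure Ξ
  lawZeta : Measure Z
  fTilde : Vec d → Ξ → ℝ
  cTilde : Fin m → Vec d → Z → ℝ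
  gradF : Vec d → Ξ → Vec d
  gradC : Fin m → Vec d → Z → Vec d

/-- The constants of the assumptions. The names ending in `T` carry a tilde in the usual notation:
`LgradF, LgradC, Lc` are the mean-square Lipschitz constants of `∇̃f, ∇̃c_i, c̃_i`;
`sigF, sigGradC, sigC` bound the standard deviations; `CgradC, Cc` bound `∇c_i, c_i`;
`CgradCT, CcT` bound `∇̃c_i, c̃_i`; `Bf, CgradF` bound `f, ∇f`; `Qlow` bounds the penalty function
below; `delta` is the constant of the regularity condition. -/
structure Constants where
  LgradF : ℝ
  LgradC : ℝ
  Lc : ℝ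
  sigF : ℝ
  sigGradC : ℝ
  sigC : ℝ
  CgradC : ℝ
  Cc : ℝ
  CgradCT : ℝ
  CcT : ℝ
  Bf : ℝ
  CgradF : ℝ
  Qlow : ℝ
  delta : ℝ

namespace Problem

variable {d m : ℕ} {Ξ Z : Type*} [MeasurableSpace Ξ] [MeasurableSpace Z]

/-- The objective `f(x) = E f̃(x, ξ)`. -/
def f (p : Problem d m Ξ Z) (x : Vec d) : ℝ := ∫ ξ, p.fTilde x ξ ∂p.lawXi

/-- The `i`-th constraint function `c_i(x) = E c̃_i(x, ζ)`. -/
def c (p : Problem d m Ξ Z) (i : Fin m) (x : Vec d) : ℝ := ∫ ζ, p.cTilde i x ζ ∂p.lawZeta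

/-- The constraint map `c = (c_1, …, c_m)`. -/
def cVec (p : Problem d m Ξ Z) (x : Vec d) : Vec m := WithLp.toLp 2 fun i => p.c i x

/-- `∇c(x)ᵀ l`, where `∇c(x)` is the Jacobian. -/
def jacT (p : Problem d m Ξ Z) (x : Vec d) (l : Vec m) : Vec d :=
  ∑ i, l i • gradient (p.c i) x

/-- The quadratic penalty function `Q_r(x) = f(x) + (r/2) ∑ c_i(x)²`. -/
def penalty (p : Problem d m Ξ Z) (r : ℝ) (x : Vec d) : ℝ :=
  p.f x + r / 2 * ∑ i, p.c i x ^ 2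

/-- The problem setting: `X` is closed and convex, `f` and `c_i` are well-defined expectations,
differentiable at the points of `X`, and the gradient oracles are measurable and unbiased. -/
structure Setting (p : Problem d m Ξ Z) : Prop where
  closed : IsClosed p.X
  convex : Convex ℝ p.X
  probXi : IsProbabilityMeasure p.lawXi
  probZeta : IsProbabilityMeasure p.lawZeta
  integrable_f : ∀ x, Integrable (p.fTilde x) p.lawXi
  integrable_c : ∀ i x, Integrable (p.cTilde i x) p.lawZeta
  measurable_c : ∀ i, Measurable fun a : Vec d × Z => p.cTilde i a.1 a.2
  measurable_gradF : Measurable fun a : Vec d × Ξ => p.gradF a.1 a.2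
  measurable_gradC : ∀ i, Measurable fun a : Vec d × Z => p.gradC i a.1 a.2
  diff_f : ∀ x ∈ p.X, DifferentiableAt ℝ p.f x
  diff_c : ∀ i, ∀ x ∈ p.X, DifferentiableAt ℝ (p.c i) x
  unbiased_f : ∀ x ∈ p.X,
    Integrable (p.gradF x) p.lawXi ∧ ∫ ξ, p.gradF x ξ ∂p.lawXi = gradient p.f x
  unbiased_c : ∀ i, ∀ x ∈ p.X,
    Integrable (p.gradC i x) p.lawZeta ∧ ∫ ζ, p.gradC i x ζ ∂p.lawZeta = gradient (p.c i) x

/-- Mean-square Lipschitz continuity of the oracles. -/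
structure A2 (p : Problem d m Ξ Z) (k : Constants) : Prop where
  gradF : ∀ x ∈ p.X, ∀ y ∈ p.X,
    ExpLE p.lawXi (fun ξ => ‖p.gradF x ξ - p.gradF y ξ‖ ^ 2) (k.LgradF ^ 2 * ‖x - y‖ ^ 2)
  gradC : ∀ i, ∀ x ∈ p.X, ∀ y ∈ p.X,
    ExpLE p.lawZeta (fun ζ => ‖p.gradC i x ζ - p.gradC i y ζ‖ ^ 2) (k.LgradC ^ 2 * ‖x - y‖ ^ 2)
  c : ∀ i, ∀ x ∈ p.X, ∀ y ∈ p.X,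
    ExpLE p.lawZeta (fun ζ => |p.cTilde i x ζ - p.cTilde i y ζ| ^ 2) (k.Lc ^ 2 * ‖x - y‖ ^ 2)

/-- Variance bounds. -/
structure A3 (p : Problem d m Ξ Z) (k : Constants) : Prop where
  gradF : ∀ x ∈ p.X, ExpLE p.lawXi (fun ξ => ‖p.gradF x ξ - gradient p.f x‖ ^ 2) (k.sigF ^ 2)
  gradC : ∀ i, ∀ x ∈ p.X,
    ExpLE p.lawZeta (fun ζ => ‖p.gradC i x ζ - gradient (p.c i) x‖ ^ 2) (k.sigGradC ^ 2)
  c : ∀ i, ∀ x ∈ p.X, ExpLE p.lawZeta (fun ζ => |p.cTilde i x ζ - p.c i x| ^ 2) (k.sigC ^ 2)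

/-- Boundedness on `X`. (The bound on `f`, which is only required along the iterates, is in
`AlongIterates`.) -/
structure A4 (p : Problem d m Ξ Z) (k : Constants) : Prop where
  gradC : ∀ i, ∀ x ∈ p.X, ‖gradient (p.c i) x‖ ≤ k.CgradC
  c : ∀ i, ∀ x ∈ p.X, |p.c i x| ≤ k.Cc
  gradCTilde : ∀ i, ∀ x ∈ p.X, ∀ ζ, ‖p.gradC i x ζ‖ ≤ k.CgradCT
  cTilde : ∀ i, ∀ x ∈ p.X, ∀ ζ, |p.cTilde i x ζ| ≤ k.CcT
  gradF : ∀ x ∈ p.X, ‖gradient p.f x‖ ≤ k.CgradF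
  penalty : ∀ r > 0, ∀ x ∈ p.X, k.Qlow ≤ p.penalty r x

/-- The stochastic gradient in `x` of the augmented Lagrangian with multiplier `l` and penalty
parameter `r`, from the sample `b = (ξ⁰, ζ¹, ζ²)`. -/
def gradQ (p : Problem d m Ξ Z) (r : ℝ) (x : Vec d) (l : Vec m) (b : Ξ × Z × Z) : Vec d :=
  p.gradF x b.1 + ∑ i, l i • p.gradC i x b.2.1
    + r • ∑ i, p.cTilde i x b.2.2 • p.gradC i x b.2.1

end Problem

/-- The user's choices: the constants `ρ` and `γ` and the initial multiplier `λ₁`. -/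
structure Params (m : ℕ) where
  rho : ℝ
  gamma : ℝ
  lam1 : Vec m

/-- `L̃² = (3/4) L̃_{∇f}² + (3/4) m² (‖λ₁‖ + 4)² L̃_{∇c}² +
(3/2) m² (C̃_c² L̃_{∇c}² + C̃_{∇c}² L̃_c²)`. -/
def LTildeSq {m : ℕ} (k : Constants) (q : Params m) : ℝ :=
  3 / 4 * k.LgradF ^ 2 + 3 / 4 * (m : ℝ) ^ 2 * (‖q.lam1‖ + 4) ^ 2 * k.LgradC ^ 2
    + 3 / 2 * (m : ℝ) ^ 2 * (k.CcT ^ 2 * k.LgradC ^ 2 + k.CgradCT ^ 2 * k.Lc ^ 2)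

/-- Primal step sizes `η_k = 1 / (9 L̃ ρ (k+1)^{3/5})`. -/
def etaSeq {m : ℕ} (κ : Constants) (q : Params m) (k : ℕ) : ℝ :=
  1 / (9 * √(LTildeSq κ q) * q.rho * ((k : ℝ) + 1) ^ (3 / 5 : ℝ))

/-- Penalty parameters `ρ_k = ρ k^{1/5}`. -/
def rhoSeq {m : ℕ} (q : Params m) (k : ℕ) : ℝ := q.rho * (k : ℝ) ^ (1 / 5 : ℝ)

/-- Momentum parameters `α_k = 72 / (81 k^{4/5})`. -/
def alphaSeq (k : ℕ) : ℝ := 72 / (81 * (k : ℝ) ^ (4 / 5 : ℝ))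

/-- Dual step size `γ_{k,i} = γ / (k log²(k+1) |c̃_i(x_k, ζ²_k)|)`, as a function of the value
`t = c̃_i(x_k, ζ²_k)`. For `t = 0` the increment `γ_{k,i} t` is zero whatever the step size. -/
def gammaSeq {m : ℕ} (q : Params m) (k : ℕ) (t : ℝ) : ℝ :=
  q.gamma / ((k : ℝ) * Real.log ((k : ℝ) + 1) ^ 2 * |t|)

/-- The triple `(x_k, λ_k, g_k)`. -/
structure State (d m : ℕ) where
  x : Vec d
  lam : Vec m
  g : Vec d

section Algorithm

variable {d m : ℕ} {Ξ Z : Type*} [MeasurableSpace Ξ] [MeasurableSpace Z]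

/-- One iteration: from `(x_k, λ_k, g_k)` and the samples `b = B_k`, `b' = B_{k+1}` to
`(x_{k+1}, λ_{k+1}, g_{k+1})`. -/
def step (p : Problem d m Ξ Z) (κ : Constants) (q : Params m) (k : ℕ)
    (s : State d m) (b b' : Ξ × Z × Z) : State d m :=
  let x' : Vec d := proj p.X (s.x - etaSeq κ q k • s.g)
  let l' : Vec m := WithLp.toLp 2 fun i =>
    s.lam i + gammaSeq q k (p.cTilde i s.x b.2.2) * p.cTilde i s.x b.2.2
  { x := x'
    lam := l'
    g := p.gradQ (rhoSeq q (k + 1)) x' l' b'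
      + (1 - alphaSeq (k + 1)) • (s.g - p.gradQ (rhoSeq q k) s.x s.lam b') }

/-- The run of the algorithm on the sample sequence `B 1, B 2, …` (`B 0` is not used):
`run … n = (x_{n+1}, λ_{n+1}, g_{n+1})`. -/
def run (p : Problem d m Ξ Z) (κ : Constants) (q : Params m) (x1 : Vec d)
    (B : ℕ → Ξ × Z × Z) : ℕ → State d m
  | 0 => { x := x1, lam := q.lam1, g := p.gradQ (rhoSeq q 1) x1 q.lam1 (B 1) }
  | n + 1 => step p κ q (n + 1) (run p κ q x1 B n) (B (n + 1)) (B (n + 2))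

variable {Ω : Type*} [MeasurableSpace Ω]

/-- The random primal iterate `x_k`, for `k ≥ 1`. -/
def iterX (p : Problem d m Ξ Z) (κ : Constants) (q : Params m) (x1 : Vec d)
    (B : ℕ → Ω → Ξ × Z × Z) (k : ℕ) (ω : Ω) : Vec d :=
  (run p κ q x1 (fun j => B j ω) (k - 1)).x

/-- The samples `B_k = (ξ⁰_k, ζ¹_k, ζ²_k)`, `k ≥ 1`, are independent over `k`, `ξ⁰_k` has the
law of `ξ`, and `ζ¹_k, ζ²_k` are i.i.d. with the law of `ζ`. -/
structure Sampling (p : Problem d m Ξ Z) (P : Measure Ω) (B : ℕ → Ω → Ξ × Z × Z) : Prop where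
  measurable : ∀ k ≥ 1, Measurable (B k)
  indep : iIndepFun (fun k => B (k + 1)) P
  lawXi : ∀ k ≥ 1, P.map (fun ω => (B k ω).1) = p.lawXi
  lawZeta : ∀ k ≥ 1, P.map (fun ω => (B k ω).2) = p.lawZeta.prod p.lawZeta

/-- The assumptions made along the iterates: `|f(x_k)| ≤ B_f`, and the regularity condition
`d(∇c(x_k)ᵀ c(x_k), -N_X(x_k)) ≥ δ ‖c(x_k)‖`. -/
structure AlongIterates (p : Problem d m Ξ Z) (κ : Constants) (q : Params m) (x1 : Vec d)
    (P : Measure Ω) (B : ℕ → Ω → Ξ × Z × Z) : Prop where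
  f_bound : ∀ k ≥ 1, ∀ᵐ ω ∂P, |p.f (iterX p κ q x1 B k ω)| ≤ κ.Bf
  A5 : ∀ k ≥ 1, ∀ᵐ ω ∂P,
    κ.delta * ‖p.cVec (iterX p κ q x1 B k ω)‖ ≤
      distNegNormal p.X (iterX p κ q x1 B k ω)
        (p.jacT (iterX p κ q x1 B k ω) (p.cVec (iterX p κ q x1 B k ω)))

/-- The random point `xbar` is `ε`-stationary in expectation: for some random multiplier `l`,
`E d(∇f(xbar) + ∇c(xbar)ᵀ l, -N_X(xbar)) ≤ ε` and `E ‖c(xbar)‖ ≤ ε`. -/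
def StationaryInExpectation (p : Problem d m Ξ Z) (P : Measure Ω) (xbar : Ω → Vec d)
    (ε : ℝ) : Prop :=
  ∃ l : Ω → Vec m, Measurable l ∧
    ExpLE P (fun ω =>
      distNegNormal p.X (xbar ω) (gradient p.f (xbar ω) + p.jacT (xbar ω) (l ω))) ε ∧
    ExpLE P (fun ω => ‖p.cVec (xbar ω)‖) ε

end Algorithm

end StochALM

end

noncomputable section

namespace StochALM

/-! ### Projections, normal cones and the descent inequality -/

section Geometry

variable {d : ℕ} {X : Set (Vec d)}

/-! The dual steps are normalised by the size of the sampled constraint, so the multipliers move by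
summable deterministic amounts and stay bounded (`abs_lam_le`). The method then behaves like a
stochastic projected gradient method for a quadratic penalty with growing weight. In the scale t =
(n+1)^{1/5} the penalty is ρt, and with u the value of t at the next index the primal step is η =
1/(9Lu³) and the momentum is 8/(9u⁴), where L = L̃ρ.

Four expectations are followed: the squared error s of the gradient estimator, the squared
displacement d, the augmented Lagrangian φ and the squared infeasibility c. Recursive momentum
contracts s and feeds it with sampling noise, with d times a squared Lipschitz constant, and with
parameter drift (`expLE_gradErr_succ`). A projected step lowers φ by about d/(2η), at the price of
ηs/2 and of a term in c caused by the growing penalty (`lagr_succ_le`). The regularity condition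
bounds c by a multiple of t⁻²(d/η² + s + 1) (`infeasibility_le`, `integral_cVec_sq_le`), which makes
that last term negligible. `Recursion` collects these facts about real sequences, and `recursion`
proves them for the algorithm.

The Lyapunov function φ + t s/(8L) falls by (d/η² + s)/(162Lu³) up to an error O(t⁻⁵), which is
harmonic in n (`Recursion.lyapunov_step`). Since φ is bounded below, the sum of d/η² + s over the
first K = t⁵ iterations is O(t³ log K) (`Recursion.exists_sum_le`), so its average is O(t⁻² log K).
This average controls the squared stationarity residual, with multiplier λ_k + ρ_k c(x_{k+1}), and,
up to O(t⁻²), the squared infeasibility. It is below ε² once K is ε⁻⁵ times a power of a logarithm.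

The Lyapunov estimate needs t to be large: L̃ is built from ‖λ₁‖ + 4 instead of the true bound on
the multipliers, and the feedback of c must be small. The finitely many earlier iterations are
bounded crudely by quantities that depend on the constants only, so that C does not depend on the
problem instance. -/

theorem proj_spec (hc : IsClosed X) (hne : X.Nonempty) (v : Vec d) :
    proj X v ∈ X ∧ dist v (proj X v) = Metric.infDist v X := by
  obtain ⟨y, hy, h⟩ := hc.exists_infDist_eq_dist hne v
  exact Classical.epsilon_spec (p := fun y => y ∈ X ∧ dist v y = Metric.infDist v X) ⟨y, hy, h.symm⟩

theorem proj_mem (hc : IsClosed X) (hne : X.Nonempty) (v : Vec d) : proj X v ∈ X :=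
  (proj_spec hc hne v).1

theorem inner_sub_proj_le (hc : IsClosed X) (hconv : Convex ℝ X) (hne : X.Nonempty) (v : Vec d)
    {y : Vec d} (hy : y ∈ X) : inner ℝ (v - proj X v) (y - proj X v) ≤ 0 := by
  have h := proj_spec hc hne v
  refine (norm_eq_iInf_iff_real_inner_le_zero hconv h.1).1 ?_ y hy
  rw [← dist_eq_norm, h.2, Metric.infDist_eq_iInf]
  simp [dist_eq_norm]

theorem dist_proj_le (hc : IsClosed X) (hconv : Convex ℝ X) (hne : X.Nonempty) (v w : Vec d) :
    dist (proj X v) (proj X w) ≤ dist v w := by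
  have h1 := inner_sub_proj_le hc hconv hne v (proj_mem hc hne w)
  have h2 := inner_sub_proj_le hc hconv hne w (proj_mem hc hne v)
  rw [dist_eq_norm, dist_eq_norm]
  set a := proj X v
  set b := proj X w
  -- The sum of the two variational inequalities, each tested at the other projection, is ‖a - b‖² ≤
  -- ⟨v - w, a - b⟩.
  have h3 : ‖a - b‖ * ‖a - b‖ ≤ ‖v - w‖ * ‖a - b‖ := by
    have h4 : inner ℝ (v - w) (a - b) ≤ ‖v - w‖ * ‖a - b‖ := real_inner_le_norm _ _
    have h5 : inner ℝ (v - a) (b - a) + inner ℝ (w - b) (a - b)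
        = ‖a - b‖ * ‖a - b‖ - inner ℝ (v - w) (a - b) := by
      rw [← real_inner_self_eq_norm_mul_norm, ← neg_sub a b, inner_neg_right, ← sub_eq_neg_add,
        ← inner_sub_left, ← inner_sub_left]
      congr 1
      abel
    linarith
  rcases (norm_nonneg (a - b)).eq_or_lt with h0 | h0
  · rw [← h0]; positivity
  · exact le_of_mul_le_mul_right h3 h0

theorem measurable_proj (hc : IsClosed X) (hconv : Convex ℝ X) (hne : X.Nonempty) :
    Measurable (proj X) :=
  (LipschitzWith.of_dist_le_mul (K := 1)
    (by simpa using dist_proj_le hc hconv hne)).continuous.measurable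

theorem zero_mem_neg_normal (x : Vec d) : (0 : Vec d) ∈ {w | -w ∈ normalCone X x} := by
  simp [normalCone]

theorem isClosed_neg_normal (x : Vec d) : IsClosed {w : Vec d | -w ∈ normalCone X x} := by
  have e : {w : Vec d | -w ∈ normalCone X x} = ⋂ y ∈ X, {w | inner ℝ (-w) (y - x) ≤ 0} := by
    ext w; simp [normalCone]
  rw [e]
  exact isClosed_biInter fun y _ => isClosed_le (by fun_prop) continuous_const

theorem distNegNormal_nonneg (x v : Vec d) : 0 ≤ distNegNormal X x v := Metric.infDist_nonneg

theorem distNegNormal_le_add (x v w : Vec d) :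
    distNegNormal X x v ≤ distNegNormal X x w + ‖v - w‖ := by
  rw [← dist_eq_norm]; exact Metric.infDist_le_infDist_add_dist

/-- The normal cone is stable under positive scaling, so the scaled nearest point gives one
inequality for every positive factor. The other inequality is the same one for r⁻¹. -/
theorem distNegNormal_smul {r : ℝ} (hr : 0 < r) (x v : Vec d) :
    distNegNormal X x (r • v) = r * distNegNormal X x v := by
  have hmem : ∀ (r : ℝ), 0 < r → ∀ w : Vec d, -w ∈ normalCone X x → -(r • w) ∈ normalCone X x := by
    intro r hr w hw y hy
    rw [← smul_neg, real_inner_smul_left]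
    exact mul_nonpos_of_nonneg_of_nonpos hr.le (hw y hy)
  have key : ∀ (r : ℝ), 0 < r → ∀ v, distNegNormal X x (r • v) ≤ r * distNegNormal X x v := by
    intro r hr v
    obtain ⟨w, hw, h⟩ := (isClosed_neg_normal (X := X) x).exists_infDist_eq_dist
      ⟨0, zero_mem_neg_normal x⟩ v
    unfold distNegNormal
    rw [h, dist_eq_norm]
    refine (Metric.infDist_le_dist_of_mem (s := {w | -w ∈ normalCone X x}) (hmem r hr w hw)).trans ?_
    rw [dist_eq_norm, ← smul_sub, norm_smul, Real.norm_of_nonneg hr.le]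
  refine le_antisymm (key r hr v) ?_
  have h := key r⁻¹ (inv_pos.2 hr) (r • v)
  rw [smul_smul, inv_mul_cancel₀ hr.ne', one_smul] at h
  calc r * distNegNormal X x v ≤ r * (r⁻¹ * distNegNormal X x (r • v)) := by gcongr
    _ = _ := by field_simp

/-- A projected gradient step certifies approximate stationarity of its end point. -/
theorem distNegNormal_proj_le (hc : IsClosed X) (hconv : Convex ℝ X) (hne : X.Nonempty)
    {η : ℝ} (hη : 0 < η) (x g v : Vec d) :
    distNegNormal X (proj X (x - η • g)) v
      ≤ ‖v - g‖ + ‖proj X (x - η • g) - x‖ / η := by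
  set y := proj X (x - η • g) with hy
  have hmem : g + η⁻¹ • (y - x) ∈ {w | -w ∈ normalCone X y} := by
    intro z hz
    have h := inner_sub_proj_le hc hconv hne (x - η • g) hz
    rw [← hy] at h
    have e : -(g + η⁻¹ • (y - x)) = η⁻¹ • (x - η • g - y) := by
      rw [smul_sub, smul_sub, smul_sub, smul_smul, inv_mul_cancel₀ hη.ne', one_smul]; abel
    rw [e, real_inner_smul_left]
    exact mul_nonpos_of_nonneg_of_nonpos (inv_pos.2 hη).le h
  refine (Metric.infDist_le_dist_of_mem hmem).trans ?_
  rw [dist_eq_norm, ← sub_sub]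
  refine (norm_sub_le _ _).trans ?_
  rw [norm_smul, Real.norm_of_nonneg (inv_pos.2 hη).le, div_eq_inv_mul]

/-- This is the variational inequality of the projection tested at the starting point, which lies in
`X`. -/
theorem inner_proj_step_le (hc : IsClosed X) (hconv : Convex ℝ X) {η : ℝ} (hη : 0 < η)
    {x : Vec d} (hx : x ∈ X) (g : Vec d) :
    inner ℝ g (proj X (x - η • g) - x) ≤ -(‖proj X (x - η • g) - x‖ ^ 2 / η) := by
  have h := inner_sub_proj_le hc hconv ⟨x, hx⟩ (x - η • g) hx
  set y := proj X (x - η • g)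
  have e : inner ℝ (x - η • g - y) (x - y) = ‖y - x‖ ^ 2 + η * inner ℝ g (y - x) := by
    have : x - η • g - y = -((y - x) + η • g) := by abel
    rw [this, ← neg_sub y x, inner_neg_neg, inner_add_left, real_inner_smul_left,
      real_inner_self_eq_norm_sq]
  rw [e] at h
  rw [← neg_div, le_div_iff₀ hη]
  linarith

theorem norm_proj_step_le (hc : IsClosed X) (hconv : Convex ℝ X) {η : ℝ} (hη : 0 < η)
    {x : Vec d} (hx : x ∈ X) (g : Vec d) : ‖proj X (x - η • g) - x‖ ≤ η * ‖g‖ := by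
  have hp : proj X x = x := by
    have h := inner_sub_proj_le hc hconv ⟨x, hx⟩ x hx
    rw [real_inner_self_nonpos, sub_eq_zero] at h
    exact h.symm
  have h := dist_proj_le hc hconv ⟨x, hx⟩ (x - η • g) x
  rw [hp, dist_eq_norm, dist_eq_norm, sub_sub_cancel_left, norm_neg, norm_smul,
    Real.norm_of_nonneg hη.le] at h
  exact h

/-- The graph of the normal cone is closed, so that the distance to it is lower semicontinuous. -/
theorem isClosed_distNegNormal_le (hc : IsClosed X) (a : ℝ) :
    IsClosed {z : Vec d × Vec d | z.1 ∈ X ∧ distNegNormal X z.1 z.2 ≤ a} := by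
  -- A distance at most a is witnessed by a displacement from v into the negative normal cone that
  -- lies in the closed a-ball. The sublevel set is therefore the projection of a closed set along a
  -- compact factor.
  let T : Set ((Vec d × Vec d) × Metric.closedBall (0 : Vec d) a) :=
    {z | z.1.1 ∈ X ∧ ∀ y ∈ X, inner ℝ (-(z.1.2 + z.2.1)) (y - z.1.1) ≤ 0}
  have hT : IsClosed T := by
    refine (hc.preimage (by fun_prop)).inter ?_
    change IsClosed {z : (Vec d × Vec d) × Metric.closedBall (0 : Vec d) a |
      ∀ y ∈ X, inner ℝ (-(z.1.2 + z.2.1)) (y - z.1.1) ≤ 0}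
    simp only [Set.ofPred_forall]
    refine isClosed_iInter fun y => isClosed_iInter fun _ => ?_
    exact isClosed_le (by fun_prop) continuous_const
  have : CompactSpace (Metric.closedBall (0 : Vec d) a) :=
    isCompact_iff_compactSpace.1 (isCompact_closedBall _ _)
  convert isClosedMap_fst_of_compactSpace (X := Vec d × Vec d) T hT using 1
  ext ⟨x, v⟩
  constructor
  · rintro ⟨hx, h⟩
    obtain ⟨w, hw, e⟩ := (isClosed_neg_normal (X := X) x).exists_infDist_eq_dist
      ⟨0, zero_mem_neg_normal x⟩ v
    have hwa : w - v ∈ Metric.closedBall (0 : Vec d) a := by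
      rw [mem_closedBall_zero_iff, ← dist_eq_norm, dist_comm, ← e]; exact h
    refine ⟨((x, v), ⟨w - v, hwa⟩), ⟨hx, ?_⟩, rfl⟩
    intro y hy
    simpa using hw y hy
  · rintro ⟨⟨⟨x', v'⟩, u⟩, ⟨hx, h⟩, e⟩
    obtain ⟨rfl, rfl⟩ := Prod.mk.inj e
    refine ⟨hx, (Metric.infDist_le_dist_of_mem (s := {w | -w ∈ normalCone X x'})
      (y := v' + u.1) h).trans ?_⟩
    have := mem_closedBall_zero_iff.1 u.2
    simpa [dist_eq_norm] using this

theorem measurable_distNegNormal {α : Type*} [MeasurableSpace α] (hc : IsClosed X)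
    {x v : α → Vec d} (hx : Measurable x) (hv : Measurable v) (hX : ∀ a, x a ∈ X) :
    Measurable fun a => distNegNormal X (x a) (v a) := by
  refine measurable_of_Iic fun b => ?_
  have h := (hx.prodMk hv) (isClosed_distNegNormal_le hc b).measurableSet
  convert h using 1
  ext a
  simp [hX a]

/-- The descent inequality for a function with Lipschitz gradient on a convex set. -/
theorem descent_of_lipschitz_gradient (hconv : Convex ℝ X) {F : Vec d → ℝ} {G : Vec d → Vec d}
    (hF : ∀ x ∈ X, HasGradientAt F (G x) x) {M : ℝ}
    (hG : ∀ x ∈ X, ∀ y ∈ X, ‖G y - G x‖ ≤ M * ‖y - x‖) {x y : Vec d} (hx : x ∈ X) (hy : y ∈ X) :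
    F y ≤ F x + inner ℝ (G x) (y - x) + M / 2 * ‖y - x‖ ^ 2 := by
  let γ : ℝ → Vec d := fun t => x + t • (y - x)
  have hγ : ∀ t ∈ Set.Icc (0 : ℝ) 1, γ t ∈ X := fun t ht => by
    have := hconv.add_smul_sub_mem hx hy ht
    exact this
  -- The claim is h 1 ≤ h 0, and the Lipschitz bound on the gradient along the segment is exactly h'
  -- ≤ 0. By convexity the segment stays in `X`, the only place where the gradient is known.
  let h : ℝ → ℝ := fun t => F (γ t) - t * inner ℝ (G x) (y - x) - M / 2 * ‖y - x‖ ^ 2 * t ^ 2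
  have hd : ∀ t ∈ Set.Icc (0 : ℝ) 1, HasDerivAt h (inner ℝ (G (γ t)) (y - x)
      - inner ℝ (G x) (y - x) - M / 2 * ‖y - x‖ ^ 2 * (2 * t)) t := by
    intro t ht
    have h1 : HasDerivAt γ (y - x) t := by
      simpa [γ] using ((hasDerivAt_id t).smul_const (y - x)).const_add x
    have h2 : HasDerivAt (fun t => F (γ t)) (inner ℝ (G (γ t)) (y - x)) t := by
      have := (hF _ (hγ t ht)).hasFDerivAt.comp_hasDerivAt t h1
      simpa [Function.comp_def] using this
    have h3 : HasDerivAt (fun t : ℝ => t * inner ℝ (G x) (y - x)) (inner ℝ (G x) (y - x)) t := by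
      simpa using (hasDerivAt_id t).mul_const (inner ℝ (G x) (y - x))
    have h4 : HasDerivAt (fun t : ℝ => M / 2 * ‖y - x‖ ^ 2 * t ^ 2)
        (M / 2 * ‖y - x‖ ^ 2 * (2 * t)) t := by
      simpa using (hasDerivAt_pow 2 t).const_mul (M / 2 * ‖y - x‖ ^ 2)
    exact (h2.sub h3).sub h4
  have hanti : AntitoneOn h (Set.Icc 0 1) := by
    refine antitoneOn_of_deriv_nonpos (convex_Icc 0 1)
      (fun t ht => (hd t ht).continuousAt.continuousWithinAt) ?_ ?_
    · intro t ht
      exact (hd t (interior_subset ht)).differentiableAt.differentiableWithinAt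
    · intro t ht
      have ht' := interior_subset ht
      rw [(hd t ht').deriv, ← inner_sub_left]
      have h1 : inner ℝ (G (γ t) - G x) (y - x) ≤ ‖G (γ t) - G x‖ * ‖y - x‖ :=
        real_inner_le_norm _ _
      have h2 := hG x hx (γ t) (hγ t ht')
      have h3 : ‖γ t - x‖ = t * ‖y - x‖ := by
        simp [γ, norm_smul, abs_of_nonneg ht'.1]
      rw [h3] at h2
      have h4 := mul_le_mul_of_nonneg_right h2 (norm_nonneg (y - x))
      linarith [h1.trans h4]
  have := hanti (Set.left_mem_Icc.2 zero_le_one) (Set.right_mem_Icc.2 zero_le_one) zero_le_one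
  simp only [h, γ] at this
  simp only [one_smul, add_sub_cancel, zero_smul, add_zero, one_mul, zero_mul] at this
  linarith

theorem measurable_comp_of_continuousOn {α : Type*} [MeasurableSpace α]
    {F : Vec d → ℝ} (hF : ContinuousOn F X) {x : α → Vec d} (hx : Measurable x)
    (hX : ∀ a, x a ∈ X) : Measurable fun a => F (x a) := by
  have h1 : Measurable (X.domRestrict F) := (continuousOn_iff_continuous_domRestrict.1 hF).measurable
  exact h1.comp (hx.subtype_mk (h := hX))

end Geometry

/-! ### Second moments of random vectors -/

section SecondMoments

variable {β : Type*} [MeasurableSpace β] {ν : Measure β} {E : Type*} [NormedAddCommGroup E]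

theorem norm_add_sq_le_two (a b : E) : ‖a + b‖ ^ 2 ≤ 2 * ‖a‖ ^ 2 + 2 * ‖b‖ ^ 2 := by
  have h := norm_add_le a b
  have h0 := norm_nonneg (a + b)
  nlinarith [sq_nonneg (‖a‖ - ‖b‖)]

theorem norm_add_sq_le_three (a b c : E) :
    ‖a + b + c‖ ^ 2 ≤ 3 * ‖a‖ ^ 2 + 3 * ‖b‖ ^ 2 + 3 * ‖c‖ ^ 2 := by
  have h := norm_add₃_le (a := a) (b := b) (c := c)
  have h0 := norm_nonneg (a + b + c)
  nlinarith [sq_nonneg (‖a‖ - ‖b‖), sq_nonneg (‖a‖ - ‖c‖), sq_nonneg (‖b‖ - ‖c‖)]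

theorem norm_sum_sq_le {m : ℕ} (v : Fin m → E) :
    ‖∑ i, v i‖ ^ 2 ≤ m * ∑ i, ‖v i‖ ^ 2 := by
  have h := norm_sum_le Finset.univ v
  calc ‖∑ i, v i‖ ^ 2 ≤ (∑ i, ‖v i‖) ^ 2 := by gcongr
    _ ≤ _ := by simpa using sq_sum_le_card_mul_sum_sq (s := Finset.univ) (f := fun i => ‖v i‖)

variable [InnerProductSpace ℝ E] [CompleteSpace E] [IsProbabilityMeasure ν]

/-- The cross term 2⟨a, E w⟩ vanishes. Applied to a vector minus its mean, this also yields that the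
variance is at most the second moment, and Jensen's inequality for the squared norm. -/
theorem integral_norm_add_sq_of_mean_zero {w : β → E} (hw : MemLp w 2 ν) (h0 : ∫ b, w b ∂ν = 0)
    (a : E) : ∫ b, ‖a + w b‖ ^ 2 ∂ν = ‖a‖ ^ 2 + ∫ b, ‖w b‖ ^ 2 ∂ν := by
  have hi : Integrable w ν := hw.integrable (by norm_num)
  have hs : Integrable (fun b => ‖w b‖ ^ 2) ν := (memLp_two_iff_integrable_sq_norm hw.1).1 hw
  have h1 : Integrable (fun b => 2 * inner ℝ a (w b)) ν := (hi.const_inner a).const_mul 2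
  simp only [norm_add_sq_real]
  have h2 : Integrable (fun b => ‖a‖ ^ 2 + 2 * inner ℝ a (w b)) ν := (integrable_const _).add h1
  rw [integral_add h2 hs, integral_add (integrable_const _) h1,
    integral_const_mul, integral_inner hi, h0]
  simp

theorem integral_norm_sub_mean_sq_le {w : β → E} (hw : MemLp w 2 ν) {a : E}
    (ha : ∫ b, w b ∂ν = a) : ∫ b, ‖w b - a‖ ^ 2 ∂ν ≤ ∫ b, ‖w b‖ ^ 2 ∂ν := by
  have hi : Integrable w ν := hw.integrable (by norm_num)
  have h := integral_norm_add_sq_of_mean_zero (w := fun b => w b - a) (hw.sub (memLp_const a))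
    (by rw [integral_sub hi (integrable_const a), ha]; simp) a
  simp only [add_sub_cancel] at h
  rw [h]
  have := sq_nonneg ‖a‖
  linarith

theorem norm_integral_sq_le {w : β → E} (hw : MemLp w 2 ν) :
    ‖∫ b, w b ∂ν‖ ^ 2 ≤ ∫ b, ‖w b‖ ^ 2 ∂ν := by
  have hi : Integrable w ν := hw.integrable (by norm_num)
  set a := ∫ b, w b ∂ν with ha
  have h := integral_norm_add_sq_of_mean_zero (w := fun b => w b - a) (hw.sub (memLp_const a))
    (by rw [integral_sub hi (integrable_const a), ← ha]; simp) a
  simp only [add_sub_cancel] at h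
  rw [h]
  have : 0 ≤ ∫ b, ‖w b - a‖ ^ 2 ∂ν := integral_nonneg fun b => by positivity
  linarith

end SecondMoments

/-! ### Averaging over a fresh sample, and calculus of bounds on expectations -/

section Independence

variable {Ω S β : Type*} [MeasurableSpace Ω] [MeasurableSpace S] [MeasurableSpace β]

/-- A bound on the mean given the past integrates to a bound on the mean. -/
theorem expLE_of_indepFun {P : Measure Ω} [IsProbabilityMeasure P] {Y : Ω → S} {b : Ω → β}
    (hY : Measurable Y) (hb : Measurable b) (hind : IndepFun Y b P) {h : S × β → ℝ}
    (hm : Measurable h) (h0 : ∀ z, 0 ≤ h z) {H : S → ℝ} (hH : Integrable (fun ω => H (Y ω)) P)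
    (hle : ∀ ω, ExpLE (P.map b) (fun z => h (Y ω, z)) (H (Y ω))) :
    ExpLE P (fun ω => h (Y ω, b ω)) (∫ ω, H (Y ω) ∂P) := by
  have hprob : IsProbabilityMeasure (P.map b) := Measure.isProbabilityMeasure_map hb.aemeasurable
  have hH0 : ∀ ω, 0 ≤ H (Y ω) := fun ω => (integral_nonneg fun _ => h0 _).trans (hle ω).2
  have hmap : P.map (fun ω => (Y ω, b ω)) = (P.map Y).prod (P.map b) :=
    (indepFun_iff_map_prod_eq_prod_map_map hY.aemeasurable hb.aemeasurable).1 hind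
  -- Integrability of the joint function is part of the conclusion, so Tonelli's theorem is applied
  -- to nonnegative extended integrals on the product law.
  have hbound : ∫⁻ ω, ENNReal.ofReal (h (Y ω, b ω)) ∂P ≤ ∫⁻ ω, ENNReal.ofReal (H (Y ω)) ∂P := by
    calc ∫⁻ ω, ENNReal.ofReal (h (Y ω, b ω)) ∂P
        = ∫⁻ z, ENNReal.ofReal (h z) ∂(P.map (fun ω => (Y ω, b ω))) := by
          rw [lintegral_map hm.ennreal_ofReal (hY.prodMk hb)]
      _ = ∫⁻ y, ∫⁻ z, ENNReal.ofReal (h (y, z)) ∂(P.map b) ∂(P.map Y) := by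
          rw [hmap, lintegral_prod _ hm.ennreal_ofReal.aemeasurable]
      _ = ∫⁻ ω, ∫⁻ z, ENNReal.ofReal (h (Y ω, z)) ∂(P.map b) ∂P := by
          rw [lintegral_map _ hY]
          exact hm.ennreal_ofReal.lintegral_prod_right'
      _ ≤ _ := by
          refine lintegral_mono fun ω => ?_
          rw [← ofReal_integral_eq_lintegral_ofReal (hle ω).1 (ae_of_all _ fun _ => h0 _)]
          exact ENNReal.ofReal_le_ofReal (hle ω).2
  have hmeas : Measurable fun ω => h (Y ω, b ω) := hm.comp (hY.prodMk hb)
  have hfin : ∫⁻ ω, ENNReal.ofReal (H (Y ω)) ∂P ≠ ⊤ := by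
    rw [← ofReal_integral_eq_lintegral_ofReal hH (ae_of_all _ hH0)]
    exact ENNReal.ofReal_ne_top
  refine ⟨⟨hmeas.aestronglyMeasurable, ?_⟩, ?_⟩
  · rw [hasFiniteIntegral_iff_ofReal (ae_of_all _ fun _ => h0 _)]
    exact lt_of_le_of_lt hbound hfin.lt_top
  · rw [integral_eq_lintegral_of_nonneg_ae (ae_of_all _ fun _ => h0 _) hmeas.aestronglyMeasurable,
      integral_eq_lintegral_of_nonneg_ae (ae_of_all _ hH0) hH.1]
    exact ENNReal.toReal_mono hfin hbound

end Independence

section ExpLECalculus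

variable {α β : Type*} [MeasurableSpace α] [MeasurableSpace β] {μ : Measure α} {ν : Measure β}

theorem ExpLE.comp {h : α → ℝ} {c : ℝ} (H : ExpLE μ h c) {f : β → α}
    (hf : MeasurePreserving f ν μ) : ExpLE ν (fun b => h (f b)) c := by
  refine ⟨hf.integrable_comp_of_integrable H.1, ?_⟩
  rw [← integral_map hf.measurable.aemeasurable (by rw [hf.map_eq]; exact H.1.1), hf.map_eq]
  exact H.2

theorem ExpLE.mono {h g : α → ℝ} {c : ℝ} (H : ExpLE μ h c) (hg : AEStronglyMeasurable g μ)
    (h0 : ∀ a, 0 ≤ g a) (hle : ∀ᵐ a ∂μ, g a ≤ h a) : ExpLE μ g c := by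
  have hi : Integrable g μ := H.1.mono' hg (by
    filter_upwards [hle] with a ha
    rwa [Real.norm_of_nonneg (h0 a)])
  exact ⟨hi, (integral_mono_ae hi H.1 hle).trans H.2⟩

theorem ExpLE.le_trans {h : α → ℝ} {c c' : ℝ} (H : ExpLE μ h c) (hc : c ≤ c') : ExpLE μ h c' :=
  ⟨H.1, H.2.trans hc⟩

theorem ExpLE.add {h g : α → ℝ} {c c' : ℝ} (H : ExpLE μ h c) (H' : ExpLE μ g c') :
    ExpLE μ (fun a => h a + g a) (c + c') :=
  ⟨H.1.add H'.1, by rw [integral_add H.1 H'.1]; exact add_le_add H.2 H'.2⟩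

theorem ExpLE.const_mul {h : α → ℝ} {c : ℝ} (H : ExpLE μ h c) {r : ℝ} (hr : 0 ≤ r) :
    ExpLE μ (fun a => r * h a) (r * c) :=
  ⟨H.1.const_mul r, by rw [integral_const_mul]; exact mul_le_mul_of_nonneg_left H.2 hr⟩

theorem ExpLE.sum {m : ℕ} {h : Fin m → α → ℝ} {c : Fin m → ℝ} (H : ∀ i, ExpLE μ (h i) (c i)) :
    ExpLE μ (fun a => ∑ i, h i a) (∑ i, c i) :=
  ⟨integrable_finsetSum _ fun i _ => (H i).1, by
    rw [integral_finsetSum _ fun i _ => (H i).1]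
    exact Finset.sum_le_sum fun i _ => (H i).2⟩

theorem expLE_const [IsProbabilityMeasure μ] (c : ℝ) : ExpLE μ (fun _ => c) c :=
  ⟨integrable_const c, by simp⟩

/-- The second moment of a recursive momentum update with unbiased estimators `Q`, `Q'`. -/
theorem expLE_momentum {E : Type*} [NormedAddCommGroup E] [InnerProductSpace ℝ E]
    [CompleteSpace E] [IsProbabilityMeasure μ] {Q Q' : α → E} (hQ : MemLp Q 2 μ)
    (hQ' : MemLp Q' 2 μ) {G G' : E} (hG : ∫ b, Q b ∂μ = G) (hG' : ∫ b, Q' b ∂μ = G')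
    {t : ℝ} (ht : 0 ≤ t) (ht1 : t ≤ 1) (e : E) :
    ExpLE μ (fun b => ‖(1 - t) • e + ((Q' b - G') - (1 - t) • (Q b - G))‖ ^ 2)
      ((1 - t) ^ 2 * ‖e‖ ^ 2
        + (2 * t ^ 2 * ∫ b, ‖Q' b - G'‖ ^ 2 ∂μ + 2 * ∫ b, ‖Q' b - Q b‖ ^ 2 ∂μ)) := by
  have hiQ := hQ.integrable (by norm_num)
  have hiQ' := hQ'.integrable (by norm_num)
  have hU : MemLp (fun b => Q' b - G') 2 μ := hQ'.sub (memLp_const _)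
  have hD : MemLp (fun b => Q' b - Q b) 2 μ := hQ'.sub hQ
  have hDi : ∫ b, (Q' b - Q b) ∂μ = G' - G := by rw [integral_sub hiQ' hiQ, hG, hG']
  have hV : MemLp (fun b => Q' b - Q b - (G' - G)) 2 μ := hD.sub (memLp_const _)
  have hW : MemLp (fun b => (Q' b - G') - (1 - t) • (Q b - G)) 2 μ :=
    hU.sub ((hQ.sub (memLp_const _)).const_smul (1 - t))
  have hW0 : ∫ b, ((Q' b - G') - (1 - t) • (Q b - G)) ∂μ = 0 := by
    have i1 : Integrable (fun b => (1 - t) • (Q b - G)) μ :=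
      (hiQ.sub (integrable_const _)).smul (1 - t)
    rw [integral_sub (hU.integrable (by norm_num)) i1, integral_smul,
      integral_sub hiQ (integrable_const _), integral_sub hiQ' (integrable_const _), hG, hG']
    simp
  have hsq : ∀ {w : α → E}, MemLp w 2 μ → Integrable (fun b => ‖w b‖ ^ 2) μ := fun hw =>
    (memLp_two_iff_integrable_sq_norm hw.1).1 hw
  refine ⟨hsq ((memLp_const ((1 - t) • e)).add hW), ?_⟩
  -- The fresh noise has mean zero, so it does not interact with the old error, which keeps the full
  -- contraction factor (1 - t)².
  rw [integral_norm_add_sq_of_mean_zero hW hW0, norm_smul, mul_pow, Real.norm_eq_abs, sq_abs]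
  refine add_le_add le_rfl ?_
  have hle : ∀ b, ‖(Q' b - G') - (1 - t) • (Q b - G)‖ ^ 2
      ≤ 2 * t ^ 2 * ‖Q' b - G'‖ ^ 2 + 2 * ‖Q' b - Q b - (G' - G)‖ ^ 2 := by
    intro b
    -- The noise splits into t times the noise of one sample and a centred difference of two
    -- estimators on the same sample. The first is damped by t², and the second is small when the
    -- two arguments are close.
    have e : (Q' b - G') - (1 - t) • (Q b - G)
        = t • (Q' b - G') + (1 - t) • (Q' b - Q b - (G' - G)) := by module
    rw [e]
    refine (norm_add_sq_le_two _ _).trans ?_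
    rw [norm_smul, norm_smul, mul_pow, mul_pow, Real.norm_of_nonneg ht,
      Real.norm_of_nonneg (sub_nonneg.2 ht1)]
    have h1 : (1 - t) ^ 2 ≤ 1 := by nlinarith
    have h2 := mul_le_mul_of_nonneg_right h1 (sq_nonneg ‖Q' b - Q b - (G' - G)‖)
    linarith
  have h1 := integral_mono (hsq hW) (((hsq hU).const_mul _).add ((hsq hV).const_mul _)) hle
  refine h1.trans ?_
  simp only [Pi.add_apply]
  rw [integral_add ((hsq hU).const_mul _) ((hsq hV).const_mul _), integral_const_mul,
    integral_const_mul]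
  have h2 := integral_norm_sub_mean_sq_le hD hDi
  linarith

end ExpLECalculus

/-! ### The augmented Lagrangian and its stochastic gradient -/

variable {d m : ℕ} {Ξ Z : Type*} [MeasurableSpace Ξ] [MeasurableSpace Z]

/-- All assumptions on the problem that do not involve the iterates. -/
structure Problem.Regular (p : Problem d m Ξ Z) (κ : Constants) : Prop where
  setting : p.Setting
  a2 : p.A2 κ
  a3 : p.A3 κ
  a4 : p.A4 κ

/-- `ν` is a possible law of one sample `(ξ⁰, ζ¹, ζ²)`. -/
structure Problem.SampleLaw (p : Problem d m Ξ Z) (ν : Measure (Ξ × Z × Z)) : Prop where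
  prob : IsProbabilityMeasure ν
  map_fst : ν.map Prod.fst = p.lawXi
  map_snd : ν.map Prod.snd = p.lawZeta.prod p.lawZeta

/-- The gradient in `x` of the augmented Lagrangian. -/
def Problem.gradL (p : Problem d m Ξ Z) (r : ℝ) (x : Vec d) (l : Vec m) : Vec d :=
  gradient p.f x + p.jacT x l + r • p.jacT x (p.cVec x)

/-- The augmented Lagrangian. -/
def Problem.augL (p : Problem d m Ξ Z) (r : ℝ) (l : Vec m) (x : Vec d) : ℝ :=
  p.f x + ∑ i, l i * p.c i x + r / 2 * ∑ i, p.c i x ^ 2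

/-- A common bound for `∇c_i` and `∇̃c_i`. -/
def Constants.gradCBound (κ : Constants) : ℝ := |κ.CgradC| + |κ.CgradCT|

/-- A common bound for `c_i` and `c̃_i`. -/
def Constants.cBound (κ : Constants) : ℝ := |κ.Cc| + |κ.CcT|

/-- A bound for the part of the augmented Lagrangian gradient that comes from the constraints,
for multipliers with entries in `[-Λ, Λ]`. -/
def Constants.consBound (κ : Constants) (m : ℕ) (Λ r : ℝ) : ℝ :=
  m * (Λ * κ.gradCBound) + r * (m * (κ.cBound * κ.gradCBound))

/-- The squared mean-square Lipschitz constant of the stochastic augmented Lagrangian gradient. -/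
def Constants.lipSq (κ : Constants) (m : ℕ) (Λ r : ℝ) : ℝ :=
  3 * κ.LgradF ^ 2 + 3 * (m : ℝ) ^ 2 * Λ ^ 2 * κ.LgradC ^ 2
    + 6 * r ^ 2 * (m : ℝ) ^ 2 * (κ.CcT ^ 2 * κ.LgradC ^ 2 + κ.CgradCT ^ 2 * κ.Lc ^ 2)

/-- The absolute values in the definition are needed for this: when m = 0 the bounds in (A4) on the
constraints say nothing about the sign of their constants. -/
theorem Constants.gradCBound_nonneg (κ : Constants) : 0 ≤ κ.gradCBound := by
  unfold gradCBound; positivity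

theorem Constants.cBound_nonneg (κ : Constants) : 0 ≤ κ.cBound := by
  unfold cBound; positivity

theorem Constants.lipSq_nonneg (κ : Constants) (m : ℕ) (Λ r : ℝ) : 0 ≤ κ.lipSq m Λ r := by
  unfold lipSq; positivity

namespace Problem

variable {p : Problem d m Ξ Z} {κ : Constants} {ν : Measure (Ξ × Z × Z)}

namespace SampleLaw

theorem preserving_fst (hν : p.SampleLaw ν) : MeasurePreserving Prod.fst ν p.lawXi :=
  ⟨measurable_fst, hν.map_fst⟩

theorem preserving_snd (hν : p.SampleLaw ν) :
    MeasurePreserving Prod.snd ν (p.lawZeta.prod p.lawZeta) :=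
  ⟨measurable_snd, hν.map_snd⟩

theorem preserving_snd_fst (hν : p.SampleLaw ν) (hS : p.Setting) :
    MeasurePreserving (fun b : Ξ × Z × Z => b.2.1) ν p.lawZeta :=
  have := hS.probZeta
  (measurePreserving_fst (μ := p.lawZeta) (ν := p.lawZeta)).comp hν.preserving_snd

theorem preserving_snd_snd (hν : p.SampleLaw ν) (hS : p.Setting) :
    MeasurePreserving (fun b : Ξ × Z × Z => b.2.2) ν p.lawZeta :=
  have := hS.probZeta
  (measurePreserving_snd (μ := p.lawZeta) (ν := p.lawZeta)).comp hν.preserving_snd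

end SampleLaw

theorem Setting.measurable_gradQ (hS : p.Setting) (r : ℝ) {α : Type*} [MeasurableSpace α]
    {x : α → Vec d} {l : α → Vec m} {b : α → Ξ × Z × Z} (hx : Measurable x) (hl : Measurable l)
    (hb : Measurable b) : Measurable fun a => p.gradQ r (x a) (l a) (b a) := by
  unfold gradQ
  have hF : Measurable fun a => p.gradF (x a) (b a).1 :=
    hS.measurable_gradF.comp (hx.prodMk (measurable_fst.comp hb))
  have hC : ∀ i, Measurable fun a => p.gradC i (x a) (b a).2.1 := fun i =>
    (hS.measurable_gradC i).comp (hx.prodMk (measurable_fst.comp (measurable_snd.comp hb)))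
  have hc : ∀ i, Measurable fun a => p.cTilde i (x a) (b a).2.2 := fun i =>
    (hS.measurable_c i).comp (hx.prodMk (measurable_snd.comp (measurable_snd.comp hb)))
  have hli : ∀ i, Measurable fun a => l a i := fun i => by fun_prop
  exact (hF.add (Finset.measurable_fun_sum _ fun i _ => (hli i).smul (hC i))).add
    ((Finset.measurable_fun_sum _ fun i _ => (hc i).smul (hC i)).const_smul r)

theorem Setting.measurable_gradQ_prod (hS : p.Setting) (r : ℝ) :
    Measurable fun z : Vec d × Vec m × (Ξ × Z × Z) => p.gradQ r z.1 z.2.1 z.2.2 :=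
  hS.measurable_gradQ r (by fun_prop) (by fun_prop) (by fun_prop)

theorem measurable_gradient {F : Vec d → ℝ} : Measurable (gradient F) := by
  unfold gradient
  exact ((InnerProductSpace.toDual ℝ (Vec d)).symm.continuous.measurable).comp (measurable_fderiv ℝ F)

theorem Setting.measurable_cfun (hS : p.Setting) (i : Fin m) : Measurable (p.c i) := by
  have := hS.probZeta
  exact ((hS.measurable_c i).stronglyMeasurable.integral_prod_right (ν := p.lawZeta)).measurable

theorem Setting.measurable_cVec (hS : p.Setting) : Measurable p.cVec := by
  unfold cVec
  exact (PiLp.continuous_toLp 2 _).measurable.comp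
    (measurable_pi_lambda _ fun i => hS.measurable_cfun i)

theorem measurable_jacT {α : Type*} [MeasurableSpace α] {x : α → Vec d} {l : α → Vec m}
    (hx : Measurable x) (hl : Measurable l) : Measurable fun a => p.jacT (x a) (l a) := by
  unfold jacT
  have hli : ∀ i, Measurable fun a => l a i := fun i => by fun_prop
  exact Finset.measurable_fun_sum _ fun i _ => (hli i).smul (measurable_gradient.comp hx)

theorem Setting.measurable_gradL (hS : p.Setting) (r : ℝ) {α : Type*} [MeasurableSpace α]
    {x : α → Vec d} {l : α → Vec m} (hx : Measurable x) (hl : Measurable l) :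
    Measurable fun a => p.gradL r (x a) (l a) := by
  unfold gradL
  exact ((measurable_gradient.comp hx).add (measurable_jacT hx hl)).add
    ((measurable_jacT hx (hS.measurable_cVec.comp hx)).const_smul r)

theorem Setting.measurable_gradL_prod (hS : p.Setting) (r : ℝ) :
    Measurable fun z : Vec d × Vec m => p.gradL r z.1 z.2 :=
  hS.measurable_gradL r (by fun_prop) (by fun_prop)

namespace Regular

variable (hp : p.Regular κ)
include hp

theorem norm_gradC_le (i : Fin m) {x : Vec d} (hx : x ∈ p.X) (ζ : Z) :
    ‖p.gradC i x ζ‖ ≤ κ.gradCBound :=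
  (hp.a4.gradCTilde i x hx ζ).trans
    ((le_abs_self _).trans (le_add_of_nonneg_left (abs_nonneg _)))

theorem norm_gradient_c_le (i : Fin m) {x : Vec d} (hx : x ∈ p.X) :
    ‖gradient (p.c i) x‖ ≤ κ.gradCBound :=
  (hp.a4.gradC i x hx).trans ((le_abs_self _).trans (le_add_of_nonneg_right (abs_nonneg _)))

theorem abs_cTilde_le (i : Fin m) {x : Vec d} (hx : x ∈ p.X) (ζ : Z) :
    |p.cTilde i x ζ| ≤ κ.cBound :=
  (hp.a4.cTilde i x hx ζ).trans
    ((le_abs_self _).trans (le_add_of_nonneg_left (abs_nonneg _)))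

theorem abs_c_le (i : Fin m) {x : Vec d} (hx : x ∈ p.X) : |p.c i x| ≤ κ.cBound :=
  (hp.a4.c i x hx).trans ((le_abs_self _).trans (le_add_of_nonneg_right (abs_nonneg _)))

omit hp in
theorem norm_sum_smul_le {a : Fin m → ℝ} {v : Fin m → Vec d} {A C : ℝ}
    (ha : ∀ i, |a i| ≤ A) (hv : ∀ i, ‖v i‖ ≤ C) : ‖∑ i, a i • v i‖ ≤ m * (A * C) := by
  refine (norm_sum_le _ _).trans ?_
  calc ∑ i, ‖a i • v i‖ ≤ ∑ _i : Fin m, A * C := by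
        refine Finset.sum_le_sum fun i _ => ?_
        rw [norm_smul, Real.norm_eq_abs]
        exact mul_le_mul (ha i) (hv i) (norm_nonneg _) ((abs_nonneg _).trans (ha i))
    _ = _ := by simp

theorem norm_jacT_le {x : Vec d} (hx : x ∈ p.X) {l : Vec m} {Λ : ℝ} (hl : ∀ i, |l i| ≤ Λ) :
    ‖p.jacT x l‖ ≤ m * (Λ * κ.gradCBound) :=
  norm_sum_smul_le hl fun i => hp.norm_gradient_c_le i hx

theorem norm_gradL_le {x : Vec d} (hx : x ∈ p.X) {l : Vec m} {Λ r : ℝ} (hl : ∀ i, |l i| ≤ Λ)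
    (hr : 0 ≤ r) : ‖p.gradL r x l‖ ≤ κ.CgradF + κ.consBound m Λ r := by
  unfold gradL Constants.consBound
  refine (norm_add₃_le).trans ?_
  rw [norm_smul, Real.norm_of_nonneg hr, ← add_assoc]
  have h1 := hp.a4.gradF x hx
  have h2 := hp.norm_jacT_le hx hl
  have h3 := hp.norm_jacT_le hx (l := p.cVec x) (fun i => hp.abs_c_le i hx)
  gcongr

/-- The variance of the stochastic gradient of the augmented Lagrangian. -/
theorem variance_gradQ_le (hν : p.SampleLaw ν) {x : Vec d} (hx : x ∈ p.X) {l : Vec m} {Λ r : ℝ}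
    (hl : ∀ i, |l i| ≤ Λ) (hr : 0 ≤ r) :
    ExpLE ν (fun b => ‖p.gradQ r x l b - p.gradL r x l‖ ^ 2)
      (2 * κ.sigF ^ 2 + 2 * (2 * κ.consBound m Λ r) ^ 2) := by
  have := hν.prob
  have h1 := ((hp.a3.gradF x hx).comp hν.preserving_fst).const_mul (r := 2) (by norm_num)
  have h2 := h1.add (expLE_const (μ := ν) (2 * (2 * κ.consBound m Λ r) ^ 2))
  refine h2.mono ?_ (fun _ => by positivity) (ae_of_all _ fun b => ?_)
  · have h := hp.setting.measurable_gradQ (α := Ξ × Z × Z) r (x := fun _ => x) (l := fun _ => l)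
      measurable_const measurable_const measurable_id
    exact ((h.sub_const _).norm.pow_const 2).aestronglyMeasurable
  -- Only the objective part needs a variance bound. The constraint part and its mean are both at
  -- most `consBound` in norm for every sample. Through `consBound` the resulting bound grows like
  -- r².
  · set R : Vec d := ∑ i, l i • p.gradC i x b.2.1
      + r • ∑ i, p.cTilde i x b.2.2 • p.gradC i x b.2.1 with hR
    set T : Vec d := p.jacT x l + r • p.jacT x (p.cVec x) with hT
    have hRle : ‖R‖ ≤ κ.consBound m Λ r := by
      refine (norm_add_le _ _).trans ?_
      rw [norm_smul, Real.norm_of_nonneg hr]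
      exact add_le_add (norm_sum_smul_le hl fun i => hp.norm_gradC_le i hx _)
        (mul_le_mul_of_nonneg_left (norm_sum_smul_le (fun i => hp.abs_cTilde_le i hx _)
          fun i => hp.norm_gradC_le i hx _) hr)
    have hTle : ‖T‖ ≤ κ.consBound m Λ r := by
      refine (norm_add_le _ _).trans ?_
      rw [norm_smul, Real.norm_of_nonneg hr]
      exact add_le_add (hp.norm_jacT_le hx hl)
        (mul_le_mul_of_nonneg_left (hp.norm_jacT_le hx fun i => hp.abs_c_le i hx) hr)
    have e : p.gradQ r x l b - p.gradL r x l = (p.gradF x b.1 - gradient p.f x) + (R - T) := by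
      rw [hR, hT, gradQ, gradL]; abel
    rw [e]
    refine (norm_add_sq_le_two _ _).trans ?_
    have h3 : ‖R - T‖ ≤ 2 * κ.consBound m Λ r := (norm_sub_le _ _).trans (by linarith)
    gcongr

theorem memLp_gradQ (hν : p.SampleLaw ν) {x : Vec d} (hx : x ∈ p.X) (l : Vec m) {r : ℝ}
    (hr : 0 ≤ r) : MemLp (p.gradQ r x l) 2 ν := by
  have := hν.prob
  have hm := hp.setting.measurable_gradQ (α := Ξ × Z × Z) r (x := fun _ => x) (l := fun _ => l)
      measurable_const measurable_const measurable_id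
  have hl : ∀ i, |l i| ≤ ‖l‖ := fun i => PiLp.norm_apply_le l i
  have h := (memLp_two_iff_integrable_sq_norm (hm.sub_const _).aestronglyMeasurable).2
    (hp.variance_gradQ_le hν hx hl hr).1
  have h2 := h.add (memLp_const (p.gradL r x l))
  have e : ((fun b => p.gradQ r x l b - p.gradL r x l) + fun _ => p.gradL r x l)
      = p.gradQ r x l := by ext1 b; simp
  exact e ▸ h2

/-- The penalty term is a product of two random factors. It is unbiased because c̃ is evaluated at
ζ² and ∇̃c at the independent ζ¹, so the expectation factors. -/
theorem integral_gradQ (hν : p.SampleLaw ν) {x : Vec d} (hx : x ∈ p.X) (l : Vec m) (r : ℝ) :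
    ∫ b, p.gradQ r x l b ∂ν = p.gradL r x l := by
  have := hν.prob
  have hS := hp.setting
  have := hS.probZeta
  have hZ : ∀ i, Measurable (p.gradC i x) := fun i =>
    (hS.measurable_gradC i).comp measurable_prodMk_left
  have hc : ∀ i, Measurable (p.cTilde i x) := fun i =>
    (hS.measurable_c i).comp measurable_prodMk_left
  have hF : Integrable (fun b : Ξ × Z × Z => p.gradF x b.1) ν :=
    hν.preserving_fst.integrable_comp_of_integrable (hS.unbiased_f x hx).1
  have hFi : ∫ b : Ξ × Z × Z, p.gradF x b.1 ∂ν = gradient p.f x := by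
    rw [← (hS.unbiased_f x hx).2, ← hν.map_fst, integral_map measurable_fst.aemeasurable]
    rw [hν.map_fst]; exact (hS.unbiased_f x hx).1.1
  have hC : ∀ i, Integrable (fun b : Ξ × Z × Z => p.gradC i x b.2.1) ν := fun i =>
    (hν.preserving_snd_fst hS).integrable_comp_of_integrable (hS.unbiased_c i x hx).1
  have hCi : ∀ i, ∫ b : Ξ × Z × Z, p.gradC i x b.2.1 ∂ν = gradient (p.c i) x := fun i => by
    rw [← (hS.unbiased_c i x hx).2, ← (hν.preserving_snd_fst hS).map_eq,
      integral_map (hν.preserving_snd_fst hS).measurable.aemeasurable]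
    exact (hZ i).aestronglyMeasurable
  have hcC : ∀ i, Integrable (fun b : Ξ × Z × Z => p.cTilde i x b.2.2 • p.gradC i x b.2.1) ν := by
    intro i
    refine (hC i).bdd_smul (𝕜 := ℝ) (C := κ.cBound) ?_ (ae_of_all _ fun b => ?_)
    · exact ((hc i).comp (measurable_snd.comp measurable_snd)).aestronglyMeasurable
    · exact hp.abs_cTilde_le i hx _
  have hcCi : ∀ i, ∫ b : Ξ × Z × Z, p.cTilde i x b.2.2 • p.gradC i x b.2.1 ∂ν
      = p.c i x • gradient (p.c i) x := fun i => by
    have h1 : ∫ b : Ξ × Z × Z, p.cTilde i x b.2.2 • p.gradC i x b.2.1 ∂ν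
        = ∫ z : Z × Z, p.cTilde i x z.2 • p.gradC i x z.1 ∂(p.lawZeta.prod p.lawZeta) := by
      rw [← hν.map_snd, integral_map measurable_snd.aemeasurable]
      exact (((hc i).comp measurable_snd).smul ((hZ i).comp measurable_fst)).aestronglyMeasurable
    rw [h1, ← (hS.unbiased_c i x hx).2, c, ← integral_prod_smul, ← integral_prod_swap]
    rfl
  unfold gradQ gradL jacT
  have h1 : Integrable (fun b : Ξ × Z × Z => ∑ i, l i • p.gradC i x b.2.1) ν :=
    integrable_finsetSum _ fun i _ => (hC i).smul (l i)
  have h2 : Integrable (fun b : Ξ × Z × Z => ∑ i, p.cTilde i x b.2.2 • p.gradC i x b.2.1) ν :=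
    integrable_finsetSum _ fun i _ => hcC i
  have h3 : Integrable (fun b : Ξ × Z × Z => p.gradF x b.1 + ∑ i, l i • p.gradC i x b.2.1) ν :=
    hF.add h1
  have h4 : Integrable (fun b : Ξ × Z × Z =>
      r • ∑ i, p.cTilde i x b.2.2 • p.gradC i x b.2.1) ν := h2.smul r
  have h5 : ∀ i, Integrable (fun b : Ξ × Z × Z => l i • p.gradC i x b.2.1) ν := fun i =>
    (hC i).smul (l i)
  rw [integral_add h3 h4, integral_add hF h1, integral_smul,
    integral_finsetSum _ fun i _ => h5 i, integral_finsetSum _ fun i _ => hcC i, hFi]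
  simp only [integral_smul, hCi, hcCi]
  rfl

/-- Mean-square Lipschitz continuity of the stochastic augmented Lagrangian gradient. -/
theorem gradQ_lipschitz (hν : p.SampleLaw ν) {x y : Vec d} (hx : x ∈ p.X) (hy : y ∈ p.X)
    {l : Vec m} {Λ r : ℝ} (hl : ∀ i, |l i| ≤ Λ) (hr : 0 ≤ r) :
    ExpLE ν (fun b => ‖p.gradQ r x l b - p.gradQ r y l b‖ ^ 2)
      (κ.lipSq m Λ r * ‖x - y‖ ^ 2) := by
  have := hν.prob
  have hS := hp.setting
  have h1 := ((hp.a2.gradF x hx y hy).comp hν.preserving_fst).const_mul (r := 3) (by norm_num)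
  have hG := fun i => (hp.a2.gradC i x hx y hy).comp (hν.preserving_snd_fst hS)
  have hc := fun i => (hp.a2.c i x hx y hy).comp (hν.preserving_snd_snd hS)
  have h2 := (ExpLE.sum fun i => (hG i).const_mul (r := Λ ^ 2) (by positivity)).const_mul
    (r := 3 * m) (by positivity)
  have h3 := (ExpLE.sum fun i => ((hG i).const_mul (r := 2 * κ.CcT ^ 2) (by positivity)).add
    ((hc i).const_mul (r := 2 * κ.CgradCT ^ 2) (by positivity))).const_mul
    (r := 3 * r ^ 2 * m) (by positivity)
  refine (((h1.add h2).add h3).mono ?_ (fun _ => by positivity)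
    (ae_of_all _ fun b => ?_)).le_trans (le_of_eq ?_)
  · have hm := fun x => hS.measurable_gradQ (α := Ξ × Z × Z) r (x := fun _ => x) (l := fun _ => l)
      measurable_const measurable_const measurable_id
    exact (((hm x).sub (hm y)).norm.pow_const 2).aestronglyMeasurable
  -- The product c̃_i ∇̃c_i is varied one factor at a time, the remaining factor being bounded for
  -- every sample.
  · have e : p.gradQ r x l b - p.gradQ r y l b = (p.gradF x b.1 - p.gradF y b.1)
        + ∑ i, l i • (p.gradC i x b.2.1 - p.gradC i y b.2.1)
        + r • ∑ i, (p.cTilde i x b.2.2 • (p.gradC i x b.2.1 - p.gradC i y b.2.1)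
          + (p.cTilde i x b.2.2 - p.cTilde i y b.2.2) • p.gradC i y b.2.1) := by
      simp only [gradQ, smul_sub, sub_smul, Finset.sum_add_distrib, Finset.sum_sub_distrib,
        smul_add]
      abel
    rw [e]
    refine (norm_add_sq_le_three _ _ _).trans ?_
    have i2 : ‖∑ i, l i • (p.gradC i x b.2.1 - p.gradC i y b.2.1)‖ ^ 2
        ≤ m * ∑ i, Λ ^ 2 * ‖p.gradC i x b.2.1 - p.gradC i y b.2.1‖ ^ 2 := by
      refine (norm_sum_sq_le _).trans ?_
      gcongr with i
      rw [norm_smul, mul_pow, Real.norm_eq_abs]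
      gcongr
      exact hl i
    have i3 : ‖r • ∑ i, (p.cTilde i x b.2.2 • (p.gradC i x b.2.1 - p.gradC i y b.2.1)
          + (p.cTilde i x b.2.2 - p.cTilde i y b.2.2) • p.gradC i y b.2.1)‖ ^ 2
        ≤ r ^ 2 * (m * ∑ i, (2 * κ.CcT ^ 2 * ‖p.gradC i x b.2.1 - p.gradC i y b.2.1‖ ^ 2
          + 2 * κ.CgradCT ^ 2 * |p.cTilde i x b.2.2 - p.cTilde i y b.2.2| ^ 2)) := by
      rw [norm_smul, mul_pow, Real.norm_of_nonneg hr]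
      refine mul_le_mul_of_nonneg_left ((norm_sum_sq_le _).trans ?_) (by positivity)
      gcongr with i
      refine (norm_add_sq_le_two _ _).trans ?_
      rw [norm_smul, norm_smul, mul_pow, mul_pow, Real.norm_eq_abs, Real.norm_eq_abs]
      have j1 : |p.cTilde i x b.2.2| ^ 2 ≤ κ.CcT ^ 2 := by
        gcongr; exact hp.a4.cTilde i x hx _
      have j2 : ‖p.gradC i y b.2.1‖ ^ 2 ≤ κ.CgradCT ^ 2 := by
        gcongr; exact hp.a4.gradCTilde i y hy _
      have k1 := mul_le_mul_of_nonneg_right j1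
        (sq_nonneg ‖p.gradC i x b.2.1 - p.gradC i y b.2.1‖)
      have k2 := mul_le_mul_of_nonneg_left j2
        (sq_nonneg |p.cTilde i x b.2.2 - p.cTilde i y b.2.2|)
      linarith
    linarith
  · simp only [Finset.sum_const, Finset.card_univ, Fintype.card_fin, nsmul_eq_mul,
      Constants.lipSq]
    ring

/-- By unbiasedness the left side is the norm of a mean, so Jensen's inequality transfers the
mean-square Lipschitz bound of the samples. The measure ν serves only as a law to average over. -/
theorem norm_gradL_sub_le {ν : Measure (Ξ × Z × Z)} (hν : p.SampleLaw ν) {x y : Vec d}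
    (hx : x ∈ p.X) (hy : y ∈ p.X)
    {l : Vec m} {Λ r : ℝ} (hl : ∀ i, |l i| ≤ Λ) (hr : 0 ≤ r) :
    ‖p.gradL r x l - p.gradL r y l‖ ≤ √(κ.lipSq m Λ r) * ‖x - y‖ := by
  have := hν.prob
  have hmx := hp.memLp_gradQ hν hx l hr
  have hmy := hp.memLp_gradQ hν hy l hr
  have h1 := norm_integral_sq_le (hmx.sub hmy)
  have h2 : ∫ b, (p.gradQ r x l - p.gradQ r y l) b ∂ν = p.gradL r x l - p.gradL r y l := by
    rw [← hp.integral_gradQ hν hx l r, ← hp.integral_gradQ hν hy l r]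
    exact integral_sub (hmx.integrable (by norm_num)) (hmy.integrable (by norm_num))
  rw [h2] at h1
  have h3 := h1.trans (hp.gradQ_lipschitz hν hx hy hl hr).2
  rw [← Real.sqrt_sq (norm_nonneg (x - y)), ← Real.sqrt_mul (κ.lipSq_nonneg m Λ r)]
  exact Real.le_sqrt_of_sq_le h3

/-- For a fixed point and sample the stochastic gradient is affine in multiplier and penalty, and
its coefficients are bounded. The parameter drift is thus bounded for every sample and not just on
average. -/
theorem norm_gradQ_param_sub_le {x : Vec d} (hx : x ∈ p.X) {l l' : Vec m} {τ : ℝ} {r r' : ℝ}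
    (hl : ∀ i, |l' i - l i| ≤ τ) (hr : r ≤ r') (b : Ξ × Z × Z) :
    ‖p.gradQ r' x l' b - p.gradQ r x l b‖ ≤ κ.consBound m τ (r' - r) := by
  have e : p.gradQ r' x l' b - p.gradQ r x l b = ∑ i, (l' i - l i) • p.gradC i x b.2.1
      + (r' - r) • ∑ i, p.cTilde i x b.2.2 • p.gradC i x b.2.1 := by
    simp only [gradQ, sub_smul, Finset.sum_sub_distrib]
    abel
  rw [e]
  refine (norm_add_le _ _).trans ?_
  rw [norm_smul, Real.norm_of_nonneg (sub_nonneg.2 hr)]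
  exact add_le_add (norm_sum_smul_le hl fun i => hp.norm_gradC_le i hx _)
    (mul_le_mul_of_nonneg_left (norm_sum_smul_le (fun i => hp.abs_cTilde_le i hx _)
      fun i => hp.norm_gradC_le i hx _) (sub_nonneg.2 hr))

/-- One step of the recursive momentum estimator, averaged over the fresh sample. -/
theorem momentum_error_le (hν : p.SampleLaw ν) {x x' : Vec d} (hx : x ∈ p.X) (hx' : x' ∈ p.X)
    {l l' : Vec m} {Λ τ r r' α : ℝ} (hl : ∀ i, |l i| ≤ Λ) (hl' : ∀ i, |l' i| ≤ Λ)
    (hll : ∀ i, |l' i - l i| ≤ τ) (hr : 0 ≤ r) (hrr : r ≤ r') (hα : 0 ≤ α) (hα1 : α ≤ 1)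
    (e : Vec d) :
    ExpLE ν (fun b => ‖(1 - α) • e + ((p.gradQ r' x' l' b - p.gradL r' x' l')
        - (1 - α) • (p.gradQ r x l b - p.gradL r x l))‖ ^ 2)
      ((1 - α) ^ 2 * ‖e‖ ^ 2
        + (2 * α ^ 2 * (2 * κ.sigF ^ 2 + 2 * (2 * κ.consBound m Λ r') ^ 2)
          + 4 * (κ.lipSq m Λ r * ‖x' - x‖ ^ 2) + 4 * κ.consBound m τ (r' - r) ^ 2)) := by
  have := hν.prob
  have hr' := hr.trans hrr
  have hQ := hp.memLp_gradQ hν hx l hr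
  have hQ' := hp.memLp_gradQ hν hx' l' hr'
  have hDle : ExpLE ν (fun b => ‖p.gradQ r' x' l' b - p.gradQ r x l b‖ ^ 2)
      (2 * (κ.lipSq m Λ r * ‖x' - x‖ ^ 2) + 2 * κ.consBound m τ (r' - r) ^ 2) := by
    refine (((hp.gradQ_lipschitz hν hx' hx hl hr).const_mul (r := 2) (by norm_num)).add
      (expLE_const (μ := ν) (2 * κ.consBound m τ (r' - r) ^ 2))).mono ((hQ'.sub hQ).1.norm.pow 2)
      (fun _ => by positivity) (ae_of_all _ fun b => ?_)
    -- The path goes from x to x' at the old parameters, where mean-square Lipschitz continuity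
    -- applies, and then changes the parameters at x'.
    have e : p.gradQ r' x' l' b - p.gradQ r x l b = (p.gradQ r x' l b - p.gradQ r x l b)
        + (p.gradQ r' x' l' b - p.gradQ r x' l b) := by abel
    rw [e]
    refine (norm_add_sq_le_two _ _).trans ?_
    have := hp.norm_gradQ_param_sub_le hx' hll hrr b
    gcongr
  have hV := hp.variance_gradQ_le hν hx' hl' hr'
  refine (expLE_momentum hQ hQ' (hp.integral_gradQ hν hx l r) (hp.integral_gradQ hν hx' l' r')
    hα hα1 e).le_trans (add_le_add le_rfl ?_)
  have h1 := mul_le_mul_of_nonneg_left hV.2 (by positivity : 0 ≤ 2 * α ^ 2)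
  have h2 := hDle.2
  linarith

/-- `momentum_error_le` with a random past that is independent of the fresh sample. -/
theorem expLE_momentum_step {Ω : Type*} [MeasurableSpace Ω] {P : Measure Ω}
    [IsProbabilityMeasure P] {x x' e : Ω → Vec d} {l l' : Ω → Vec m} {b : Ω → Ξ × Z × Z}
    (hxm : Measurable x) (hlm : Measurable l) (hxm' : Measurable x') (hlm' : Measurable l')
    (hem : Measurable e) (hb : Measurable b)
    (hind : IndepFun (fun ω => (x ω, l ω, x' ω, l' ω, e ω)) b P) (hν : p.SampleLaw (P.map b))
    (hx : ∀ ω, x ω ∈ p.X) (hx' : ∀ ω, x' ω ∈ p.X) {Λ τ r r' α : ℝ}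
    (hl : ∀ ω i, |l ω i| ≤ Λ) (hl' : ∀ ω i, |l' ω i| ≤ Λ)
    (hll : ∀ ω i, |l' ω i - l ω i| ≤ τ) (hr : 0 ≤ r) (hrr : r ≤ r') (hα : 0 ≤ α) (hα1 : α ≤ 1)
    (he : Integrable (fun ω => ‖e ω‖ ^ 2) P) (hd : Integrable (fun ω => ‖x' ω - x ω‖ ^ 2) P) :
    ExpLE P (fun ω => ‖(1 - α) • e ω + ((p.gradQ r' (x' ω) (l' ω) (b ω) - p.gradL r' (x' ω) (l' ω))
        - (1 - α) • (p.gradQ r (x ω) (l ω) (b ω) - p.gradL r (x ω) (l ω)))‖ ^ 2)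
      ((1 - α) ^ 2 * ∫ ω, ‖e ω‖ ^ 2 ∂P
        + (2 * α ^ 2 * (2 * κ.sigF ^ 2 + 2 * (2 * κ.consBound m Λ r') ^ 2)
          + 4 * (κ.lipSq m Λ r * ∫ ω, ‖x' ω - x ω‖ ^ 2 ∂P)
          + 4 * κ.consBound m τ (r' - r) ^ 2)) := by
  have hS := hp.setting
  let h : (Vec d × Vec m × Vec d × Vec m × Vec d) × (Ξ × Z × Z) → ℝ := fun z =>
    ‖(1 - α) • z.1.2.2.2.2
      + ((p.gradQ r' z.1.2.2.1 z.1.2.2.2.1 z.2 - p.gradL r' z.1.2.2.1 z.1.2.2.2.1)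
        - (1 - α) • (p.gradQ r z.1.1 z.1.2.1 z.2 - p.gradL r z.1.1 z.1.2.1))‖ ^ 2
  have hm : Measurable h := by
    have m1 : Measurable fun z : (Vec d × Vec m × Vec d × Vec m × Vec d) × (Ξ × Z × Z) =>
        p.gradQ r z.1.1 z.1.2.1 z.2 :=
      hS.measurable_gradQ r (by fun_prop) (by fun_prop) (by fun_prop)
    have m2 : Measurable fun z : (Vec d × Vec m × Vec d × Vec m × Vec d) × (Ξ × Z × Z) =>
        p.gradQ r' z.1.2.2.1 z.1.2.2.2.1 z.2 :=
      hS.measurable_gradQ r' (by fun_prop) (by fun_prop) (by fun_prop)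
    have m3 : Measurable fun z : (Vec d × Vec m × Vec d × Vec m × Vec d) × (Ξ × Z × Z) =>
        p.gradL r z.1.1 z.1.2.1 := hS.measurable_gradL r (by fun_prop) (by fun_prop)
    have m4 : Measurable fun z : (Vec d × Vec m × Vec d × Vec m × Vec d) × (Ξ × Z × Z) =>
        p.gradL r' z.1.2.2.1 z.1.2.2.2.1 := hS.measurable_gradL r' (by fun_prop) (by fun_prop)
    have m5 : Measurable fun z : (Vec d × Vec m × Vec d × Vec m × Vec d) × (Ξ × Z × Z) =>
        (1 - α) • z.1.2.2.2.2 := (measurable_const_smul (1 - α)).comp (by fun_prop : Measurable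
        fun z : (Vec d × Vec m × Vec d × Vec m × Vec d) × (Ξ × Z × Z) => z.1.2.2.2.2)
    have m6 : Measurable fun z : (Vec d × Vec m × Vec d × Vec m × Vec d) × (Ξ × Z × Z) =>
        (1 - α) • (p.gradQ r z.1.1 z.1.2.1 z.2 - p.gradL r z.1.1 z.1.2.1) :=
      (measurable_const_smul (1 - α)).comp (m1.sub m3)
    exact (m5.add ((m2.sub m4).sub m6)).norm.pow_const 2
  set c1 : ℝ := 2 * α ^ 2 * (2 * κ.sigF ^ 2 + 2 * (2 * κ.consBound m Λ r') ^ 2)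
  set c2 : ℝ := 4 * κ.consBound m τ (r' - r) ^ 2
  set c3 : ℝ := κ.lipSq m Λ r
  let H : Vec d × Vec m × Vec d × Vec m × Vec d → ℝ := fun y =>
    (1 - α) ^ 2 * ‖y.2.2.2.2‖ ^ 2 + (c1 + 4 * (c3 * ‖y.2.2.1 - y.1‖ ^ 2) + c2)
  have i1 : Integrable (fun ω => (1 - α) ^ 2 * ‖e ω‖ ^ 2) P := he.const_mul _
  have i2 : Integrable (fun ω => 4 * (c3 * ‖x' ω - x ω‖ ^ 2)) P := (hd.const_mul _).const_mul _
  have i3 : Integrable (fun ω => c1 + 4 * (c3 * ‖x' ω - x ω‖ ^ 2)) P :=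
    (integrable_const _).add i2
  have i4 : Integrable (fun ω => c1 + 4 * (c3 * ‖x' ω - x ω‖ ^ 2) + c2) P :=
    i3.add (integrable_const _)
  have hval : ∫ ω, H (x ω, l ω, x' ω, l' ω, e ω) ∂P = (1 - α) ^ 2 * ∫ ω, ‖e ω‖ ^ 2 ∂P
        + (c1 + 4 * (c3 * ∫ ω, ‖x' ω - x ω‖ ^ 2 ∂P) + c2) := by
    refine (integral_add i1 i4).trans ?_
    rw [integral_add i3 (integrable_const _), integral_add (integrable_const _) i2]
    simp only [integral_const_mul, integral_const, probReal_univ, one_smul]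
  rw [← hval]
  exact expLE_of_indepFun (P := P) (hxm.prodMk (hlm.prodMk (hxm'.prodMk (hlm'.prodMk hem)))) hb
    hind hm (fun z => by positivity) (H := H) (i1.add i4) (fun ω =>
      hp.momentum_error_le hν (hx ω) (hx' ω) (hl ω) (hl' ω) (hll ω) hr hrr hα hα1 (e ω))

theorem hasGradientAt_augL {x : Vec d} (hx : x ∈ p.X) (r : ℝ) (l : Vec m) :
    HasGradientAt (p.augL r l) (p.gradL r x l) x := by
  have hf := (hp.setting.diff_f x hx).hasGradientAt.hasFDerivAt
  have hc := fun i => (hp.setting.diff_c i x hx).hasGradientAt.hasFDerivAt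
  rw [hasGradientAt_iff_hasFDerivAt]
  have h1 := HasFDerivAt.fun_sum (u := Finset.univ) fun i _ => (hc i).const_mul (l i)
  have h2 := (HasFDerivAt.fun_sum (u := Finset.univ) fun i _ => (hc i).pow 2).const_mul (r / 2)
  refine ((hf.add h1).add h2).congr_fderiv ?_
  ext v
  simp [gradL, jacT, cVec, Finset.mul_sum]
  refine Finset.sum_congr rfl fun i _ => ?_
  ring

theorem augL_descent (hν : p.SampleLaw ν) {x y : Vec d} (hx : x ∈ p.X) (hy : y ∈ p.X)
    {l : Vec m} {Λ r : ℝ} (hl : ∀ i, |l i| ≤ Λ) (hr : 0 ≤ r) :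
    p.augL r l y ≤ p.augL r l x + inner ℝ (p.gradL r x l) (y - x)
      + √(κ.lipSq m Λ r) / 2 * ‖y - x‖ ^ 2 :=
  descent_of_lipschitz_gradient hp.setting.convex (fun _ hz => hp.hasGradientAt_augL hz r l)
    (fun _ hx _ hy => hp.norm_gradL_sub_le hν hy hx hl hr) hx hy

end Regular

end Problem

/-! ### Deterministic bounds for the multipliers -/

section DualSteps

variable {m : ℕ}

/-- The largest possible change of a multiplier in iteration `k`. -/
def dualStep (q : Params m) (k : ℕ) : ℝ := q.gamma / ((k : ℝ) * Real.log ((k : ℝ) + 1) ^ 2)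

/-- A bound for the entries of all multipliers. -/
def dualBound (q : Params m) : ℝ :=
  ‖q.lam1‖ + q.gamma * (1 / Real.log 2 ^ 2 + 2 / Real.log 2)

/-- Dividing the step size by |t| removes all dependence on the sample. For t = 0 the increment
vanishes, hence an inequality. -/
theorem abs_gammaSeq_mul_le {q : Params m} (hγ : 0 ≤ q.gamma) (k : ℕ) (t : ℝ) :
    |gammaSeq q k t * t| ≤ dualStep q k := by
  unfold gammaSeq dualStep
  rcases eq_or_ne t 0 with rfl | ht
  · simp only [mul_zero, abs_zero]; positivity
  · have h : 0 < |t| := abs_pos.2 ht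
    rw [abs_mul, abs_of_nonneg (by positivity), ← div_div, div_mul_cancel₀ _ h.ne']

theorem dualStep_nonneg {q : Params m} (hγ : 0 ≤ q.gamma) (k : ℕ) : 0 ≤ dualStep q k := by
  unfold dualStep; positivity

/-- The terms after the first telescope: 1/(x log²(x+1)) ≤ 2/log x - 2/log(x+1) for x ≥ 2. This uses
log(x+1) - log x ≥ 1/(x+1), and the factor 2 comes from 1/x ≤ 2/(x+1). -/
theorem sum_inv_mul_log_sq_le (n : ℕ) :
    ∑ j ∈ Finset.range (n + 1), 1 / (((j + 1 : ℕ) : ℝ) * Real.log (((j + 1 : ℕ) : ℝ) + 1) ^ 2)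
      ≤ 1 / Real.log 2 ^ 2 + 2 / Real.log 2 - 2 / Real.log ((n : ℝ) + 2) := by
  induction n with
  | zero => norm_num
  | succ n ih =>
    rw [Finset.sum_range_succ]
    have hn : (0 : ℝ) ≤ n := n.cast_nonneg
    have e : ((n + 1 + 1 : ℕ) : ℝ) = (n : ℝ) + 2 := by push_cast; ring
    have e' : ((n + 1 : ℕ) : ℝ) + 2 = (n : ℝ) + 2 + 1 := by push_cast; ring
    rw [e, e']
    set x : ℝ := (n : ℝ) + 2 with hx
    have hx2 : 2 ≤ x := by linarith
    have ha : 0 < Real.log x := Real.log_pos (by linarith)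
    have hab : Real.log x ≤ Real.log (x + 1) := Real.log_le_log (by linarith) (by linarith)
    have hdiff : 1 / (x + 1) ≤ Real.log (x + 1) - Real.log x := by
      have h := Real.log_le_sub_one_of_pos (x := x / (x + 1)) (by positivity)
      rw [Real.log_div (by positivity) (by positivity)] at h
      have h2 : x / (x + 1) - 1 = -(1 / (x + 1)) := by field_simp; ring
      linarith
    set a := Real.log x
    set b := Real.log (x + 1)
    have hb : 0 < b := ha.trans_le hab
    have key : 1 / (x * b ^ 2) ≤ 2 / a - 2 / b := by
      have e1 : 2 / a - 2 / b = 2 * (b - a) / (a * b) := by field_simp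
      rw [e1]
      calc 1 / (x * b ^ 2) ≤ 2 * (1 / (x + 1)) / (b * b) := by
            rw [mul_one_div, div_div, div_le_div_iff₀ (by positivity) (by positivity)]
            nlinarith [mul_pos hb hb]
        _ ≤ _ := by gcongr
    linarith

theorem sum_dualStep_le {q : Params m} (hγ : 0 ≤ q.gamma) (n : ℕ) :
    ∑ j ∈ Finset.range n, dualStep q (j + 1)
      ≤ q.gamma * (1 / Real.log 2 ^ 2 + 2 / Real.log 2) := by
  have hl : 0 < Real.log 2 := Real.log_pos (by norm_num)
  rcases n with _ | n
  · simp only [Finset.range_zero, Finset.sum_empty]; positivity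
  · have h := sum_inv_mul_log_sq_le n
    have h2 : 0 ≤ 2 / Real.log ((n : ℝ) + 2) := by
      have : 0 ≤ Real.log ((n : ℝ) + 2) :=
        Real.log_nonneg (by linarith [(n.cast_nonneg : (0 : ℝ) ≤ n)])
      positivity
    calc ∑ j ∈ Finset.range (n + 1), dualStep q (j + 1)
        = q.gamma * ∑ j ∈ Finset.range (n + 1),
            1 / (((j + 1 : ℕ) : ℝ) * Real.log (((j + 1 : ℕ) : ℝ) + 1) ^ 2) := by
          rw [Finset.mul_sum]
          exact Finset.sum_congr rfl fun j _ => by rw [mul_one_div]; rfl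
      _ ≤ _ := by gcongr; linarith

theorem abs_lam1_le {q : Params m} (hγ : 0 ≤ q.gamma) (i : Fin m) : |q.lam1 i| ≤ dualBound q := by
  have hl : 0 < Real.log 2 := Real.log_pos (by norm_num)
  exact (PiLp.norm_apply_le q.lam1 i).trans (le_add_of_nonneg_right (by positivity))

theorem dualBound_nonneg {q : Params m} (hγ : 0 ≤ q.gamma) : 0 ≤ dualBound q := by
  have hl : 0 < Real.log 2 := Real.log_pos (by norm_num)
  unfold dualBound
  positivity

end DualSteps

/-! ### The iterates as random variables adapted to the samples -/

variable {d m : ℕ} {Ξ Z Ω : Type*} [MeasurableSpace Ξ] [MeasurableSpace Z]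

/-- The random state `(x_{n+1}, λ_{n+1}, g_{n+1})`. -/
def iter (p : Problem d m Ξ Z) (κ : Constants) (q : Params m) (x1 : Vec d)
    (B : ℕ → Ω → Ξ × Z × Z) (n : ℕ) (ω : Ω) : State d m :=
  run p κ q x1 (fun j => B j ω) n

/-- The error of the gradient estimator. -/
def gradErr (p : Problem d m Ξ Z) (κ : Constants) (q : Params m) (x1 : Vec d)
    (B : ℕ → Ω → Ξ × Z × Z) (n : ℕ) (ω : Ω) : Vec d :=
  (iter p κ q x1 B n ω).g
    - p.gradL (rhoSeq q (n + 1)) (iter p κ q x1 B n ω).x (iter p κ q x1 B n ω).lam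

/-- The primal displacement in one iteration. -/
def displ (p : Problem d m Ξ Z) (κ : Constants) (q : Params m) (x1 : Vec d)
    (B : ℕ → Ω → Ξ × Z × Z) (n : ℕ) (ω : Ω) : Vec d :=
  (iter p κ q x1 B (n + 1) ω).x - (iter p κ q x1 B n ω).x

/-- The information carried by the samples `B 1, …, B n`. -/
def past (B : ℕ → Ω → Ξ × Z × Z) (n : ℕ) : MeasurableSpace Ω :=
  ⨆ j ∈ Set.Iio n, MeasurableSpace.comap (B (j + 1)) inferInstance

variable {p : Problem d m Ξ Z} {κ : Constants} {q : Params m} {x1 : Vec d}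
  {B : ℕ → Ω → Ξ × Z × Z}

theorem past_mono : Monotone (past B) := fun _ _ h =>
  biSup_mono fun _ hj => lt_of_lt_of_le hj h

theorem measurable_past {j n : ℕ} (h : j < n) : Measurable[past B n] (B (j + 1)) := by
  rw [measurable_iff_comap_le]
  exact le_biSup (fun j => MeasurableSpace.comap (B (j + 1)) inferInstance) (Set.mem_Iio.2 h)

theorem iter_succ_x (n : ℕ) (ω : Ω) : (iter p κ q x1 B (n + 1) ω).x
    = proj p.X ((iter p κ q x1 B n ω).x - etaSeq κ q (n + 1) • (iter p κ q x1 B n ω).g) := rfl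

theorem iter_succ_lam (n : ℕ) (ω : Ω) (i : Fin m) : (iter p κ q x1 B (n + 1) ω).lam i
    = (iter p κ q x1 B n ω).lam i
      + gammaSeq q (n + 1) (p.cTilde i (iter p κ q x1 B n ω).x (B (n + 1) ω).2.2)
        * p.cTilde i (iter p κ q x1 B n ω).x (B (n + 1) ω).2.2 := rfl

theorem iter_succ_g (n : ℕ) (ω : Ω) : (iter p κ q x1 B (n + 1) ω).g
    = p.gradQ (rhoSeq q (n + 2)) (iter p κ q x1 B (n + 1) ω).x (iter p κ q x1 B (n + 1) ω).lam
        (B (n + 2) ω)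
      + (1 - alphaSeq (n + 2)) • ((iter p κ q x1 B n ω).g
        - p.gradQ (rhoSeq q (n + 1)) (iter p κ q x1 B n ω).x (iter p κ q x1 B n ω).lam
          (B (n + 2) ω)) := rfl

/-- The old error is multiplied by 1 - α, and the rest is noise of the sample B (n + 2), of mean
zero given the past. -/
theorem gradErr_succ (n : ℕ) (ω : Ω) : gradErr p κ q x1 B (n + 1) ω
    = (1 - alphaSeq (n + 2)) • gradErr p κ q x1 B n ω
      + ((p.gradQ (rhoSeq q (n + 2)) (iter p κ q x1 B (n + 1) ω).x
            (iter p κ q x1 B (n + 1) ω).lam (B (n + 2) ω)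
          - p.gradL (rhoSeq q (n + 2)) (iter p κ q x1 B (n + 1) ω).x
            (iter p κ q x1 B (n + 1) ω).lam)
        - (1 - alphaSeq (n + 2)) • (p.gradQ (rhoSeq q (n + 1)) (iter p κ q x1 B n ω).x
            (iter p κ q x1 B n ω).lam (B (n + 2) ω)
          - p.gradL (rhoSeq q (n + 1)) (iter p κ q x1 B n ω).x (iter p κ q x1 B n ω).lam)) := by
  unfold gradErr
  rw [iter_succ_g]
  module

theorem iter_x_mem (hS : p.Setting) (hx1 : x1 ∈ p.X) (n : ℕ) (ω : Ω) :
    (iter p κ q x1 B n ω).x ∈ p.X := by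
  cases n with
  | zero => exact hx1
  | succ n => rw [iter_succ_x]; exact proj_mem hS.closed ⟨x1, hx1⟩ _

theorem abs_lam_sub_le (hγ : 0 ≤ q.gamma) (n : ℕ) (ω : Ω) (i : Fin m) :
    |(iter p κ q x1 B (n + 1) ω).lam i - (iter p κ q x1 B n ω).lam i| ≤ dualStep q (n + 1) := by
  rw [iter_succ_lam, add_sub_cancel_left]
  exact abs_gammaSeq_mul_le hγ _ _

theorem abs_lam_le (hγ : 0 ≤ q.gamma) (n : ℕ) (ω : Ω) (i : Fin m) :
    |(iter p κ q x1 B n ω).lam i| ≤ dualBound q := by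
  have h : |(iter p κ q x1 B n ω).lam i| ≤ ‖q.lam1‖ + ∑ j ∈ Finset.range n, dualStep q (j + 1) := by
    induction n with
    | zero => simpa [iter, run] using PiLp.norm_apply_le q.lam1 i
    | succ n ih =>
      rw [Finset.sum_range_succ]
      have h1 := abs_lam_sub_le (p := p) (κ := κ) (x1 := x1) (B := B) hγ n ω i
      have h2 := abs_sub_abs_le_abs_sub ((iter p κ q x1 B (n + 1) ω).lam i)
        ((iter p κ q x1 B n ω).lam i)
      linarith
  exact h.trans (add_le_add le_rfl (sum_dualStep_le hγ n))

/-- The state of index n is (x_{n+1}, λ_{n+1}, g_{n+1}). Its point and multiplier use the samples up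
to B n, while its gradient estimator also uses B (n + 1). Hence the sample entering the next
estimator is independent of both points, both multipliers and the current error. -/
theorem measurable_iter (hS : p.Setting) (hx1 : x1 ∈ p.X) (n : ℕ) :
    Measurable[past B n] (fun ω => (iter p κ q x1 B n ω).x) ∧
    Measurable[past B n] (fun ω => (iter p κ q x1 B n ω).lam) ∧
    Measurable[past B (n + 1)] (fun ω => (iter p κ q x1 B n ω).g) := by
  induction n with
  | zero =>
    refine ⟨measurable_const, measurable_const, ?_⟩
    exact (hS.measurable_gradQ_prod _).comp (measurable_const.prodMk
      (measurable_const.prodMk (measurable_past zero_lt_one)))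
  | succ n ih =>
    obtain ⟨hx, hl, hg⟩ := ih
    have hx' := hx.mono (past_mono n.le_succ) le_rfl
    have hl' := hl.mono (past_mono n.le_succ) le_rfl
    have hB : Measurable[past B (n + 1)] (B (n + 1)) := measurable_past n.lt_succ_self
    have hg' : Measurable[past B (n + 1)]
        (fun ω => etaSeq κ q (n + 1) • (iter p κ q x1 B n ω).g) :=
      (measurable_const_smul (etaSeq κ q (n + 1))).comp hg
    have h1 : Measurable[past B (n + 1)] (fun ω => (iter p κ q x1 B (n + 1) ω).x) :=
      (measurable_proj hS.closed hS.convex ⟨x1, hx1⟩).comp (hx'.sub hg')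
    have h2 : Measurable[past B (n + 1)] (fun ω => (iter p κ q x1 B (n + 1) ω).lam) := by
      refine (PiLp.continuous_toLp 2 _).measurable.comp
        (@measurable_pi_lambda Ω (Fin m) _ (past B (n + 1)) _ _ fun i => ?_)
      have hc : Measurable[past B (n + 1)]
          (fun ω => p.cTilde i (iter p κ q x1 B n ω).x (B (n + 1) ω).2.2) :=
        (hS.measurable_c i).comp
          (hx'.prodMk (measurable_snd.comp (measurable_snd.comp hB)))
      have hli : Measurable[past B (n + 1)] (fun ω => (iter p κ q x1 B n ω).lam i) :=
        (PiLp.continuous_apply 2 _ i).measurable.comp hl'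
      refine hli.add (Measurable.mul ?_ hc)
      unfold gammaSeq
      exact measurable_const.div (measurable_const.mul (measurable_norm.comp hc))
    refine ⟨h1, h2, ?_⟩
    have hB2 : Measurable[past B (n + 2)] (B (n + 2)) := measurable_past (n + 1).lt_succ_self
    have hle := past_mono (B := B) (n + 1).le_succ
    have h3 : Measurable[past B (n + 2)] (fun ω => (1 - alphaSeq (n + 2)) •
        ((iter p κ q x1 B n ω).g - p.gradQ (rhoSeq q (n + 1)) (iter p κ q x1 B n ω).x
          (iter p κ q x1 B n ω).lam (B (n + 2) ω))) :=
      (measurable_const_smul (1 - alphaSeq (n + 2))).comp ((hg.mono hle le_rfl).sub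
        ((hS.measurable_gradQ_prod _).comp
          ((hx'.mono hle le_rfl).prodMk ((hl'.mono hle le_rfl).prodMk hB2))))
    exact ((hS.measurable_gradQ_prod _).comp
      ((h1.mono hle le_rfl).prodMk ((h2.mono hle le_rfl).prodMk hB2))).add h3

theorem measurable_gradErr_past (hS : p.Setting) (hx1 : x1 ∈ p.X) (n : ℕ) :
    Measurable[past B (n + 1)] (gradErr p κ q x1 B n) := by
  obtain ⟨hx, hl, hg⟩ := measurable_iter (κ := κ) (q := q) (B := B) hS hx1 n
  have hx' : Measurable[past B (n + 1)] (fun ω => (iter p κ q x1 B n ω).x) :=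
    hx.mono (past_mono n.le_succ) le_rfl
  have hl' : Measurable[past B (n + 1)] (fun ω => (iter p κ q x1 B n ω).lam) :=
    hl.mono (past_mono n.le_succ) le_rfl
  have h : Measurable[past B (n + 1)] (fun ω => p.gradL (rhoSeq q (n + 1))
      (iter p κ q x1 B n ω).x (iter p κ q x1 B n ω).lam) := by
    have h := (hS.measurable_gradL_prod (rhoSeq q (n + 1))).comp (hx'.prodMk hl')
    simpa only [Function.comp_def] using h
  have e : gradErr p κ q x1 B n = fun ω => (iter p κ q x1 B n ω).g
    - p.gradL (rhoSeq q (n + 1)) (iter p κ q x1 B n ω).x (iter p κ q x1 B n ω).lam := rfl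
  rw [e]
  exact hg.sub h

variable [MeasurableSpace Ω] {P : Measure Ω}

theorem Sampling.past_le (hs : Sampling p P B) (n : ℕ) : past B n ≤ ‹MeasurableSpace Ω› :=
  iSup₂_le fun j _ => (hs.measurable (j + 1) (by omega)).comap_le

/-- The past and the next sample are generated by disjoint sets of indices of an independent family.
-/
theorem Sampling.indepFun_of_past (hs : Sampling p P B) {n : ℕ} {S : Type*} [MeasurableSpace S]
    {Y : Ω → S} (hY : Measurable[past B n] Y) : IndepFun Y (B (n + 1)) P := by
  have h := indep_iSup_of_disjoint (fun j => (hs.measurable (j + 1) (by omega)).comap_le)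
    hs.indep.iIndep (S := Set.Iio n) (T := {n}) (by simp)
  rw [iSup_singleton] at h
  rw [IndepFun_iff_Indep]
  exact indep_of_indep_of_le_left h hY.comap_le

theorem Sampling.sampleLaw [IsProbabilityMeasure P] (hs : Sampling p P B) {k : ℕ} (hk : 1 ≤ k) :
    p.SampleLaw (P.map (B k)) where
  prob := Measure.isProbabilityMeasure_map (hs.measurable k hk).aemeasurable
  map_fst := by
    rw [Measure.map_map measurable_fst (hs.measurable k hk)]; exact hs.lawXi k hk
  map_snd := by
    rw [Measure.map_map measurable_snd (hs.measurable k hk)]; exact hs.lawZeta k hk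

section Measurability

variable (hS : p.Setting) (hs : Sampling p P B) (hx1 : x1 ∈ p.X)
include hS hs hx1

theorem measurable_iter_x (n : ℕ) : Measurable fun ω => (iter p κ q x1 B n ω).x :=
  (measurable_iter hS hx1 n).1.mono (hs.past_le n) le_rfl

theorem measurable_iter_lam (n : ℕ) : Measurable fun ω => (iter p κ q x1 B n ω).lam :=
  (measurable_iter hS hx1 n).2.1.mono (hs.past_le n) le_rfl

theorem measurable_gradErr (n : ℕ) : Measurable (gradErr p κ q x1 B n) :=
  (measurable_gradErr_past hS hx1 n).mono (hs.past_le _) le_rfl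

theorem measurable_displ (n : ℕ) : Measurable (displ p κ q x1 B n) :=
  (measurable_iter_x hS hs hx1 (n + 1)).sub (measurable_iter_x hS hs hx1 n)

end Measurability

theorem rhoSeq_nonneg (hρ : 0 ≤ q.rho) (k : ℕ) : 0 ≤ rhoSeq q k := by
  unfold rhoSeq; positivity

theorem rhoSeq_mono (hρ : 0 ≤ q.rho) (k : ℕ) : rhoSeq q k ≤ rhoSeq q (k + 1) := by
  unfold rhoSeq; gcongr; simp

theorem alphaSeq_nonneg (k : ℕ) : 0 ≤ alphaSeq k := by
  unfold alphaSeq; positivity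

theorem alphaSeq_le_one {k : ℕ} (hk : 1 ≤ k) : alphaSeq k ≤ 1 := by
  unfold alphaSeq
  have h : (1 : ℝ) ≤ (k : ℝ) ^ (4 / 5 : ℝ) :=
    Real.one_le_rpow (by exact_mod_cast hk) (by norm_num)
  rw [div_le_one (by positivity)]
  linarith

theorem etaSeq_pos (hL : 0 < LTildeSq κ q) (hρ : 0 < q.rho) (k : ℕ) : 0 < etaSeq κ q k := by
  unfold etaSeq
  have := Real.sqrt_pos.2 hL
  positivity

/-! ### Second moments of the estimator error and of the displacement -/

section Moments

variable [IsProbabilityMeasure P] (hp : p.Regular κ) (hs : Sampling p P B) (hx1 : x1 ∈ p.X)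
  (hL : 0 < LTildeSq κ q) (hρ : 0 < q.rho) (hγ : 0 ≤ q.gamma)
include hp hs hx1 hρ hγ

theorem expLE_gradErr_zero : ExpLE P (fun ω => ‖gradErr p κ q x1 B 0 ω‖ ^ 2)
    (2 * κ.sigF ^ 2 + 2 * (2 * κ.consBound m (dualBound q) (rhoSeq q 1)) ^ 2) := by
  have h := hp.variance_gradQ_le (hs.sampleLaw le_rfl) hx1 (abs_lam1_le hγ)
    (rhoSeq_nonneg hρ.le 1)
  exact h.comp ⟨hs.measurable 1 le_rfl, rfl⟩

include hL

/-- A crude bound, from nonexpansiveness of the projection and from boundedness of the true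
gradient. It provides integrability, and control of the early iterations, where descent is not yet
available. -/
theorem expLE_displ {n : ℕ} (he : Integrable (fun ω => ‖gradErr p κ q x1 B n ω‖ ^ 2) P) :
    ExpLE P (fun ω => ‖displ p κ q x1 B n ω‖ ^ 2)
      (etaSeq κ q (n + 1) ^ 2 * (2 * ∫ ω, ‖gradErr p κ q x1 B n ω‖ ^ 2 ∂P
        + 2 * (κ.CgradF + κ.consBound m (dualBound q) (rhoSeq q (n + 1))) ^ 2)) := by
  have h1 : ExpLE P (fun ω => ‖gradErr p κ q x1 B n ω‖ ^ 2)
    (∫ ω, ‖gradErr p κ q x1 B n ω‖ ^ 2 ∂P) := ⟨he, le_rfl⟩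
  have h2 := ((h1.const_mul (r := 2) (by norm_num)).add (expLE_const (μ := P)
    (2 * (κ.CgradF + κ.consBound m (dualBound q) (rhoSeq q (n + 1))) ^ 2))).const_mul
    (r := etaSeq κ q (n + 1) ^ 2) (by positivity)
  refine h2.mono ((measurable_displ hp.setting hs hx1 n).norm.pow_const 2).aestronglyMeasurable
    (fun _ => by positivity) (ae_of_all _ fun ω => ?_)
  have hx := iter_x_mem (κ := κ) (q := q) (B := B) hp.setting hx1 n ω
  have h3 := norm_proj_step_le hp.setting.closed hp.setting.convex (etaSeq_pos hL hρ (n + 1)) hx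
    (iter p κ q x1 B n ω).g
  rw [← iter_succ_x] at h3
  have h4 := hp.norm_gradL_le hx (abs_lam_le (p := p) (κ := κ) (x1 := x1) (B := B) hγ n ω)
    (rhoSeq_nonneg hρ.le (n + 1))
  have h5 := norm_add_sq_le_two (gradErr p κ q x1 B n ω)
    (p.gradL (rhoSeq q (n + 1)) (iter p κ q x1 B n ω).x (iter p κ q x1 B n ω).lam)
  have e : gradErr p κ q x1 B n ω + p.gradL (rhoSeq q (n + 1)) (iter p κ q x1 B n ω).x
    (iter p κ q x1 B n ω).lam = (iter p κ q x1 B n ω).g := by unfold gradErr; abel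
  rw [e] at h5
  calc ‖displ p κ q x1 B n ω‖ ^ 2 ≤ (etaSeq κ q (n + 1) * ‖(iter p κ q x1 B n ω).g‖) ^ 2 := by
        gcongr; exact h3
    _ = etaSeq κ q (n + 1) ^ 2 * ‖(iter p κ q x1 B n ω).g‖ ^ 2 := by ring
    _ ≤ _ := by
        refine mul_le_mul_of_nonneg_left (h5.trans ?_) (by positivity)
        gcongr

/-- The momentum inequality with the fresh sample B (n + 2). All other random quantities involved
are measurable with respect to `past B (n + 1)`. -/
theorem expLE_gradErr_succ {n : ℕ} (he : Integrable (fun ω => ‖gradErr p κ q x1 B n ω‖ ^ 2) P) :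
    ExpLE P (fun ω => ‖gradErr p κ q x1 B (n + 1) ω‖ ^ 2)
      ((1 - alphaSeq (n + 2)) ^ 2 * ∫ ω, ‖gradErr p κ q x1 B n ω‖ ^ 2 ∂P
        + (2 * alphaSeq (n + 2) ^ 2 * (2 * κ.sigF ^ 2
            + 2 * (2 * κ.consBound m (dualBound q) (rhoSeq q (n + 2))) ^ 2)
          + 4 * (κ.lipSq m (dualBound q) (rhoSeq q (n + 1))
            * ∫ ω, ‖displ p κ q x1 B n ω‖ ^ 2 ∂P)
          + 4 * κ.consBound m (dualStep q (n + 1)) (rhoSeq q (n + 2) - rhoSeq q (n + 1)) ^ 2)) := by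
  have hS := hp.setting
  have hd := (expLE_displ hp hs hx1 hL hρ hγ he).1
  obtain ⟨hx, hl, hg⟩ := measurable_iter (κ := κ) (q := q) (B := B) hS hx1 n
  obtain ⟨hx', hl', -⟩ := measurable_iter (κ := κ) (q := q) (B := B) hS hx1 (n + 1)
  have hY := (hx.mono (past_mono n.le_succ) le_rfl).prodMk
    ((hl.mono (past_mono n.le_succ) le_rfl).prodMk
      (hx'.prodMk (hl'.prodMk (measurable_gradErr_past (κ := κ) (q := q) hS hx1 n))))
  simp only [gradErr_succ]
  exact hp.expLE_momentum_step (measurable_iter_x hS hs hx1 n) (measurable_iter_lam hS hs hx1 n)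
    (measurable_iter_x hS hs hx1 (n + 1)) (measurable_iter_lam hS hs hx1 (n + 1))
    (measurable_gradErr hS hs hx1 n) (hs.measurable (n + 2) (by omega)) (hs.indepFun_of_past hY)
    (hs.sampleLaw (by omega)) (iter_x_mem hS hx1 n) (iter_x_mem hS hx1 (n + 1))
    (abs_lam_le hγ n) (abs_lam_le hγ (n + 1)) (abs_lam_sub_le hγ n) (rhoSeq_nonneg hρ.le _)
    (rhoSeq_mono hρ.le _) (alphaSeq_nonneg _) (alphaSeq_le_one (by omega)) he hd

/-- Integrability is propagated jointly: a square-integrable error gives a square-integrable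
displacement, and both give a square-integrable next error. -/
theorem integrable_gradErr (n : ℕ) : Integrable (fun ω => ‖gradErr p κ q x1 B n ω‖ ^ 2) P := by
  induction n with
  | zero => exact (expLE_gradErr_zero hp hs hx1 hρ hγ).1
  | succ n ih => exact (expLE_gradErr_succ hp hs hx1 hL hρ hγ ih).1

theorem integrable_displ (n : ℕ) : Integrable (fun ω => ‖displ p κ q x1 B n ω‖ ^ 2) P :=
  (expLE_displ hp hs hx1 hL hρ hγ (integrable_gradErr hp hs hx1 hL hρ hγ n)).1

end Moments

/-! ### Descent, stationarity and infeasibility along the iterates -/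

variable {d m : ℕ} {Ξ Z Ω : Type*} [MeasurableSpace Ξ] [MeasurableSpace Z] [MeasurableSpace Ω]
  {p : Problem d m Ξ Z} {κ : Constants} {q : Params m} {x1 : Vec d}
  {B : ℕ → Ω → Ξ × Z × Z} {P : Measure Ω}

theorem norm_cVec_sq (x : Vec d) : ‖p.cVec x‖ ^ 2 = ∑ i, p.c i x ^ 2 := by
  rw [EuclideanSpace.real_norm_sq_eq]; rfl

theorem jacT_add_smul (x : Vec d) (l l' : Vec m) (r : ℝ) :
    p.jacT x (l + r • l') = p.jacT x l + r • p.jacT x l' := by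
  simp only [Problem.jacT, PiLp.add_apply, PiLp.smul_apply, smul_eq_mul, add_smul,
    Finset.sum_add_distrib, mul_smul, Finset.smul_sum]

theorem abs_sum_mul_c_le (hp : p.Regular κ) {x : Vec d} (hx : x ∈ p.X) {l : Fin m → ℝ} {A : ℝ}
    (hl : ∀ i, |l i| ≤ A) : |∑ i, l i * p.c i x| ≤ m * (A * κ.cBound) := by
  refine (Finset.abs_sum_le_sum_abs _ _).trans ?_
  calc ∑ i, |l i * p.c i x| ≤ ∑ _i : Fin m, A * κ.cBound := by
        refine Finset.sum_le_sum fun i _ => ?_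
        rw [abs_mul]
        exact mul_le_mul (hl i) (hp.abs_c_le i hx) (abs_nonneg _) ((abs_nonneg _).trans (hl i))
    _ = _ := by simp

theorem norm_cVec_sq_le (hp : p.Regular κ) {x : Vec d} (hx : x ∈ p.X) :
    ‖p.cVec x‖ ^ 2 ≤ m * κ.cBound ^ 2 := by
  rw [norm_cVec_sq]
  calc ∑ i, p.c i x ^ 2 ≤ ∑ _i : Fin m, κ.cBound ^ 2 := by
        refine Finset.sum_le_sum fun i _ => ?_
        rw [← sq_abs (p.c i x)]
        have := hp.abs_c_le i hx
        gcongr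
    _ = _ := by simp

/-- The Lipschitz constant in force at iteration `n + 1`. -/
def lipSeq (κ : Constants) (q : Params m) (n : ℕ) : ℝ :=
  √(κ.lipSq m (dualBound q) (rhoSeq q (n + 1)))

/-- The augmented Lagrangian along the iterates. -/
def lagr (p : Problem d m Ξ Z) (κ : Constants) (q : Params m) (x1 : Vec d)
    (B : ℕ → Ω → Ξ × Z × Z) (n : ℕ) (ω : Ω) : ℝ :=
  p.augL (rhoSeq q (n + 1)) (iter p κ q x1 B n ω).lam (iter p κ q x1 B n ω).x

section Pointwise

variable [IsProbabilityMeasure P] (hp : p.Regular κ) (hs : Sampling p P B) (hx1 : x1 ∈ p.X)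
  (hL : 0 < LTildeSq κ q) (hρ : 0 < q.rho) (hγ : 0 ≤ q.gamma)
include hp hs hx1 hL hρ hγ

/-- The descent inequality at frozen parameters is combined with the projection step. The latter
gains D²/η, and Young's inequality gives half of it back against the estimator error. The last two
terms pay for updating the multiplier and the penalty at the new point. -/
theorem lagr_succ_le (n : ℕ) (ω : Ω) : lagr p κ q x1 B (n + 1) ω ≤ lagr p κ q x1 B n ω
    - (1 / (2 * etaSeq κ q (n + 1)) - lipSeq κ q n / 2) * ‖displ p κ q x1 B n ω‖ ^ 2
    + etaSeq κ q (n + 1) / 2 * ‖gradErr p κ q x1 B n ω‖ ^ 2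
    + m * (dualStep q (n + 1) * κ.cBound)
    + (rhoSeq q (n + 2) - rhoSeq q (n + 1)) / 2
      * ‖p.cVec (iter p κ q x1 B (n + 1) ω).x‖ ^ 2 := by
  have hη := etaSeq_pos hL hρ (n + 1)
  have hx := iter_x_mem (κ := κ) (q := q) (B := B) hp.setting hx1 n ω
  have hx' := iter_x_mem (κ := κ) (q := q) (B := B) hp.setting hx1 (n + 1) ω
  have hdes := hp.augL_descent (hs.sampleLaw le_rfl) hx hx'
    (abs_lam_le (p := p) (κ := κ) (x1 := x1) (B := B) hγ n ω) (rhoSeq_nonneg hρ.le (n + 1))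
  have hstep := inner_proj_step_le hp.setting.closed hp.setting.convex hη hx
    (iter p κ q x1 B n ω).g
  rw [← iter_succ_x] at hstep
  have hdual := (le_abs_self _).trans (abs_sum_mul_c_le hp hx'
    (abs_lam_sub_le (p := p) (κ := κ) (x1 := x1) (B := B) hγ n ω))
  have e1 : lagr p κ q x1 B (n + 1) ω = p.augL (rhoSeq q (n + 1)) (iter p κ q x1 B n ω).lam
      (iter p κ q x1 B (n + 1) ω).x
      + ∑ i, ((iter p κ q x1 B (n + 1) ω).lam i - (iter p κ q x1 B n ω).lam i)
        * p.c i (iter p κ q x1 B (n + 1) ω).x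
      + (rhoSeq q (n + 2) - rhoSeq q (n + 1)) / 2
        * ‖p.cVec (iter p κ q x1 B (n + 1) ω).x‖ ^ 2 := by
    simp only [lagr, Problem.augL, norm_cVec_sq, sub_mul, Finset.sum_sub_distrib]
    ring
  have e2 : p.gradL (rhoSeq q (n + 1)) (iter p κ q x1 B n ω).x (iter p κ q x1 B n ω).lam
      = (iter p κ q x1 B n ω).g - gradErr p κ q x1 B n ω := by unfold gradErr; abel
  rw [e2, inner_sub_left] at hdes
  change _ ≤ lagr p κ q x1 B n ω + (inner ℝ _ (displ p κ q x1 B n ω)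
    - inner ℝ _ (displ p κ q x1 B n ω)) + lipSeq κ q n / 2 * ‖displ p κ q x1 B n ω‖ ^ 2 at hdes
  change inner ℝ _ (displ p κ q x1 B n ω) ≤ -(‖displ p κ q x1 B n ω‖ ^ 2 / _) at hstep
  rw [e1]
  have hcs : -inner ℝ (gradErr p κ q x1 B n ω) (displ p κ q x1 B n ω)
      ≤ ‖gradErr p κ q x1 B n ω‖ * ‖displ p κ q x1 B n ω‖ := by
    rw [← inner_neg_left, ← norm_neg (gradErr p κ q x1 B n ω)]
    exact real_inner_le_norm _ _
  set D := ‖displ p κ q x1 B n ω‖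
  set E := ‖gradErr p κ q x1 B n ω‖
  set η := etaSeq κ q (n + 1)
  have hyoung : E * D ≤ η / 2 * E ^ 2 + 1 / (2 * η) * D ^ 2 := by
    have h : η / 2 * E ^ 2 + 1 / (2 * η) * D ^ 2 - E * D = (η * E - D) ^ 2 / (2 * η) := by
      field_simp; ring
    have : 0 ≤ (η * E - D) ^ 2 / (2 * η) := by positivity
    linarith
  have e3 : D ^ 2 / η = 1 / (2 * η) * D ^ 2 + 1 / (2 * η) * D ^ 2 := by field_simp; norm_num
  have e4 : (1 / (2 * η) - lipSeq κ q n / 2) * D ^ 2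
    = 1 / (2 * η) * D ^ 2 - lipSeq κ q n / 2 * D ^ 2 := by ring
  linarith

/-- The projection step certifies its end point for the direction g. The true gradient there differs
from g by the estimator error and by a Lipschitz term in the displacement. -/
theorem stationarity_le (n : ℕ) (ω : Ω) :
    distNegNormal p.X (iter p κ q x1 B (n + 1) ω).x
      (p.gradL (rhoSeq q (n + 1)) (iter p κ q x1 B (n + 1) ω).x (iter p κ q x1 B n ω).lam)
    ≤ (lipSeq κ q n + 1 / etaSeq κ q (n + 1)) * ‖displ p κ q x1 B n ω‖
      + ‖gradErr p κ q x1 B n ω‖ := by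
  have hη := etaSeq_pos hL hρ (n + 1)
  have hx := iter_x_mem (κ := κ) (q := q) (B := B) hp.setting hx1 n ω
  have hx' := iter_x_mem (κ := κ) (q := q) (B := B) hp.setting hx1 (n + 1) ω
  have h1 := distNegNormal_proj_le hp.setting.closed hp.setting.convex ⟨x1, hx1⟩ hη
    (iter p κ q x1 B n ω).x (iter p κ q x1 B n ω).g
    (p.gradL (rhoSeq q (n + 1)) (iter p κ q x1 B (n + 1) ω).x (iter p κ q x1 B n ω).lam)
  rw [← iter_succ_x] at h1
  have h2 := hp.norm_gradL_sub_le (hs.sampleLaw le_rfl) hx' hx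
    (abs_lam_le (p := p) (κ := κ) (x1 := x1) (B := B) hγ n ω) (rhoSeq_nonneg hρ.le (n + 1))
  change _ ≤ _ + ‖displ p κ q x1 B n ω‖ / _ at h1
  change _ ≤ lipSeq κ q n * ‖displ p κ q x1 B n ω‖ at h2
  have e : p.gradL (rhoSeq q (n + 1)) (iter p κ q x1 B (n + 1) ω).x (iter p κ q x1 B n ω).lam
      - (iter p κ q x1 B n ω).g
      = (p.gradL (rhoSeq q (n + 1)) (iter p κ q x1 B (n + 1) ω).x (iter p κ q x1 B n ω).lam
        - p.gradL (rhoSeq q (n + 1)) (iter p κ q x1 B n ω).x (iter p κ q x1 B n ω).lam)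
        - gradErr p κ q x1 B n ω := by unfold gradErr; abel
  rw [e] at h1
  have h3 := norm_sub_le (p.gradL (rhoSeq q (n + 1)) (iter p κ q x1 B (n + 1) ω).x
    (iter p κ q x1 B n ω).lam
    - p.gradL (rhoSeq q (n + 1)) (iter p κ q x1 B n ω).x (iter p κ q x1 B n ω).lam)
    (gradErr p κ q x1 B n ω)
  have e2 : (lipSeq κ q n + 1 / etaSeq κ q (n + 1)) * ‖displ p κ q x1 B n ω‖
    = lipSeq κ q n * ‖displ p κ q x1 B n ω‖ + ‖displ p κ q x1 B n ω‖ / etaSeq κ q (n + 1) := by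
    ring
  linarith

/-- The regularity condition multiplied by the penalty bounds the left side by the distance for the
penalty part of the gradient alone. Adding the bounded objective and multiplier parts changes this
distance by at most a constant, since distance is 1-Lipschitz. -/
theorem infeasibility_le (n : ℕ) {ω : Ω}
    (h5 : κ.delta * ‖p.cVec (iter p κ q x1 B (n + 1) ω).x‖ ≤
      distNegNormal p.X (iter p κ q x1 B (n + 1) ω).x
        (p.jacT (iter p κ q x1 B (n + 1) ω).x (p.cVec (iter p κ q x1 B (n + 1) ω).x))) :
    κ.delta * rhoSeq q (n + 1) * ‖p.cVec (iter p κ q x1 B (n + 1) ω).x‖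
    ≤ (lipSeq κ q n + 1 / etaSeq κ q (n + 1)) * ‖displ p κ q x1 B n ω‖
      + ‖gradErr p κ q x1 B n ω‖ + (κ.CgradF + m * (dualBound q * κ.gradCBound)) := by
  have hx' := iter_x_mem (κ := κ) (q := q) (B := B) hp.setting hx1 (n + 1) ω
  have hr : 0 < rhoSeq q (n + 1) := by unfold rhoSeq; positivity
  have h1 := stationarity_le hp hs hx1 hL hρ hγ n ω
  set x' := (iter p κ q x1 B (n + 1) ω).x
  set l := (iter p κ q x1 B n ω).lam
  have h2 := mul_le_mul_of_nonneg_left h5 hr.le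
  rw [← distNegNormal_smul hr] at h2
  have h3 := distNegNormal_le_add (X := p.X) x' (rhoSeq q (n + 1) • p.jacT x' (p.cVec x'))
    (p.gradL (rhoSeq q (n + 1)) x' l)
  have e : rhoSeq q (n + 1) • p.jacT x' (p.cVec x') - p.gradL (rhoSeq q (n + 1)) x' l
      = -(gradient p.f x' + p.jacT x' l) := by unfold Problem.gradL; abel
  rw [e, norm_neg] at h3
  have h4 := norm_add_le (gradient p.f x') (p.jacT x' l)
  have h6 := hp.a4.gradF x' hx'
  have h7 := hp.norm_jacT_le hx'
    (abs_lam_le (p := p) (κ := κ) (x1 := x1) (B := B) hγ n ω)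
  linarith

end Pointwise

section Expectations

variable (hp : p.Regular κ) (hs : Sampling p P B) (hx1 : x1 ∈ p.X)
  (hL : 0 < LTildeSq κ q) (hρ : 0 < q.rho) (hγ : 0 ≤ q.gamma)
  (ha : AlongIterates p κ q x1 P B)

include hp hs hx1 in
theorem measurable_lagr (n : ℕ) : Measurable (lagr p κ q x1 B n) := by
  have hx := measurable_iter_x (κ := κ) (q := q) hp.setting hs hx1 n
  have hl := measurable_iter_lam (κ := κ) (q := q) hp.setting hs hx1 n
  have hf : Measurable fun ω => p.f (iter p κ q x1 B n ω).x :=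
    measurable_comp_of_continuousOn
      (fun x hx => (hp.setting.diff_f x hx).continuousAt.continuousWithinAt) hx
      (iter_x_mem hp.setting hx1 n)
  have hc : ∀ i, Measurable fun ω => p.c i (iter p κ q x1 B n ω).x := fun i =>
    (hp.setting.measurable_cfun i).comp hx
  have hli : ∀ i, Measurable fun ω => (iter p κ q x1 B n ω).lam i := fun i => by fun_prop
  unfold lagr Problem.augL
  exact (hf.add (Finset.measurable_fun_sum _ fun i _ => (hli i).mul (hc i))).add
    ((Finset.measurable_fun_sum _ fun i _ => (hc i).pow_const 2).const_mul _)

include hp hx1 hρ hγ ha in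
-- The bound below is uniform in n because the quadratic term is nonnegative. The bound above grows
-- with the penalty, but the sum over iterations uses it only at one fixed index.
theorem lagr_bounds (n : ℕ) : ∀ᵐ ω ∂P,
    -(κ.Bf + m * (dualBound q * κ.cBound)) ≤ lagr p κ q x1 B n ω ∧
    lagr p κ q x1 B n ω ≤ κ.Bf + m * (dualBound q * κ.cBound)
      + rhoSeq q (n + 1) / 2 * (m * κ.cBound ^ 2) := by
  filter_upwards [ha.f_bound (n + 1) (by omega)] with ω hω
  have hx := iter_x_mem (κ := κ) (q := q) (B := B) hp.setting hx1 n ω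
  have h1 := abs_le.1 hω
  change -κ.Bf ≤ p.f (iter p κ q x1 B n ω).x ∧ p.f (iter p κ q x1 B n ω).x ≤ κ.Bf at h1
  have h2 := abs_le.1 (abs_sum_mul_c_le hp hx
    (abs_lam_le (p := p) (κ := κ) (x1 := x1) (B := B) hγ n ω))
  have hr := rhoSeq_nonneg hρ.le (n + 1)
  have h3 := mul_le_mul_of_nonneg_left (norm_cVec_sq_le hp hx)
    (by positivity : 0 ≤ rhoSeq q (n + 1) / 2)
  have h4 : 0 ≤ rhoSeq q (n + 1) / 2 * ‖p.cVec (iter p κ q x1 B n ω).x‖ ^ 2 := by positivity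
  simp only [lagr, Problem.augL]
  rw [norm_cVec_sq] at h3 h4
  constructor <;> linarith

variable [IsProbabilityMeasure P]

include hp hs hx1 hρ hγ ha in
theorem integrable_lagr (n : ℕ) : Integrable (lagr p κ q x1 B n) P := by
  have hb := lagr_bounds hp hx1 hρ hγ ha n
  refine Integrable.of_bound (measurable_lagr hp hs hx1 n).aestronglyMeasurable
    (κ.Bf + m * (dualBound q * κ.cBound) + rhoSeq q (n + 1) / 2 * (m * κ.cBound ^ 2)) ?_
  filter_upwards [hb] with ω hω
  have hr := rhoSeq_nonneg hρ.le (n + 1)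
  have : 0 ≤ rhoSeq q (n + 1) / 2 * (m * κ.cBound ^ 2) := by positivity
  rw [Real.norm_eq_abs, abs_le]
  constructor <;> linarith [hω.1, hω.2]

include hp hs hx1 in
theorem integrable_cVec_sq (n : ℕ) :
    Integrable (fun ω => ‖p.cVec (iter p κ q x1 B n ω).x‖ ^ 2) P := by
  have hm := (hp.setting.measurable_cVec.comp
    (measurable_iter_x (κ := κ) (q := q) hp.setting hs hx1 n)).norm.pow_const 2
  refine Integrable.of_bound hm.aestronglyMeasurable (m * κ.cBound ^ 2) (ae_of_all _ fun ω => ?_)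
  have := norm_cVec_sq_le hp (iter_x_mem (κ := κ) (q := q) (B := B) hp.setting hx1 n ω)
  rwa [Real.norm_of_nonneg (by positivity)]

include hp hx1 hρ hγ ha hs in
theorem integral_lagr_bounds (n : ℕ) :
    -(κ.Bf + m * (dualBound q * κ.cBound)) ≤ ∫ ω, lagr p κ q x1 B n ω ∂P ∧
    ∫ ω, lagr p κ q x1 B n ω ∂P ≤ κ.Bf + m * (dualBound q * κ.cBound)
      + rhoSeq q (n + 1) / 2 * (m * κ.cBound ^ 2) := by
  have hb := lagr_bounds hp hx1 hρ hγ ha n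
  have hi := integrable_lagr hp hs hx1 hρ hγ ha n
  constructor
  · have := integral_mono_ae (integrable_const _) hi (hb.mono fun ω h => h.1)
    simpa using this
  · have := integral_mono_ae hi (integrable_const _) (hb.mono fun ω h => h.2)
    simpa using this

include hp hx1 hρ hγ ha hs hL in
theorem integral_lagr_succ_le (n : ℕ) :
    ∫ ω, lagr p κ q x1 B (n + 1) ω ∂P ≤ ∫ ω, lagr p κ q x1 B n ω ∂P
    - (1 / (2 * etaSeq κ q (n + 1)) - lipSeq κ q n / 2) * ∫ ω, ‖displ p κ q x1 B n ω‖ ^ 2 ∂P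
    + etaSeq κ q (n + 1) / 2 * ∫ ω, ‖gradErr p κ q x1 B n ω‖ ^ 2 ∂P
    + m * (dualStep q (n + 1) * κ.cBound)
    + (rhoSeq q (n + 2) - rhoSeq q (n + 1)) / 2
      * ∫ ω, ‖p.cVec (iter p κ q x1 B (n + 1) ω).x‖ ^ 2 ∂P := by
  have i0 := integrable_lagr hp hs hx1 hρ hγ ha n
  have i1 := (integrable_displ hp hs hx1 hL hρ hγ n).const_mul
    (1 / (2 * etaSeq κ q (n + 1)) - lipSeq κ q n / 2)
  have i2 := (integrable_gradErr hp hs hx1 hL hρ hγ n).const_mul (etaSeq κ q (n + 1) / 2)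
  have i3 := (integrable_cVec_sq (κ := κ) (q := q) hp hs hx1 (n + 1)).const_mul
    ((rhoSeq q (n + 2) - rhoSeq q (n + 1)) / 2)
  have j1 := i0.sub i1
  have j2 := j1.add i2
  have j3 := j2.add (integrable_const (m * (dualStep q (n + 1) * κ.cBound)))
  have h := integral_mono (integrable_lagr hp hs hx1 hρ hγ ha (n + 1)) (j3.add i3)
    (lagr_succ_le hp hs hx1 hL hρ hγ n)
  refine h.trans (le_of_eq ?_)
  rw [integral_add' j3 i3, integral_add' j2 (integrable_const _), integral_add' j1 i2,
    integral_sub' i0 i1]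
  simp only [integral_const_mul, integral_const, probReal_univ, one_smul]

include hp hx1 hρ hγ hs hL in
-- With A = 0 this is the stationarity residual, and with A the bound on the objective and
-- multiplier parts of the gradient it is the right side of `infeasibility_le`.
theorem expLE_stationarity (n : ℕ) (A : ℝ) :
    ExpLE P (fun ω => ((lipSeq κ q n + 1 / etaSeq κ q (n + 1)) * ‖displ p κ q x1 B n ω‖
      + ‖gradErr p κ q x1 B n ω‖ + A) ^ 2)
      (3 * (lipSeq κ q n + 1 / etaSeq κ q (n + 1)) ^ 2 * ∫ ω, ‖displ p κ q x1 B n ω‖ ^ 2 ∂P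
        + 3 * ∫ ω, ‖gradErr p κ q x1 B n ω‖ ^ 2 ∂P + 3 * A ^ 2) := by
  have h1 : ExpLE P _ _ := ⟨integrable_displ hp hs hx1 hL hρ hγ n, le_rfl⟩
  have h2 : ExpLE P _ _ := ⟨integrable_gradErr hp hs hx1 hL hρ hγ n, le_rfl⟩
  have h3 := ((h1.const_mul (r := 3 * (lipSeq κ q n + 1 / etaSeq κ q (n + 1)) ^ 2)
    (by positivity)).add (h2.const_mul (r := 3) (by norm_num))).add
    (expLE_const (μ := P) (3 * A ^ 2))
  refine h3.mono ?_ (fun _ => by positivity) (ae_of_all _ fun ω => ?_)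
  · have m1 := (measurable_displ (κ := κ) (q := q) hp.setting hs hx1 n).norm
    have m2 := (measurable_gradErr (κ := κ) (q := q) hp.setting hs hx1 n).norm
    exact ((((m1.const_mul _).add m2).add_const _).pow_const 2).aestronglyMeasurable
  · have h := norm_add_sq_le_three ((lipSeq κ q n + 1 / etaSeq κ q (n + 1))
      * ‖displ p κ q x1 B n ω‖) ‖gradErr p κ q x1 B n ω‖ A
    simp only [Real.norm_eq_abs, sq_abs] at h
    refine h.trans (le_of_eq ?_)
    ring

include hp hx1 hρ hγ ha hs hL in
theorem integral_cVec_sq_le (hδ : 0 < κ.delta) (n : ℕ) :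
    (κ.delta * rhoSeq q (n + 1)) ^ 2 * ∫ ω, ‖p.cVec (iter p κ q x1 B (n + 1) ω).x‖ ^ 2 ∂P
      ≤ 3 * (lipSeq κ q n + 1 / etaSeq κ q (n + 1)) ^ 2 * ∫ ω, ‖displ p κ q x1 B n ω‖ ^ 2 ∂P
        + 3 * ∫ ω, ‖gradErr p κ q x1 B n ω‖ ^ 2 ∂P
        + 3 * (κ.CgradF + m * (dualBound q * κ.gradCBound)) ^ 2 := by
  have h := expLE_stationarity hp hs hx1 hL hρ hγ n
    (κ.CgradF + m * (dualBound q * κ.gradCBound))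
  rw [← integral_const_mul]
  refine le_trans ?_ h.2
  refine integral_mono_ae ((integrable_cVec_sq hp hs hx1 (n + 1)).const_mul _) h.1 ?_
  filter_upwards [ha.A5 (n + 2) (by omega)] with ω hω
  have h1 := infeasibility_le hp hs hx1 hL hρ hγ n (ω := ω) hω
  have hr := rhoSeq_nonneg hρ.le (n + 1)
  rw [← mul_pow]
  gcongr

end Expectations

/-! ### The recursion of real sequences and its Lyapunov analysis -/

/-- The time scale `t_n = (n + 1)^{1/5}` in which all parameters are polynomial. -/
def scale (n : ℕ) : ℝ := ((n : ℝ) + 1) ^ (1 / 5 : ℝ)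

theorem scale_pow (n : ℕ) : scale n ^ 5 = (n : ℝ) + 1 := by
  unfold scale
  rw [← Real.rpow_natCast, ← Real.rpow_mul (by positivity)]
  norm_num

theorem one_le_scale (n : ℕ) : 1 ≤ scale n := by
  unfold scale
  exact Real.one_le_rpow (by linarith [(n.cast_nonneg : (0 : ℝ) ≤ n)]) (by norm_num)

theorem scale_pos (n : ℕ) : 0 < scale n := zero_lt_one.trans_le (one_le_scale n)

theorem scale_mono : Monotone scale := fun a b h => by
  unfold scale
  have : (a : ℝ) ≤ b := by exact_mod_cast h
  gcongr

theorem scale_succ_pow (n : ℕ) : scale (n + 1) ^ 5 = scale n ^ 5 + 1 := by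
  rw [scale_pow, scale_pow]; push_cast; ring

theorem scale_succ_le (n : ℕ) : scale (n + 1) ≤ 6 / 5 * scale n := by
  have h1 := one_le_scale n
  refine le_of_pow_le_pow_left₀ (n := 5) (by norm_num) (by positivity) ?_
  rw [scale_succ_pow, mul_pow]
  have : 1 ≤ scale n ^ 5 := one_le_pow₀ h1
  norm_num
  linarith

/-- Consecutive fifth powers differ by 1, and u⁵ - t⁵ is u - t times five terms that are each at
least t⁴. -/
theorem scale_succ_sub_le (n : ℕ) : scale (n + 1) - scale n ≤ 1 / (5 * scale n ^ 4) := by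
  have h0 := scale_pos n
  have h1 := scale_mono n.le_succ
  have h2 := scale_succ_pow n
  rw [Nat.succ_eq_add_one] at h1
  set t := scale n
  set u := scale (n + 1)
  rw [le_div_iff₀ (by positivity)]
  have e : u ^ 5 - t ^ 5 = (u - t) * (u ^ 4 + u ^ 3 * t + u ^ 2 * t ^ 2 + u * t ^ 3 + t ^ 4) := by
    ring
  have h3 : 5 * t ^ 4 ≤ u ^ 4 + u ^ 3 * t + u ^ 2 * t ^ 2 + u * t ^ 3 + t ^ 4 := by
    have a1 : t ^ 4 ≤ u ^ 4 := by gcongr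
    have a2 : t ^ 3 * t ≤ u ^ 3 * t := by gcongr
    have a3 : t ^ 2 * t ^ 2 ≤ u ^ 2 * t ^ 2 := by gcongr
    have a4 : t * t ^ 3 ≤ u * t ^ 3 := by gcongr
    nlinarith
  have h4 := mul_le_mul_of_nonneg_left h3 (sub_nonneg.2 h1)
  linarith

/-- A telescoping comparison: 1 = u⁵ - t⁵ ≤ 5(u - t)u⁴ ≤ 5(u³ - t³)u². -/
theorem sum_inv_scale_sq_le (k : ℕ) :
    ∑ n ∈ Finset.range (k + 1), 1 / scale n ^ 2 ≤ 5 * scale k ^ 3 := by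
  induction k with
  | zero => simp [scale]
  | succ k ih =>
    rw [Finset.sum_range_succ]
    have h0 := scale_pos k
    have h1 := scale_mono k.le_succ
    have h2 := scale_succ_pow k
    rw [Nat.succ_eq_add_one] at h1
    set t := scale k
    set u := scale (k + 1)
    have hu : 0 < u := h0.trans_le h1
    have h3 : 1 / u ^ 2 ≤ 5 * u ^ 3 - 5 * t ^ 3 := by
      rw [div_le_iff₀ (by positivity)]
      have e : u ^ 5 - t ^ 5 = (u - t) * (u ^ 4 + u ^ 3 * t + u ^ 2 * t ^ 2 + u * t ^ 3 + t ^ 4) := by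
        ring
      have h3 : u ^ 4 + u ^ 3 * t + u ^ 2 * t ^ 2 + u * t ^ 3 + t ^ 4 ≤ 5 * u ^ 4 := by
        have a1 : t ^ 4 ≤ u ^ 4 := by gcongr
        have a2 : u ^ 3 * t ≤ u ^ 3 * u := by gcongr
        have a3 : u ^ 2 * t ^ 2 ≤ u ^ 2 * u ^ 2 := by gcongr
        have a4 : u * t ^ 3 ≤ u * u ^ 3 := by gcongr
        nlinarith
      have h4 := mul_le_mul_of_nonneg_left h3 (sub_nonneg.2 h1)
      have h5 : (u - t) * u ^ 4 ≤ (u ^ 3 - t ^ 3) * u ^ 2 := by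
        have : (u ^ 3 - t ^ 3) * u ^ 2 - (u - t) * u ^ 4 = (u - t) * (t * (u + t) * u ^ 2) := by ring
        have h6 : 0 ≤ (u - t) * (t * (u + t) * u ^ 2) :=
          mul_nonneg (sub_nonneg.2 h1) (by positivity)
        linarith
      linarith
    linarith

theorem sum_inv_scale_pow_le (k : ℕ) :
    ∑ n ∈ Finset.range (k + 1), 1 / scale n ^ 5 ≤ 1 + Real.log ((k : ℝ) + 1) := by
  have h := harmonic_le_one_add_log (k + 1)
  rw [harmonic] at h
  push_cast at h
  refine le_trans (le_of_eq (Finset.sum_congr rfl fun n _ => ?_)) h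
  rw [scale_pow, one_div]

theorem exists_le_scale (T : ℝ) : ∃ n : ℕ, T ≤ scale n := by
  obtain ⟨n, hn⟩ := exists_nat_ge (|T| ^ 5)
  refine ⟨n, (le_abs_self T).trans ?_⟩
  refine le_of_pow_le_pow_left₀ (n := 5) (by norm_num) (scale_pos n).le ?_
  rw [scale_pow]
  linarith

/-- The inequalities between the expected squared error `s`, the expected squared displacement `d`,
the expected augmented Lagrangian `φ` and the expected squared infeasibility `c`; `M` are Lipschitz
constants, `L` is `L̃ρ`, and `N`, `T` are large constants. -/
structure Recursion (L N T : ℝ) (M s d φ c : ℕ → ℝ) : Prop where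
  s_nonneg : ∀ n, 0 ≤ s n
  d_nonneg : ∀ n, 0 ≤ d n
  M_nonneg : ∀ n, 0 ≤ M n
  s_zero : s 0 ≤ N
  s_succ : ∀ n, s (n + 1) ≤ (1 - 8 / (9 * scale (n + 1) ^ 4)) ^ 2 * s n
    + (2 * (8 / (9 * scale (n + 1) ^ 4)) ^ 2 * (N * scale (n + 1) ^ 2) + 4 * (M n ^ 2 * d n)
      + N / scale n ^ 8)
  φ_succ : ∀ n, φ (n + 1) ≤ φ n - (9 * L * scale (n + 1) ^ 3 / 2 - M n / 2) * d n
    + 1 / (18 * L * scale (n + 1) ^ 3) * s n + N / scale n ^ 5 + N / scale n ^ 4 * c n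
  c_le : ∀ n, c n ≤ N / scale n ^ 2 * (81 * L ^ 2 * scale (n + 1) ^ 6 * d n + s n + 1)
  le_φ : ∀ n, -N ≤ φ n
  φ_le : ∀ n, φ n ≤ N * scale n
  d_le : ∀ n, 81 * L ^ 2 * scale (n + 1) ^ 6 * d n ≤ 2 * s n + N * scale n ^ 2
  M_le : ∀ n, M n ≤ N * scale n
  M_le' : ∀ n, T ≤ scale n → M n ≤ 2 * L * scale n

namespace Recursion

variable {L N T : ℝ} {M s d φ c : ℕ → ℝ}

/-- The Lyapunov function `φ + t / (8 L) s` decreases up to a harmonic error term. -/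
theorem lyapunov_step (h : Recursion L N T M s d φ c) (hL : 0 < L) (hN : 0 ≤ N) {n : ℕ}
    (hT : T ≤ scale n) (hT' : 2000 * N ^ 2 * L ≤ scale n) :
    (81 * L ^ 2 * scale (n + 1) ^ 6 * d n + s n) / (162 * L * scale (n + 1) ^ 3)
      + (φ (n + 1) + scale (n + 1) / (8 * L) * s (n + 1))
    ≤ φ n + scale n / (8 * L) * s n + (N + N ^ 2 + N / L) * (1 / scale n ^ 5) := by
  have h1 := one_le_scale n
  have htu := scale_mono n.le_succ
  have hu65 := scale_succ_le n
  have hsub := scale_succ_sub_le n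
  have hφ := h.φ_succ n
  have hs := h.s_succ n
  have hc := h.c_le n
  have hs0 := h.s_nonneg n
  have hd0 := h.d_nonneg n
  have hM0 := h.M_nonneg n
  have hM := h.M_le' n hT
  rw [Nat.succ_eq_add_one] at htu
  set t := scale n
  set u := scale (n + 1)
  have ht : 0 < t := by linarith
  have hu : 0 < u := by linarith
  have hu1 : 1 ≤ u := by linarith
  have hu3 : u ^ 3 ≤ 1.728 * t ^ 3 := by
    calc u ^ 3 ≤ (6 / 5 * t) ^ 3 := by gcongr
      _ = 1.728 * t ^ 3 := by ring
  have hu6 : u ^ 6 ≤ 3 * t ^ 6 := by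
    calc u ^ 6 = (u ^ 3) ^ 2 := by ring
      _ ≤ (1.728 * t ^ 3) ^ 2 := by gcongr
      _ ≤ 3 * t ^ 6 := by
        have : 0 < t ^ 6 := by positivity
        nlinarith
  have ht3 : t ≤ t ^ 3 := by
    calc t = t ^ 1 := (pow_one t).symm
      _ ≤ t ^ 3 := pow_le_pow_right₀ h1 (by norm_num)
  have hinv : 1 / t ^ 3 ≤ 1.728 / u ^ 3 := by
    rw [div_le_div_iff₀ (by positivity) (by positivity)]; linarith
  -- the three contributions to the coefficient of `s n`
  have f1 : u / (8 * L) * (1 - 8 / (9 * u ^ 4)) ^ 2 ≤ u / (8 * L) - (1 / 9) * (1 / (L * u ^ 3)) := by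
    have ha : 0 ≤ 8 / (9 * u ^ 4) := by positivity
    have ha1 : 8 / (9 * u ^ 4) ≤ 1 := by
      rw [div_le_one (by positivity)]
      have : 1 ≤ u ^ 4 := one_le_pow₀ hu1
      linarith
    have e : u / (8 * L) - (1 / 9) * (1 / (L * u ^ 3)) = u / (8 * L) * (1 - 8 / (9 * u ^ 4)) := by
      field_simp
    rw [e]
    refine mul_le_mul_of_nonneg_left ?_ (by positivity)
    nlinarith
  have f2 : u / (8 * L) ≤ t / (8 * L) + 0.0432 * (1 / (L * u ^ 3)) := by
    have : u - t ≤ 0.3456 * (1 / u ^ 3) := by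
      calc u - t ≤ 1 / (5 * t ^ 4) := hsub
        _ ≤ 1 / (5 * t ^ 3) := by
          gcongr 1 / (5 * ?_)
          exact pow_le_pow_right₀ h1 (by norm_num)
        _ = 1 / 5 * (1 / t ^ 3) := by field_simp
        _ ≤ 1 / 5 * (1.728 / u ^ 3) := by gcongr
        _ = _ := by ring
    have h2 := mul_le_mul_of_nonneg_left this (by positivity : 0 ≤ 1 / (8 * L))
    have e1 : 1 / (8 * L) * (u - t) = u / (8 * L) - t / (8 * L) := by ring
    have e2 : 1 / (8 * L) * (0.3456 * (1 / u ^ 3)) = 0.0432 * (1 / (L * u ^ 3)) := by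
      field_simp; norm_num
    linarith
  -- The threshold in `hT'` enters here and in `g3`. It makes the feedback of the infeasibility,
  -- which is proportional to N²/t⁶, a small fraction of the available decrease.
  have f3 : N ^ 2 / t ^ 6 ≤ 0.001 * (1 / (L * u ^ 3)) := by
    have a1 : N ^ 2 ≤ t ^ 3 / (2000 * L) := by
      rw [le_div_iff₀ (by positivity)]; linarith
    calc N ^ 2 / t ^ 6 ≤ t ^ 3 / (2000 * L) / t ^ 6 := by gcongr
      _ = 1 / (2000 * L) * (1 / t ^ 3) := by field_simp
      _ ≤ 1 / (2000 * L) * (1.728 / u ^ 3) := by gcongr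
      _ = 0.000864 * (1 / (L * u ^ 3)) := by field_simp; norm_num
      _ ≤ _ := by gcongr; norm_num
  -- the three contributions to the coefficient of `d n`
  have hu3' : u ≤ u ^ 3 := by
    calc u = u ^ 1 := (pow_one u).symm
      _ ≤ u ^ 3 := pow_le_pow_right₀ hu1 (by norm_num)
  have g1 : M n / 2 ≤ L * u ^ 3 := by
    have : 2 * L * t ≤ 2 * L * u ^ 3 := by gcongr; linarith
    linarith
  have g2 : u / (8 * L) * (4 * M n ^ 2) ≤ 2 * (L * u ^ 3) := by
    calc u / (8 * L) * (4 * M n ^ 2) ≤ u / (8 * L) * (4 * (2 * L * u) ^ 2) := by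
          gcongr
          exact hM.trans (by gcongr)
      _ = _ := by field_simp; norm_num
  have g3 : N ^ 2 / t ^ 6 * (81 * L ^ 2 * u ^ 6) ≤ 0.2 * (L * u ^ 3) := by
    have a1 : N ^ 2 * L ≤ u ^ 3 / 2000 := by linarith
    calc N ^ 2 / t ^ 6 * (81 * L ^ 2 * u ^ 6) ≤ N ^ 2 / t ^ 6 * (81 * L ^ 2 * (3 * t ^ 6)) := by
          gcongr
      _ = 243 * L * (N ^ 2 * L) := by field_simp; ring
      _ ≤ 243 * L * (u ^ 3 / 2000) := by gcongr
      _ = 0.1215 * (L * u ^ 3) := by ring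
      _ ≤ _ := by gcongr; norm_num
  -- the remaining terms
  have w1 : u / (8 * L) * (2 * (8 / (9 * u ^ 4)) ^ 2 * (N * u ^ 2)) ≤ 1 / 2 * (N / L * (1 / t ^ 5)) := by
    calc u / (8 * L) * (2 * (8 / (9 * u ^ 4)) ^ 2 * (N * u ^ 2))
        = 16 / 81 * (N / L * (1 / u ^ 5)) := by field_simp; ring
      _ ≤ 16 / 81 * (N / L * (1 / t ^ 5)) := by gcongr
      _ ≤ 1 / 2 * (N / L * (1 / t ^ 5)) :=
        mul_le_mul_of_nonneg_right (by norm_num) (by positivity)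
  have w2 : u / (8 * L) * (N / t ^ 8) ≤ 1 / 2 * (N / L * (1 / t ^ 5)) := by
    calc u / (8 * L) * (N / t ^ 8) ≤ (6 / 5 * t) / (8 * L) * (N / t ^ 8) := by gcongr
      _ = 3 / 20 * (N / L * (1 / t ^ 7)) := by field_simp; ring
      _ ≤ 3 / 20 * (N / L * (1 / t ^ 5)) := by gcongr; norm_num
      _ ≤ 1 / 2 * (N / L * (1 / t ^ 5)) :=
        mul_le_mul_of_nonneg_right (by norm_num) (by positivity)
  have w3 : N ^ 2 / t ^ 6 ≤ N ^ 2 * (1 / t ^ 5) := by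
    rw [mul_one_div]
    gcongr
    norm_num
  -- assembling
  have hs' := mul_le_mul_of_nonneg_left hs (by positivity : 0 ≤ u / (8 * L))
  have hc' := mul_le_mul_of_nonneg_left hc (by positivity : 0 ≤ N / t ^ 4)
  have ec : N / t ^ 4 * (N / t ^ 2 * (81 * L ^ 2 * u ^ 6 * d n + s n + 1))
      = N ^ 2 / t ^ 6 * (81 * L ^ 2 * u ^ 6) * d n + N ^ 2 / t ^ 6 * s n + N ^ 2 / t ^ 6 := by
    field_simp
  rw [ec] at hc'
  -- The budget, in units of s/(Lu³): contraction gives 1/9, against 1/18 from descent, 0.0432 from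
  -- the growing weight, 0.001 from infeasibility and 1/162 to be kept. In units of Lu³d: descent
  -- gives 9/2, against 1 from curvature, 2 from the error recursion, 0.2 from infeasibility and 1/2
  -- to be kept.
  have e5 : (81 * L ^ 2 * u ^ 6 * d n + s n) / (162 * L * u ^ 3)
      = 0.5 * (L * u ^ 3 * d n) + 1 / 162 * (1 / (L * u ^ 3) * s n) := by field_simp; ring
  have F1 := mul_le_mul_of_nonneg_right f1 hs0
  have F2 := mul_le_mul_of_nonneg_right f2 hs0
  have F3 := mul_le_mul_of_nonneg_right f3 hs0
  have G1 := mul_le_mul_of_nonneg_right g1 hd0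
  have G2 := mul_le_mul_of_nonneg_right g2 hd0
  have G3 := mul_le_mul_of_nonneg_right g3 hd0
  have S0 : 0 ≤ 1 / (L * u ^ 3) * s n := by positivity
  have D0 : 0 ≤ L * u ^ 3 * d n := by positivity
  have e6 : 1 / (18 * L * u ^ 3) * s n = 1 / 18 * (1 / (L * u ^ 3) * s n) := by field_simp
  rw [e6] at hφ
  rw [e5]
  have e7 : N / t ^ 5 = N * (1 / t ^ 5) := by ring
  rw [e7] at hφ
  linarith

/-- Crude bounds for finitely many iterations. -/
theorem exists_s_le (L N T : ℝ) (hL : 0 < L) (hN : 0 ≤ N) (n : ℕ) :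
    ∃ S : ℝ, 0 ≤ S ∧ ∀ M s d φ c : ℕ → ℝ, Recursion L N T M s d φ c → s n ≤ S := by
  induction n with
  | zero => exact ⟨N, hN, fun M s d φ c h => h.s_zero⟩
  | succ n ih =>
    obtain ⟨S, hS, ih⟩ := ih
    have ht := scale_pos n
    have hu := scale_pos (n + 1)
    set K := 81 * L ^ 2 * scale (n + 1) ^ 6 with hK
    have hK0 : 0 < K := by positivity
    refine ⟨S + (2 * (8 / (9 * scale (n + 1) ^ 4)) ^ 2 * (N * scale (n + 1) ^ 2)
      + 4 * ((N * scale n) ^ 2 * ((2 * S + N * scale n ^ 2) / K)) + N / scale n ^ 8),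
      by positivity, fun M s d φ c h => (h.s_succ n).trans ?_⟩
    have hs := ih M s d φ c h
    have hs0 := h.s_nonneg n
    -- The displacement is bounded through the step length alone, so no smallness condition on n is
    -- required.
    have hd : d n ≤ (2 * S + N * scale n ^ 2) / K := by
      rw [le_div_iff₀ hK0, mul_comm]
      exact (h.d_le n).trans (by linarith)
    have hM := h.M_le n
    have hM0 := h.M_nonneg n
    have hd0 := h.d_nonneg n
    have ha : (1 - 8 / (9 * scale (n + 1) ^ 4)) ^ 2 * s n ≤ S := by
      have h1 : 0 ≤ 8 / (9 * scale (n + 1) ^ 4) := by positivity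
      have h2 : 8 / (9 * scale (n + 1) ^ 4) ≤ 1 := by
        rw [div_le_one (by positivity)]
        have : 1 ≤ scale (n + 1) ^ 4 := one_le_pow₀ (one_le_scale _)
        linarith
      have h3 : (1 - 8 / (9 * scale (n + 1) ^ 4)) ^ 2 ≤ 1 := by nlinarith
      calc _ ≤ 1 * s n := by gcongr
        _ ≤ S := by linarith
    gcongr

/-- Telescoping the Lyapunov inequality leaves a harmonic sum, hence the logarithm, and removing the
weights u⁻³ costs the factor t_k³. The constant is chosen before the sequences, which is what makes
it independent of dimension, problem and run. -/
theorem exists_sum_le (L N T : ℝ) (hL : 0 < L) (hN : 0 ≤ N) :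
    ∃ A : ℝ, 0 ≤ A ∧ ∀ M s d φ c : ℕ → ℝ, Recursion L N T M s d φ c → ∀ k : ℕ,
      ∑ n ∈ Finset.range (k + 1), (81 * L ^ 2 * scale (n + 1) ^ 6 * d n + s n)
        ≤ A * (1 + Real.log ((k : ℝ) + 1)) * scale k ^ 3 := by
  choose S hS0 hS using exists_s_le L N T hL hN
  -- From n₀ on both largeness conditions of the Lyapunov inequality hold. Terms before n₀ are
  -- bounded by E, and the Lyapunov function at n₀ by Q.
  obtain ⟨n₀, hn₀⟩ := exists_le_scale (max T (2000 * N ^ 2 * L))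
  set E : ℕ → ℝ := fun n => (3 * S n + N * scale n ^ 2) / (162 * L * scale (n + 1) ^ 3) with hE
  have hE0 : ∀ n, 0 ≤ E n := fun n => by
    have := hS0 n
    have := scale_pos n
    have := scale_pos (n + 1)
    simp only [hE]
    positivity
  set W := N + N ^ 2 + N / L
  have hW : 0 ≤ W := by positivity
  set R := ∑ n ∈ Finset.range n₀, E n
  have hR : 0 ≤ R := Finset.sum_nonneg fun n _ => hE0 n
  set Q := N * scale n₀ + scale n₀ / (8 * L) * S n₀
  have hQ : 0 ≤ Q := by
    have := hS0 n₀
    have := scale_pos n₀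
    positivity
  -- The factor comes from 162 · (6/5)³ ≤ 280, since u ≤ (6/5) t_k for every index in the sum. The
  -- summand N compensates for the lower bound -N on φ.
  refine ⟨280 * L * (R + Q + N + W), by positivity, ?_⟩
  intro M s d φ c h k
  set b : ℕ → ℝ := fun n => (81 * L ^ 2 * scale (n + 1) ^ 6 * d n + s n)
    / (162 * L * scale (n + 1) ^ 3) with hb
  have hbE : ∀ n, b n ≤ E n := fun n => by
    have h1 := h.d_le n
    have h2 := hS n M s d φ c h
    have := scale_pos (n + 1)
    simp only [hb, hE]
    exact div_le_div_of_nonneg_right (by linarith) (by positivity)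
  have hsumW : ∀ K, 0 ≤ ∑ n ∈ Finset.range K, 1 / scale n ^ 5 := fun K =>
    Finset.sum_nonneg fun n _ => by have := scale_pos n; positivity
  have key : ∀ K, n₀ ≤ K → ∑ n ∈ Finset.range K, b n + (φ K + scale K / (8 * L) * s K)
      ≤ R + Q + W * ∑ n ∈ Finset.range K, 1 / scale n ^ 5 := by
    intro K hK
    induction K, hK using Nat.le_induction with
    | base =>
      have h1 : ∑ n ∈ Finset.range n₀, b n ≤ R := Finset.sum_le_sum fun n _ => hbE n
      have h2 := h.φ_le n₀
      have h3 := mul_le_mul_of_nonneg_left (hS n₀ M s d φ c h)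
        (by have := scale_pos n₀; positivity : 0 ≤ scale n₀ / (8 * L))
      have h4 := mul_nonneg hW (hsumW n₀)
      simp only [Q]
      linarith
    | succ K hK ih =>
      have hsc := hn₀.trans (scale_mono hK)
      have h1 := h.lyapunov_step hL hN ((le_max_left _ _).trans hsc) ((le_max_right _ _).trans hsc)
      rw [Finset.sum_range_succ, Finset.sum_range_succ, mul_add]
      simp only [hb] at ih ⊢
      linarith
  have hlog : 0 ≤ Real.log ((k : ℝ) + 1) :=
    Real.log_nonneg (by linarith [(k.cast_nonneg : (0 : ℝ) ≤ k)])
  have hbsum : ∑ n ∈ Finset.range (k + 1), b n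
      ≤ (R + Q + N + W) * (1 + Real.log ((k : ℝ) + 1)) := by
    have h5 := sum_inv_scale_pow_le k
    have h6 : R + Q + N + W * (1 + Real.log ((k : ℝ) + 1))
        ≤ (R + Q + N + W) * (1 + Real.log ((k : ℝ) + 1)) := by
      have : 0 ≤ (R + Q + N) * Real.log ((k : ℝ) + 1) := by positivity
      linarith
    refine le_trans ?_ h6
    rcases le_total n₀ (k + 1) with hk | hk
    · have h1 := key (k + 1) hk
      have h2 := h.le_φ (k + 1)
      have h3 : 0 ≤ scale (k + 1) / (8 * L) * s (k + 1) := by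
        have := scale_pos (k + 1)
        have := h.s_nonneg (k + 1)
        positivity
      have h4 := mul_le_mul_of_nonneg_left h5 hW
      linarith
    · have h1 : ∑ n ∈ Finset.range (k + 1), b n ≤ R := by
        refine (Finset.sum_le_sum fun n _ => hbE n).trans ?_
        exact Finset.sum_le_sum_of_subset_of_nonneg (Finset.range_mono hk) fun n _ _ => hE0 n
      have h2 : 0 ≤ W * (1 + Real.log ((k : ℝ) + 1)) := by positivity
      linarith
  have hstep : ∀ n ∈ Finset.range (k + 1), 81 * L ^ 2 * scale (n + 1) ^ 6 * d n + s n
      ≤ 280 * L * scale k ^ 3 * b n := by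
    intro n hn
    have hu := scale_pos (n + 1)
    have h1 : scale (n + 1) ≤ 6 / 5 * scale k :=
      (scale_succ_le n).trans (by
        have := scale_mono (Nat.lt_succ_iff.1 (Finset.mem_range.1 hn))
        linarith)
    have h2 : scale (n + 1) ^ 3 ≤ 1.728 * scale k ^ 3 := by
      calc scale (n + 1) ^ 3 ≤ (6 / 5 * scale k) ^ 3 := by gcongr
        _ = _ := by ring
    have hb0 : 0 ≤ b n := by
      have := h.d_nonneg n
      have := h.s_nonneg n
      simp only [hb]
      positivity
    have e : 81 * L ^ 2 * scale (n + 1) ^ 6 * d n + s n = 162 * L * scale (n + 1) ^ 3 * b n := by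
      simp only [hb]
      field_simp
    rw [e]
    have hk := scale_pos k
    refine mul_le_mul_of_nonneg_right ?_ hb0
    have h3 := mul_le_mul_of_nonneg_left h2 (by positivity : 0 ≤ 162 * L)
    have h4 : 0 ≤ L * scale k ^ 3 := by positivity
    linarith
  refine (Finset.sum_le_sum hstep).trans ?_
  rw [← Finset.mul_sum]
  have hk := scale_pos k
  calc 280 * L * scale k ^ 3 * ∑ n ∈ Finset.range (k + 1), b n
      ≤ 280 * L * scale k ^ 3 * ((R + Q + N + W) * (1 + Real.log ((k : ℝ) + 1))) := by
        gcongr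
    _ = _ := by ring

end Recursion

/-! ### The parameters as powers of the time scale -/

section Parameters

variable {m : ℕ} {κ : Constants} {q : Params m}

/-- The product `L̃ρ`. -/
def smoothConst (κ : Constants) (q : Params m) : ℝ := √(LTildeSq κ q) * q.rho

/-- The stationarity measures are controlled by the squared error and scaled displacement with
this factor. -/
def certConst (κ : Constants) (q : Params m) : ℝ :=
  3 * (√(κ.lipSq m (dualBound q) q.rho) + 9 * smoothConst κ q) ^ 2 / (81 * smoothConst κ q ^ 2)
    + 3 + 3 * (κ.CgradF + m * (dualBound q * κ.gradCBound)) ^ 2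

/-- A constant that dominates all those in the recursion. -/
def recConst (κ : Constants) (q : Params m) : ℝ :=
  (2 * κ.sigF ^ 2 + 8 * κ.consBound m (dualBound q) q.rho ^ 2)
    + 4 * κ.consBound m (4 * q.gamma) q.rho ^ 2
    + m * (4 * q.gamma * κ.cBound)
    + q.rho
    + certConst κ q / (κ.delta * q.rho) ^ 2
    + (|κ.Bf| + m * (dualBound q * κ.cBound) + q.rho * (m * κ.cBound ^ 2))
    + 2 * (|κ.CgradF| + κ.consBound m (dualBound q) q.rho) ^ 2
    + √(κ.lipSq m (dualBound q) q.rho)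

theorem rhoSeq_eq (q : Params m) (n : ℕ) : rhoSeq q (n + 1) = q.rho * scale n := by
  unfold rhoSeq scale; push_cast; rfl

theorem etaSeq_eq (κ : Constants) (q : Params m) (n : ℕ) :
    etaSeq κ q (n + 1) = 1 / (9 * smoothConst κ q * scale (n + 1) ^ 3) := by
  unfold etaSeq scale smoothConst
  rw [← Real.rpow_natCast, ← Real.rpow_mul (by positivity)]
  norm_num [mul_assoc]

theorem alphaSeq_eq (n : ℕ) : alphaSeq (n + 2) = 8 / (9 * scale (n + 1) ^ 4) := by
  unfold alphaSeq scale
  rw [← Real.rpow_natCast, ← Real.rpow_mul (by positivity)]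
  have e : ((n + 2 : ℕ) : ℝ) = ((n + 1 : ℕ) : ℝ) + 1 := by push_cast; ring
  rw [e]
  norm_num
  field_simp
  norm_num

/-- Since log(n+2) ≥ log 2 > 1/2, the squared logarithm costs a factor 4. Summability has served its
purpose in bounding the multipliers; harmonic decay is enough from here on. -/
theorem dualStep_le (hγ : 0 ≤ q.gamma) (n : ℕ) :
    dualStep q (n + 1) ≤ 4 * q.gamma / scale n ^ 5 := by
  unfold dualStep
  rw [scale_pow]
  have hn : (0 : ℝ) ≤ n := n.cast_nonneg
  push_cast
  have h1 : 1 / 2 ≤ Real.log ((n : ℝ) + 1 + 1) := by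
    have h2 : Real.log 2 ≤ Real.log ((n : ℝ) + 1 + 1) :=
      Real.log_le_log (by norm_num) (by linarith)
    linarith [Real.log_two_gt_d9]
  have h2 : 1 / 4 ≤ Real.log ((n : ℝ) + 1 + 1) ^ 2 := by nlinarith
  rw [div_le_div_iff₀ (by positivity) (by positivity)]
  have h3 : 0 ≤ q.gamma * ((n : ℝ) + 1) := by positivity
  nlinarith

theorem consBound_nonneg (κ : Constants) {Λ r : ℝ} (hΛ : 0 ≤ Λ) (hr : 0 ≤ r) :
    0 ≤ κ.consBound m Λ r := by
  have := κ.gradCBound_nonneg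
  have := κ.cBound_nonneg
  unfold Constants.consBound
  positivity

theorem consBound_mono (κ : Constants) {Λ Λ' r r' : ℝ} (hΛ : Λ ≤ Λ') (hr : r ≤ r') :
    κ.consBound m Λ r ≤ κ.consBound m Λ' r' := by
  have := κ.gradCBound_nonneg
  have := κ.cBound_nonneg
  unfold Constants.consBound
  gcongr

theorem consBound_smul (κ : Constants) (Λ r t : ℝ) :
    κ.consBound m (Λ * t) (r * t) = κ.consBound m Λ r * t := by
  unfold Constants.consBound; ring

theorem consBound_scale_le (κ : Constants) {Λ r t : ℝ} (hΛ : 0 ≤ Λ) (ht : 1 ≤ t) :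
    κ.consBound m Λ (r * t) ≤ κ.consBound m Λ r * t := by
  rw [← consBound_smul]
  exact consBound_mono κ (le_mul_of_one_le_right hΛ ht) le_rfl

theorem lipSeq_le (n : ℕ) :
    lipSeq κ q n ≤ √(κ.lipSq m (dualBound q) q.rho) * scale n := by
  have ht := one_le_scale n
  unfold lipSeq
  rw [rhoSeq_eq]
  refine Real.sqrt_le_iff.2 ⟨by positivity, ?_⟩
  rw [mul_pow, Real.sq_sqrt (κ.lipSq_nonneg m _ _)]
  have h1 : 1 ≤ scale n ^ 2 := one_le_pow₀ ht
  unfold Constants.lipSq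
  have h2 : 0 ≤ 3 * κ.LgradF ^ 2 + 3 * (m : ℝ) ^ 2 * dualBound q ^ 2 * κ.LgradC ^ 2 := by positivity
  nlinarith

/-- The constant L̃ allows for multipliers up to ‖λ₁‖ + 4, whereas `dualBound` depends on γ and may
be larger. Once t exceeds `dualBound`, the growing penalty absorbs the difference, and the squared
Lipschitz constant is at most 4L̃²(ρt)², the coefficients 3 and 6 being four times those in L̃². -/
theorem lipSeq_le_of_large (hρ : 1 < q.rho) (hγ : 0 ≤ q.gamma) {n : ℕ}
    (hn : dualBound q ≤ scale n) : lipSeq κ q n ≤ 2 * smoothConst κ q * scale n := by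
  have ht := one_le_scale n
  have hΛ := dualBound_nonneg hγ
  have hL : 0 ≤ LTildeSq κ q := by unfold LTildeSq; positivity
  have hρ0 : 0 < q.rho := by linarith
  unfold lipSeq smoothConst
  rw [rhoSeq_eq]
  refine Real.sqrt_le_iff.2 ⟨by positivity, ?_⟩
  have e : (2 * (√(LTildeSq κ q) * q.rho) * scale n) ^ 2
      = 4 * LTildeSq κ q * (q.rho * scale n) ^ 2 := by
    rw [mul_pow, mul_pow, mul_pow, Real.sq_sqrt hL]; ring
  rw [e]
  have hr1 : scale n ≤ q.rho * scale n := by nlinarith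
  set r := q.rho * scale n
  have h1 : 1 ≤ r ^ 2 := one_le_pow₀ (ht.trans hr1)
  have h2 : dualBound q ^ 2 ≤ (‖q.lam1‖ + 4) ^ 2 * r ^ 2 := by
    rw [← mul_pow]
    have : dualBound q ≤ (‖q.lam1‖ + 4) * r := by
      have := norm_nonneg q.lam1
      nlinarith
    gcongr
  unfold Constants.lipSq LTildeSq
  have h3 : κ.LgradF ^ 2 ≤ κ.LgradF ^ 2 * r ^ 2 := le_mul_of_one_le_right (by positivity) h1
  have h4 : (m : ℝ) ^ 2 * dualBound q ^ 2 * κ.LgradC ^ 2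
      ≤ (m : ℝ) ^ 2 * ((‖q.lam1‖ + 4) ^ 2 * r ^ 2) * κ.LgradC ^ 2 := by gcongr
  linarith

theorem certConst_nonneg (κ : Constants) (q : Params m) : 0 ≤ certConst κ q := by
  unfold certConst
  positivity

/-- The pieces of `recConst`. -/
theorem le_recConst (hρ : 0 < q.rho) (hγ : 0 ≤ q.gamma) :
    2 * κ.sigF ^ 2 + 8 * κ.consBound m (dualBound q) q.rho ^ 2 ≤ recConst κ q ∧
    4 * κ.consBound m (4 * q.gamma) q.rho ^ 2 ≤ recConst κ q ∧
    m * (4 * q.gamma * κ.cBound) ≤ recConst κ q ∧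
    q.rho ≤ recConst κ q ∧
    certConst κ q / (κ.delta * q.rho) ^ 2 ≤ recConst κ q ∧
    |κ.Bf| + m * (dualBound q * κ.cBound) + q.rho * (m * κ.cBound ^ 2) ≤ recConst κ q ∧
    2 * (|κ.CgradF| + κ.consBound m (dualBound q) q.rho) ^ 2 ≤ recConst κ q ∧
    √(κ.lipSq m (dualBound q) q.rho) ≤ recConst κ q := by
  have h0 := certConst_nonneg κ q
  have h1 := dualBound_nonneg hγ
  have h2 := κ.cBound_nonneg
  have a1 : 0 ≤ 2 * κ.sigF ^ 2 + 8 * κ.consBound m (dualBound q) q.rho ^ 2 := by positivity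
  have a2 : 0 ≤ 4 * κ.consBound m (4 * q.gamma) q.rho ^ 2 := by positivity
  have a3 : 0 ≤ m * (4 * q.gamma * κ.cBound) := by positivity
  have a4 : 0 ≤ certConst κ q / (κ.delta * q.rho) ^ 2 := by positivity
  have a5 : 0 ≤ |κ.Bf| + m * (dualBound q * κ.cBound) + q.rho * (m * κ.cBound ^ 2) := by positivity
  have a6 : 0 ≤ 2 * (|κ.CgradF| + κ.consBound m (dualBound q) q.rho) ^ 2 := by positivity
  have a7 : 0 ≤ √(κ.lipSq m (dualBound q) q.rho) := by positivity
  unfold recConst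
  refine ⟨?_, ?_, ?_, ?_, ?_, ?_, ?_, ?_⟩ <;> linarith

end Parameters

/-! ### The algorithm satisfies the recursion -/

variable {d m : ℕ} {Ξ Z Ω : Type*} [MeasurableSpace Ξ] [MeasurableSpace Z] [MeasurableSpace Ω]
  {p : Problem d m Ξ Z} {κ : Constants} {q : Params m} {x1 : Vec d}
  {B : ℕ → Ω → Ξ × Z × Z} {P : Measure Ω}

/-- The factor 81 L² u⁶ is η⁻², and Lipschitz constants of order t are dominated by η⁻¹, of order
u³. The case A = w = 0 serves stationarity; the case of the full constant A with w = 1 serves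
infeasibility. -/
theorem cert_le (hL : 0 < LTildeSq κ q) (hρ : 0 < q.rho) (n : ℕ) {D S A : ℝ} (hD : 0 ≤ D)
    (hS : 0 ≤ S) (hA : A ^ 2 ≤ (κ.CgradF + m * (dualBound q * κ.gradCBound)) ^ 2)
    {w : ℝ} (hw : 0 ≤ w) (hAw : A ^ 2 ≤ A ^ 2 * w) :
    3 * (lipSeq κ q n + 1 / etaSeq κ q (n + 1)) ^ 2 * D + 3 * S + 3 * A ^ 2
      ≤ certConst κ q * (81 * smoothConst κ q ^ 2 * scale (n + 1) ^ 6 * D + S + w) := by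
  have hs : 0 < smoothConst κ q := mul_pos (Real.sqrt_pos.2 hL) hρ
  have hu1 := one_le_scale (n + 1)
  have hu := scale_pos (n + 1)
  rw [etaSeq_eq, one_div_one_div]
  have hM := lipSeq_le (κ := κ) (q := q) n
  have hM0 : 0 ≤ lipSeq κ q n := Real.sqrt_nonneg _
  set M0 := √(κ.lipSq m (dualBound q) q.rho) with hM0'
  have hM0n : 0 ≤ M0 := Real.sqrt_nonneg _
  set L := smoothConst κ q with hLdef
  set u := scale (n + 1)
  have h1 : lipSeq κ q n + 9 * L * u ^ 3 ≤ (M0 + 9 * L) * u ^ 3 := by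
    have h2 : M0 * scale n ≤ M0 * u ^ 3 := by
      gcongr
      calc scale n ≤ u := scale_mono n.le_succ
        _ = u ^ 1 := (pow_one u).symm
        _ ≤ u ^ 3 := pow_le_pow_right₀ hu1 (by norm_num)
    linarith
  have h2 : 3 * (lipSeq κ q n + 9 * L * u ^ 3) ^ 2 * D
      ≤ 3 * (M0 + 9 * L) ^ 2 / (81 * L ^ 2) * (81 * L ^ 2 * u ^ 6 * D) := by
    calc 3 * (lipSeq κ q n + 9 * L * u ^ 3) ^ 2 * D
        ≤ 3 * ((M0 + 9 * L) * u ^ 3) ^ 2 * D := by gcongr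
      _ = _ := by field_simp
  set X := 81 * L ^ 2 * u ^ 6 * D
  have hX : 0 ≤ X := by positivity
  have e : certConst κ q = 3 * (M0 + 9 * L) ^ 2 / (81 * L ^ 2) + 3
    + 3 * (κ.CgradF + m * (dualBound q * κ.gradCBound)) ^ 2 := rfl
  rw [e]
  set a := 3 * (M0 + 9 * L) ^ 2 / (81 * L ^ 2)
  set F := (κ.CgradF + m * (dualBound q * κ.gradCBound)) ^ 2
  have ha : 0 ≤ a := by positivity
  have hF : 0 ≤ F := by positivity
  have hAF := mul_le_mul_of_nonneg_right hA hw
  have k1 : 0 ≤ 3 * X + 3 * F * X := by positivity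
  have k2 : 0 ≤ a * S + 3 * F * S := by positivity
  have k3 : 0 ≤ a * w + 3 * w := by positivity
  linarith

/-- Everything random enters the remaining argument through these inequalities between expectations,
with constants that depend on κ, m and the parameters only. -/
theorem recursion [IsProbabilityMeasure P] (hp : p.Regular κ) (hs : Sampling p P B)
    (hx1 : x1 ∈ p.X) (hδ : 0 < κ.delta) (hL : 0 < LTildeSq κ q) (hρ : 1 < q.rho)
    (hγ : 0 ≤ q.gamma) (ha : AlongIterates p κ q x1 P B) :
    Recursion (smoothConst κ q) (recConst κ q) (dualBound q) (lipSeq κ q)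
      (fun n => ∫ ω, ‖gradErr p κ q x1 B n ω‖ ^ 2 ∂P)
      (fun n => ∫ ω, ‖displ p κ q x1 B n ω‖ ^ 2 ∂P)
      (fun n => ∫ ω, lagr p κ q x1 B n ω ∂P)
      (fun n => ∫ ω, ‖p.cVec (iter p κ q x1 B (n + 1) ω).x‖ ^ 2 ∂P) := by
  have hρ0 : 0 < q.rho := by linarith
  have hsm : 0 < smoothConst κ q := mul_pos (Real.sqrt_pos.2 hL) hρ0
  have hΛ := dualBound_nonneg hγ
  have hV := κ.cBound_nonneg
  obtain ⟨b1, b2, b3, b4, b5, b6, b7, b8⟩ := le_recConst (κ := κ) hρ0 hγ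
  have hvar : ∀ n, 2 * κ.sigF ^ 2 + 2 * (2 * κ.consBound m (dualBound q) (rhoSeq q (n + 1))) ^ 2
      ≤ recConst κ q * scale n ^ 2 := by
    intro n
    have ht := one_le_scale n
    have h1 : 1 ≤ scale n ^ 2 := one_le_pow₀ ht
    have h2 := consBound_scale_le (m := m) κ (r := q.rho) hΛ ht
    have h3 : 0 ≤ κ.consBound m (dualBound q) (q.rho * scale n) :=
      consBound_nonneg κ hΛ (by positivity)
    rw [rhoSeq_eq]
    calc 2 * κ.sigF ^ 2 + 2 * (2 * κ.consBound m (dualBound q) (q.rho * scale n)) ^ 2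
        ≤ 2 * κ.sigF ^ 2 * scale n ^ 2
          + 2 * (2 * (κ.consBound m (dualBound q) q.rho * scale n)) ^ 2 := by
          refine add_le_add (le_mul_of_one_le_right (by positivity) h1) ?_
          gcongr
      _ = (2 * κ.sigF ^ 2 + 8 * κ.consBound m (dualBound q) q.rho ^ 2) * scale n ^ 2 := by ring
      _ ≤ _ := by gcongr
  refine
    { s_nonneg := fun n => integral_nonneg fun _ => by positivity
      d_nonneg := fun n => integral_nonneg fun _ => by positivity
      M_nonneg := fun n => Real.sqrt_nonneg _
      s_zero := ?_, s_succ := fun n => ?_, φ_succ := fun n => ?_, c_le := fun n => ?_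
      le_φ := fun n => ?_, φ_le := fun n => ?_, d_le := fun n => ?_, M_le := fun n => ?_
      M_le' := fun n hn => lipSeq_le_of_large hρ hγ hn }
  · refine (expLE_gradErr_zero hp hs hx1 hρ0 hγ).2.trans ((hvar 0).trans (le_of_eq ?_))
    simp [scale]
  · have h := (expLE_gradErr_succ hp hs hx1 hL hρ0 hγ
      (integrable_gradErr hp hs hx1 hL hρ0 hγ n)).2
    have e : κ.lipSq m (dualBound q) (rhoSeq q (n + 1)) = lipSeq κ q n ^ 2 :=
      (Real.sq_sqrt (κ.lipSq_nonneg m _ _)).symm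
    rw [alphaSeq_eq, e] at h
    refine h.trans ?_
    have ht := scale_pos n
    have ht1 := one_le_scale n
    have h1 := hvar (n + 1)
    -- The penalty changes by O(t⁻⁴) and the multipliers by O(t⁻⁵). By homogeneity of `consBound`
    -- the squared drift is O(t⁻⁸).
    have hpar : 4 * κ.consBound m (dualStep q (n + 1)) (rhoSeq q (n + 2) - rhoSeq q (n + 1)) ^ 2
        ≤ recConst κ q / scale n ^ 8 := by
      have i1 : dualStep q (n + 1) ≤ 4 * q.gamma * (1 / scale n ^ 4) := by
        refine (dualStep_le hγ n).trans ?_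
        rw [mul_one_div]
        gcongr
        norm_num
      have i2 : rhoSeq q (n + 2) - rhoSeq q (n + 1) ≤ q.rho * (1 / scale n ^ 4) := by
        rw [rhoSeq_eq, rhoSeq_eq, ← mul_sub]
        refine mul_le_mul_of_nonneg_left ((scale_succ_sub_le n).trans ?_) hρ0.le
        have : 0 < scale n ^ 4 := by positivity
        gcongr
        linarith
      have i3 := consBound_mono (m := m) κ i1 i2
      rw [consBound_smul] at i3
      have i4 : 0 ≤ κ.consBound m (dualStep q (n + 1)) (rhoSeq q (n + 2) - rhoSeq q (n + 1)) :=
        consBound_nonneg κ (dualStep_nonneg hγ _) (sub_nonneg.2 (rhoSeq_mono hρ0.le _))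
      calc 4 * κ.consBound m (dualStep q (n + 1)) (rhoSeq q (n + 2) - rhoSeq q (n + 1)) ^ 2
          ≤ 4 * (κ.consBound m (4 * q.gamma) q.rho * (1 / scale n ^ 4)) ^ 2 := by gcongr
        _ = 4 * κ.consBound m (4 * q.gamma) q.rho ^ 2 / scale n ^ 8 := by field_simp
        _ ≤ _ := by gcongr
    gcongr
  · have h := integral_lagr_succ_le hp hs hx1 hL hρ0 hγ ha n
    have hc0 : 0 ≤ ∫ ω, ‖p.cVec (iter p κ q x1 B (n + 1) ω).x‖ ^ 2 ∂P :=
      integral_nonneg fun _ => by positivity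
    have ht := scale_pos n
    have hu := scale_pos (n + 1)
    have i1 : m * (dualStep q (n + 1) * κ.cBound) ≤ recConst κ q / scale n ^ 5 := by
      calc m * (dualStep q (n + 1) * κ.cBound)
          ≤ m * (4 * q.gamma / scale n ^ 5 * κ.cBound) := by gcongr; exact dualStep_le hγ n
        _ = m * (4 * q.gamma * κ.cBound) / scale n ^ 5 := by ring
        _ ≤ _ := by gcongr
    have i2 : (rhoSeq q (n + 2) - rhoSeq q (n + 1)) / 2 ≤ recConst κ q / scale n ^ 4 := by
      rw [rhoSeq_eq, rhoSeq_eq, ← mul_sub]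
      calc q.rho * (scale (n + 1) - scale n) / 2 ≤ q.rho * (1 / (5 * scale n ^ 4)) / 2 := by
            gcongr; exact scale_succ_sub_le n
        _ = 1 / 10 * (q.rho / scale n ^ 4) := by field_simp; norm_num
        _ ≤ 1 * (q.rho / scale n ^ 4) := by gcongr; norm_num
        _ ≤ _ := by rw [one_mul]; gcongr
    have e1 : 1 / (2 * etaSeq κ q (n + 1)) = 9 * smoothConst κ q * scale (n + 1) ^ 3 / 2 := by
      rw [etaSeq_eq]; field_simp
    have e2 : etaSeq κ q (n + 1) / 2 = 1 / (18 * smoothConst κ q * scale (n + 1) ^ 3) := by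
      rw [etaSeq_eq]; field_simp; norm_num
    rw [e1, e2] at h
    have i3 := mul_le_mul_of_nonneg_right i2 hc0
    linarith
  · have h := integral_cVec_sq_le hp hs hx1 hL hρ0 hγ ha hδ n
    have ht := scale_pos n
    have hS0 : 0 ≤ ∫ ω, ‖gradErr p κ q x1 B n ω‖ ^ 2 ∂P := integral_nonneg fun _ => by positivity
    have hD0 : 0 ≤ ∫ ω, ‖displ p κ q x1 B n ω‖ ^ 2 ∂P := integral_nonneg fun _ => by positivity
    have h1 := h.trans (cert_le hL hρ0 n hD0 hS0 le_rfl zero_le_one (by rw [mul_one]))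
    rw [rhoSeq_eq] at h1
    set Y := 81 * smoothConst κ q ^ 2 * scale (n + 1) ^ 6
      * ∫ ω, ‖displ p κ q x1 B n ω‖ ^ 2 ∂P + ∫ ω, ‖gradErr p κ q x1 B n ω‖ ^ 2 ∂P + 1
    have hY : 0 ≤ Y := by positivity
    set c := ∫ ω, ‖p.cVec (iter p κ q x1 B (n + 1) ω).x‖ ^ 2 ∂P
    calc c = (κ.delta * (q.rho * scale n)) ^ 2 * c / (κ.delta * (q.rho * scale n)) ^ 2 := by
          field_simp
      _ ≤ certConst κ q * Y / (κ.delta * (q.rho * scale n)) ^ 2 := by gcongr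
      _ = certConst κ q / (κ.delta * q.rho) ^ 2 / scale n ^ 2 * Y := by field_simp
      _ ≤ _ := by gcongr
  · have h := (integral_lagr_bounds hp hs hx1 hρ0 hγ ha n).1
    have h1 := le_abs_self κ.Bf
    have h2 : 0 ≤ q.rho * (m * κ.cBound ^ 2) := by positivity
    linarith
  · have h := (integral_lagr_bounds hp hs hx1 hρ0 hγ ha n).2
    have ht := one_le_scale n
    have h1 := le_abs_self κ.Bf
    rw [rhoSeq_eq] at h
    have h2 : 0 ≤ |κ.Bf| + m * (dualBound q * κ.cBound) := by positivity
    have h3 : 0 ≤ q.rho * scale n * (m * κ.cBound ^ 2) := by positivity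
    calc _ ≤ κ.Bf + m * (dualBound q * κ.cBound) + q.rho * scale n / 2 * (m * κ.cBound ^ 2) := h
      _ ≤ (|κ.Bf| + m * (dualBound q * κ.cBound)) * scale n
          + q.rho * (m * κ.cBound ^ 2) * scale n := by
          have := le_mul_of_one_le_right h2 ht
          linarith
      _ = (|κ.Bf| + m * (dualBound q * κ.cBound) + q.rho * (m * κ.cBound ^ 2)) * scale n := by ring
      _ ≤ _ := by gcongr
  · have h := (expLE_displ hp hs hx1 hL hρ0 hγ (integrable_gradErr hp hs hx1 hL hρ0 hγ n)).2
    have ht := one_le_scale n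
    have hu := scale_pos (n + 1)
    rw [etaSeq_eq, rhoSeq_eq] at h
    have h2 := consBound_scale_le (m := m) κ (r := q.rho) hΛ ht
    have h3 : 0 ≤ κ.consBound m (dualBound q) (q.rho * scale n) :=
      consBound_nonneg κ hΛ (by positivity)
    have hG : 0 ≤ κ.CgradF := (norm_nonneg _).trans (hp.a4.gradF x1 hx1)
    have h4 : 2 * (κ.CgradF + κ.consBound m (dualBound q) (q.rho * scale n)) ^ 2
        ≤ recConst κ q * scale n ^ 2 := by
      calc 2 * (κ.CgradF + κ.consBound m (dualBound q) (q.rho * scale n)) ^ 2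
          ≤ 2 * (|κ.CgradF| * scale n + κ.consBound m (dualBound q) q.rho * scale n) ^ 2 := by
            gcongr
            exact (le_abs_self _).trans (le_mul_of_one_le_right (abs_nonneg _) ht)
        _ = 2 * (|κ.CgradF| + κ.consBound m (dualBound q) q.rho) ^ 2 * scale n ^ 2 := by ring
        _ ≤ _ := by gcongr
    refine (mul_le_mul_of_nonneg_left h (by positivity)).trans ?_
    refine le_trans (le_of_eq ?_) (add_le_add le_rfl h4)
    field_simp
    norm_num
  · refine (lipSeq_le n).trans ?_
    have := scale_pos n
    gcongr

/-! ### The uniformly random iteration and the choice of its range -/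

theorem uniformOn_Icc_eq (K : ℕ) : (uniformOn (Set.Icc 1 K) : Measure ℕ)
    = (K : ENNReal)⁻¹ • Measure.count.restrict (↑(Finset.Icc 1 K) : Set ℕ) := by
  rw [uniformOn, ProbabilityTheory.cond, ← Finset.coe_Icc, Measure.count_apply_finset]
  simp

theorem ae_uniformOn_Icc (K : ℕ) : ∀ᵐ n ∂(uniformOn (Set.Icc 1 K) : Measure ℕ),
    n ∈ Set.Icc 1 K := by
  rw [uniformOn_Icc_eq, Finset.coe_Icc]
  exact Measure.ae_smul_measure (ae_restrict_mem measurableSet_Icc) _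

theorem integrable_uniformOn_Icc {K : ℕ} (hK : 1 ≤ K) (g : ℕ → ℝ) :
    Integrable g (uniformOn (Set.Icc 1 K)) := by
  have := isProbabilityMeasure_uniformOn (Set.finite_Icc 1 K) ⟨1, Set.mem_Icc.2 ⟨le_rfl, hK⟩⟩
  have h := IntegrableOn.of_finite (μ := uniformOn (Set.Icc 1 K)) (f := g) (Set.finite_Icc 1 K)
  rwa [IntegrableOn, Measure.restrict_eq_self_of_ae_mem (ae_uniformOn_Icc K)] at h

theorem integral_uniformOn_Icc (K : ℕ) (g : ℕ → ℝ) :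
    ∫ n, g n ∂(uniformOn (Set.Icc 1 K)) = (K : ℝ)⁻¹ * ∑ n ∈ Finset.range K, g (n + 1) := by
  have e : ∑ n ∈ Finset.Icc 1 K, g n = ∑ n ∈ Finset.range K, g (n + 1) := by
    induction K with
    | zero => simp
    | succ K ih => rw [Finset.sum_Icc_succ_top (by omega), ih, Finset.sum_range_succ]
  have hi : IntegrableOn g (↑(Finset.Icc 1 K) : Set ℕ) Measure.count := by
    have : IsFiniteMeasure ((Measure.count : Measure ℕ).restrict ↑(Finset.Icc 1 K)) :=
      ⟨by rw [Measure.restrict_apply_univ, Measure.count_apply_finset]; simp⟩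
    have h := IntegrableOn.finset (μ := (Measure.count : Measure ℕ).restrict ↑(Finset.Icc 1 K))
      (s := Finset.Icc 1 K) (f := g)
    rwa [IntegrableOn, Measure.restrict_restrict (Finset.measurableSet _), Set.inter_self] at h
  rw [uniformOn_Icc_eq, integral_smul_measure, setIntegral_finset (hf := hi), ← e]
  simp [Measure.real]

variable {Ω : Type*} [MeasurableSpace Ω] {P : Measure Ω} [IsProbabilityMeasure P]

/-- A mean-square bound, averaged over the iterations, bounds the expectation at a random
iteration. -/
theorem expLE_uniformOn_prod {K : ℕ} (hK : 1 ≤ K) {h : ℕ × Ω → ℝ} (hm : Measurable h)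
    (h0 : ∀ z, 0 ≤ h z) {v : ℕ → ℝ} (hv : ∀ n, ExpLE P (fun ω => h (n + 1, ω) ^ 2) (v n))
    {ε : ℝ} (hε : 0 < ε) (hsum : ∑ n ∈ Finset.range K, v n ≤ K * ε ^ 2) :
    ExpLE ((uniformOn (Set.Icc 1 K)).prod P) h ε := by
  have := isProbabilityMeasure_uniformOn (Set.finite_Icc 1 K) ⟨1, Set.mem_Icc.2 ⟨le_rfl, hK⟩⟩
  -- Young's inequality h ≤ ε/2 + h²/(2ε) replaces Jensen's: averaged over the iterations, each half
  -- contributes at most ε/2.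
  have hone : ∀ n, ExpLE P (fun ω => h (n + 1, ω)) (ε / 2 + 1 / (2 * ε) * v n) := fun n => by
    refine ((expLE_const (μ := P) (ε / 2)).add ((hv n).const_mul (r := 1 / (2 * ε))
      (by positivity))).mono (hm.comp measurable_prodMk_left).aestronglyMeasurable
      (fun _ => h0 _) (ae_of_all _ fun ω => ?_)
    have e : ε / 2 + 1 / (2 * ε) * h (n + 1, ω) ^ 2 - h (n + 1, ω)
        = (ε - h (n + 1, ω)) ^ 2 / (2 * ε) := by field_simp; ring
    have : 0 ≤ (ε - h (n + 1, ω)) ^ 2 / (2 * ε) := by positivity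
    linarith
  have hint : Integrable h ((uniformOn (Set.Icc 1 K)).prod P) := by
    rw [integrable_prod_iff hm.aestronglyMeasurable]
    refine ⟨?_, integrable_uniformOn_Icc hK _⟩
    -- The index 0 has no mass, and the hypothesis says nothing about it.
    filter_upwards [ae_uniformOn_Icc K] with n hn
    obtain ⟨n, rfl⟩ : ∃ j, n = j + 1 := ⟨n - 1, by have := (Set.mem_Icc.1 hn).1; omega⟩
    exact (hone n).1
  refine ⟨hint, ?_⟩
  rw [integral_prod _ hint, integral_uniformOn_Icc]
  have hK0 : (0 : ℝ) < K := by exact_mod_cast hK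
  rw [inv_mul_le_iff₀ hK0]
  calc ∑ n ∈ Finset.range K, ∫ ω, h (n + 1, ω) ∂P
      ≤ ∑ n ∈ Finset.range K, (ε / 2 + 1 / (2 * ε) * v n) :=
        Finset.sum_le_sum fun n _ => (hone n).2
    _ = K * (ε / 2) + 1 / (2 * ε) * ∑ n ∈ Finset.range K, v n := by
        rw [Finset.sum_add_distrib, ← Finset.mul_sum]; simp
    _ ≤ K * (ε / 2) + 1 / (2 * ε) * (K * ε ^ 2) := by gcongr
    _ = K * ε := by field_simp; norm_num

/-- The choice of the iteration number that beats the logarithm. -/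
theorem mul_one_add_log_le {A y T : ℝ} (hA : 0 ≤ A) (hy : 1 ≤ y)
    (hT : (21 * A + 1) * y * (1 + Real.log y) ≤ T) :
    A * (1 + Real.log (T ^ 5)) ≤ (T / y) ^ 2 := by
  have hlogy : 0 ≤ Real.log y := Real.log_nonneg hy
  set D := 21 * A + 1 with hD
  set l := 1 + Real.log y with hl
  have hD1 : 1 ≤ D := by linarith
  have hl1 : 1 ≤ l := by linarith
  have hy0 : 0 < y := by linarith
  have hD0 : 0 < D := by linarith
  have hl0 : 0 < l := by linarith
  -- The ratio v ≥ 1 by which T exceeds the threshold keeps the estimate valid for every larger T,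
  -- and not only at the threshold.
  set v := T / (D * y * l) with hv
  have hpos : 0 < D * y * l := by positivity
  have hv1 : 1 ≤ v := by rw [hv, one_le_div hpos]; exact hT
  have hv0 : 0 < v := by linarith
  have hTe : T = D * y * l * v := by rw [hv]; field_simp
  have hlog : Real.log T = Real.log D + Real.log y + Real.log l + Real.log v := by
    rw [hTe, Real.log_mul (by positivity) (by positivity), Real.log_mul (by positivity)
      (by positivity), Real.log_mul (by positivity) (by positivity)]
  have k1 := Real.log_le_sub_one_of_pos hD0
  have k2 := Real.log_le_sub_one_of_pos hl0
  have k3 := Real.log_le_sub_one_of_pos hv0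
  -- The logarithm of T splits into four logarithms, each at most one of D, l, v and hence at most D
  -- l v. This gives 21 = 1 + 5 · 4.
  have hbound : 1 + Real.log (T ^ 5) ≤ 21 * (D * l * v) := by
    rw [Real.log_pow, hlog]
    push_cast
    have a1 : D ≤ D * l * v := by
      rw [mul_assoc]; exact le_mul_of_one_le_right hD0.le (one_le_mul_of_one_le_of_one_le hl1 hv1)
    have a2 : l ≤ D * l * v := by
      rw [mul_comm D l, mul_assoc]
      exact le_mul_of_one_le_right hl0.le (one_le_mul_of_one_le_of_one_le hD1 hv1)
    have a3 : v ≤ D * l * v :=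
      le_mul_of_one_le_left hv0.le (one_le_mul_of_one_le_of_one_le hD1 hl1)
    linarith
  have hTy : T / y = D * l * v := by rw [hTe]; field_simp
  rw [hTy]
  have hX : 0 < D * l * v := by positivity
  have hDX : D ≤ D * l * v := by
    rw [mul_assoc]; exact le_mul_of_one_le_right hD0.le (one_le_mul_of_one_le_of_one_le hl1 hv1)
  calc A * (1 + Real.log (T ^ 5)) ≤ A * (21 * (D * l * v)) := by gcongr
    _ = 21 * A * (D * l * v) := by ring
    _ ≤ (D * l * v) * (D * l * v) :=
        mul_le_mul_of_nonneg_right (by linarith) hX.le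
    _ = _ := by ring

/-! ### Conclusion for a random iterate -/

/-- Both squared residuals at iteration n + 1 are bounded by multiples of d/η² + s, for
infeasibility with an additional 1/t². Their sums over k + 1 iterations are of order t_k³ log k, to
be compared with (k + 1) ε². -/
theorem stationaryInExpectation {d m : ℕ} {Ξ Z : Type*} [MeasurableSpace Ξ] [MeasurableSpace Z]
    {p : Problem d m Ξ Z} {κ : Constants} {q : Params m} {x1 : Vec d} {B : ℕ → Ω → Ξ × Z × Z}
    (hp : p.Regular κ) (hs : Sampling p P B)
    (hx1 : x1 ∈ p.X) (hδ : 0 < κ.delta) (hL : 0 < LTildeSq κ q) (hρ : 1 < q.rho)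
    (hγ : 0 ≤ q.gamma) (ha : AlongIterates p κ q x1 P B) {A : ℝ} {k : ℕ} (hA : 0 ≤ A)
    (hsum : ∑ n ∈ Finset.range (k + 1), (81 * smoothConst κ q ^ 2 * scale (n + 1) ^ 6
        * ∫ ω, ‖displ p κ q x1 B n ω‖ ^ 2 ∂P + ∫ ω, ‖gradErr p κ q x1 B n ω‖ ^ 2 ∂P)
      ≤ A * (1 + Real.log ((k : ℝ) + 1)) * scale k ^ 3) {ε : ℝ} (hε : 0 < ε)
    (hk : (certConst κ q * A + recConst κ q * (A + 5)) * (1 + Real.log ((k : ℝ) + 1))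
      ≤ (scale k * ε) ^ 2) :
    StationaryInExpectation p ((uniformOn (Set.Icc 1 (k + 1))).prod P)
      (fun a : ℕ × Ω => iterX p κ q x1 B (a.1 + 1) a.2) ε := by
  have hρ0 : 0 < q.rho := by linarith
  have hS := hp.setting
  have hrec := recursion hp hs hx1 hδ hL hρ hγ ha
  have hcert := certConst_nonneg κ q
  have hN : 0 ≤ recConst κ q := hρ0.le.trans (le_recConst (κ := κ) hρ0 hγ).2.2.2.1
  have hlog : 0 ≤ Real.log ((k : ℝ) + 1) :=
    Real.log_nonneg (by linarith [(k.cast_nonneg : (0 : ℝ) ≤ k)])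
  have hsk := scale_pos k
  -- The number of iterations is t_k⁵. Splitting off t_k³, the order of the summed residuals, leaves
  -- the requirement that (t_k ε)² beat a logarithm.
  have hKε : ((k + 1 : ℕ) : ℝ) * ε ^ 2 = (scale k * ε) ^ 2 * scale k ^ 3 := by
    push_cast
    rw [← scale_pow k]
    ring
  have hmx : Measurable fun a : ℕ × Ω => (iter p κ q x1 B a.1 a.2).x :=
    measurable_from_prod_countable_right fun n => measurable_iter_x hS hs hx1 n
  have hml : Measurable fun a : ℕ × Ω => (iter p κ q x1 B (a.1 - 1) a.2).lam
      + rhoSeq q a.1 • p.cVec (iter p κ q x1 B a.1 a.2).x :=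
    measurable_from_prod_countable_right fun n => (measurable_iter_lam hS hs hx1 (n - 1)).add
      ((measurable_const_smul (rhoSeq q n)).comp
        (hS.measurable_cVec.comp (measurable_iter_x hS hs hx1 n)))
  -- The multiplier is λ_k + ρ_k c(x_{k+1}) for k the random index: it turns ∇f + ∇cᵀl into the
  -- augmented Lagrangian gradient at the new point with the old parameters. The shift by 1 reflects
  -- that the state of index n carries the subscript n + 1.
  refine ⟨fun a => (iter p κ q x1 B (a.1 - 1) a.2).lam
      + rhoSeq q a.1 • p.cVec (iter p κ q x1 B a.1 a.2).x, hml, ?_, ?_⟩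
  · have hmg := (Problem.measurable_gradient (F := p.f)).comp hmx
    have hmv : Measurable fun a : ℕ × Ω => gradient p.f (iter p κ q x1 B a.1 a.2).x
        + p.jacT (iter p κ q x1 B a.1 a.2).x ((iter p κ q x1 B (a.1 - 1) a.2).lam
          + rhoSeq q a.1 • p.cVec (iter p κ q x1 B a.1 a.2).x) :=
      hmg.add (Problem.measurable_jacT hmx hml)
    have hmeas := measurable_distNegNormal hS.closed hmx hmv
      (fun a => iter_x_mem (κ := κ) (q := q) (B := B) hS hx1 a.1 a.2)
    refine expLE_uniformOn_prod (by omega) hmeas (fun _ => distNegNormal_nonneg _ _)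
      (v := fun n => certConst κ q * (81 * smoothConst κ q ^ 2 * scale (n + 1) ^ 6
        * ∫ ω, ‖displ p κ q x1 B n ω‖ ^ 2 ∂P + ∫ ω, ‖gradErr p κ q x1 B n ω‖ ^ 2 ∂P))
      (fun n => ?_) hε ?_
    · have h1 := expLE_stationarity hp hs hx1 hL hρ0 hγ n 0
      have h2 := cert_le hL hρ0 n (hrec.d_nonneg n) (hrec.s_nonneg n)
        (A := 0) (by rw [zero_pow two_ne_zero]; positivity) (w := 0) le_rfl (by simp)
      rw [add_zero] at h2
      refine (h1.le_trans h2).mono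
        ((hmeas.comp measurable_prodMk_left).pow_const 2).aestronglyMeasurable
        (fun _ => by positivity) (ae_of_all _ fun ω => ?_)
      have h3 := stationarity_le hp hs hx1 hL hρ0 hγ n ω
      have e : gradient p.f (iter p κ q x1 B (n + 1) ω).x + p.jacT (iter p κ q x1 B (n + 1) ω).x
          ((iter p κ q x1 B (n + 1 - 1) ω).lam
            + rhoSeq q (n + 1) • p.cVec (iter p κ q x1 B (n + 1) ω).x)
          = p.gradL (rhoSeq q (n + 1)) (iter p κ q x1 B (n + 1) ω).x
            (iter p κ q x1 B n ω).lam := by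
        rw [jacT_add_smul, Problem.gradL, Nat.add_sub_cancel, add_assoc]
      have h4 := distNegNormal_nonneg (X := p.X) (iter p κ q x1 B (n + 1) ω).x
        (p.gradL (rhoSeq q (n + 1)) (iter p κ q x1 B (n + 1) ω).x (iter p κ q x1 B n ω).lam)
      simp only [add_zero]
      rw [e]
      gcongr
    · rw [← Finset.mul_sum, hKε]
      refine (mul_le_mul_of_nonneg_left hsum hcert).trans ?_
      have h5 : 0 ≤ recConst κ q * (A + 5) * (1 + Real.log ((k : ℝ) + 1)) := by positivity
      have h6 : certConst κ q * A * (1 + Real.log ((k : ℝ) + 1)) ≤ (scale k * ε) ^ 2 := by linarith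
      have h7 := mul_le_mul_of_nonneg_right h6 (by positivity : 0 ≤ scale k ^ 3)
      linarith
  · have hmeas : Measurable fun a : ℕ × Ω => ‖p.cVec (iter p κ q x1 B a.1 a.2).x‖ :=
      (hS.measurable_cVec.comp hmx).norm
    refine expLE_uniformOn_prod (by omega) hmeas (fun _ => norm_nonneg _)
      (v := fun n => recConst κ q * (81 * smoothConst κ q ^ 2 * scale (n + 1) ^ 6
        * ∫ ω, ‖displ p κ q x1 B n ω‖ ^ 2 ∂P + ∫ ω, ‖gradErr p κ q x1 B n ω‖ ^ 2 ∂P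
        + 1 / scale n ^ 2))
      (fun n => ⟨integrable_cVec_sq hp hs hx1 (n + 1), (hrec.c_le n).trans ?_⟩) hε ?_
    · have ht := one_le_scale n
      have ht0 := scale_pos n
      have hd := hrec.d_nonneg n
      have hsn := hrec.s_nonneg n
      set Y := 81 * smoothConst κ q ^ 2 * scale (n + 1) ^ 6
        * ∫ ω, ‖displ p κ q x1 B n ω‖ ^ 2 ∂P + ∫ ω, ‖gradErr p κ q x1 B n ω‖ ^ 2 ∂P with hY
      have hY0 : 0 ≤ Y := by
        have := scale_pos (n + 1)
        exact add_nonneg (mul_nonneg (by positivity) hd) hsn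
      have h1 : 1 / scale n ^ 2 ≤ 1 := by
        rw [div_le_one (by positivity)]; exact one_le_pow₀ ht
      have h2 := mul_le_mul_of_nonneg_right h1 hY0
      calc recConst κ q / scale n ^ 2 * (Y + 1)
          = recConst κ q * (1 / scale n ^ 2 * Y + 1 / scale n ^ 2) := by ring
        _ ≤ recConst κ q * (Y + 1 / scale n ^ 2) := by gcongr; linarith
    · rw [← Finset.mul_sum, Finset.sum_add_distrib, hKε]
      have h1 := sum_inv_scale_sq_le k
      have h5 : 0 ≤ certConst κ q * A * (1 + Real.log ((k : ℝ) + 1)) := by positivity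
      have h6 : recConst κ q * (A + 5) * (1 + Real.log ((k : ℝ) + 1)) ≤ (scale k * ε) ^ 2 := by
        linarith
      have h7 := mul_le_mul_of_nonneg_right h6 (by positivity : 0 ≤ scale k ^ 3)
      refine le_trans ?_ h7
      have h8 : 5 * scale k ^ 3 ≤ 5 * (1 + Real.log ((k : ℝ) + 1)) * scale k ^ 3 := by
        gcongr; linarith
      have h9 := mul_le_mul_of_nonneg_left (add_le_add hsum (h1.trans h8)) hN
      linarith

end StochALM

end

theorem mainTheorem4 :
    ∃ e : ℕ, ∀ (m : ℕ) (κ : StochALM.Constants) (q : StochALM.Params m),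
      0 < κ.delta → 0 < StochALM.LTildeSq κ q → 1 < q.rho → 0 < q.gamma →
      ∃ C : ℝ, 0 < C ∧
        ∀ (d : ℕ) (Ξ Z Ω : Type*) [MeasurableSpace Ξ] [MeasurableSpace Z] [MeasurableSpace Ω]
          (p : StochALM.Problem d m Ξ Z) (P : MeasureTheory.Measure Ω)
          [MeasureTheory.IsProbabilityMeasure P]
          (B : ℕ → Ω → Ξ × Z × Z) (x1 : StochALM.Vec d),
          p.Setting → p.A2 κ → p.A3 κ → p.A4 κ → x1 ∈ p.X →
          StochALM.Sampling p P B → StochALM.AlongIterates p κ q x1 P B →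
          ∀ (ε : ℝ) (K : ℕ), 0 < ε → ε ≤ 1 →
            C * ε⁻¹ ^ 5 * (1 + Real.log ε⁻¹) ^ e ≤ K →
            StochALM.StationaryInExpectation p
              ((ProbabilityTheory.uniformOn (Set.Icc 1 K)).prod P)
              (fun a : ℕ × Ω => StochALM.iterX p κ q x1 B (a.1 + 1) a.2) ε := by
  -- The threshold for t_k = K^{1/5} is linear in ε⁻¹(1 + log ε⁻¹), so its fifth power carries the
  -- exponent 5 on both factors.
  refine ⟨5, fun m κ q hδ hL hρ hγ => ?_⟩
  have hρ0 : 0 < q.rho := by linarith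
  have hN : 0 ≤ StochALM.recConst κ q :=
    hρ0.le.trans (StochALM.le_recConst (κ := κ) hρ0 hγ.le).2.2.2.1
  have hcert := StochALM.certConst_nonneg κ q
  obtain ⟨A, hA, hsum⟩ := StochALM.Recursion.exists_sum_le (StochALM.smoothConst κ q)
    (StochALM.recConst κ q) (StochALM.dualBound q) (mul_pos (Real.sqrt_pos.2 hL) hρ0) hN
  set A' := StochALM.certConst κ q * A + StochALM.recConst κ q * (A + 5)
  have hA' : 0 ≤ A' := by positivity
  -- With this C the condition on K is the fifth power of the hypothesis of `mul_one_add_log_le` for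
  -- T = t_k and y = ε⁻¹.
  refine ⟨(21 * A' + 1) ^ 5, by positivity, ?_⟩
  intro d Ξ Z Ω _ _ _ p P _ B x1 hS h2 h3 h4 hx1 hs ha ε K hε hε1 hK
  have hy : 1 ≤ ε⁻¹ := (one_le_inv₀ hε).2 hε1
  have hl : 1 ≤ 1 + Real.log ε⁻¹ := by linarith [Real.log_nonneg hy]
  have hKpos : (0 : ℝ) < K := lt_of_lt_of_le (by positivity) hK
  obtain ⟨k, rfl⟩ : ∃ k, K = k + 1 := by
    have : 0 < K := by exact_mod_cast hKpos
    exact ⟨K - 1, by omega⟩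
  have hp : p.Regular κ := ⟨hS, h2, h3, h4⟩
  refine StochALM.stationaryInExpectation hp hs hx1 hδ hL hρ hγ.le ha hA
    (hsum _ _ _ _ _ (StochALM.recursion hp hs hx1 hδ hL hρ hγ.le ha) k) hε ?_
  have hT : (21 * A' + 1) * ε⁻¹ * (1 + Real.log ε⁻¹) ≤ StochALM.scale k := by
    refine le_of_pow_le_pow_left₀ (n := 5) (by norm_num) (StochALM.scale_pos k).le ?_
    rw [StochALM.scale_pow, mul_pow, mul_pow]
    exact_mod_cast hK
  have h := StochALM.mul_one_add_log_le hA' hy hT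
  rwa [StochALM.scale_pow, div_inv_eq_mul] at h
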